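/- Let $k$ be a field of characteristic different from $2$ and $3$, with algebraic closure $\bar k$. Let $d_1,\dots,d_r\ge 2$ be integers, $m+1=d_1+\dots+d_r$, and let $\mathcal A\in k^{n+1}\otimes\bigl(\bigoplus_{l=1}^r \mathrm{Sym}_2 k^{d_l}\bigr)$, i.e. for each $l$ an $(n+1)$-tuple $(A^{(l)}_0,\dots,A^{(l)}_n)$ of symmetric $d_l\times d_l$ matrices over $k$; let $A_i$ be the block-diagonal $(m+1)\times(m+1)$ matrix with blocks $A_i^{(1)},\dots,A_i^{(r)}$. Write $\mathcal A^{(l)}(x)=\sum_i x_iA_i^{(l)}$ and $f_l=\det\mathcal A^{(l)}(\mathbf x)\in k[x_0,\dots,x_n]$, and assume that every $f_l$ is irreducible. Let $X=Z(f_1,\dots,f_r)\subseteq\mathbb P^n$, let $\mathfrak C=Z(\mathbf y^TA_0\mathbf y,\dots,\mathbf y^TA_n\mathbf y)\subseteq\mathbb P^m$ (the Cayley variety), and let $\psi\colon\mathbb P^m\dashrightarrow\widehat{\mathbb P}^n$, $\psi(y)=(y^TA_0y,\dots,y^TA_ny)$. The block spaces are the subspaces $\mathbb P(k^{d_l})\subseteq\mathbb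 P^m$ given by the inclusions of the summands of $k^{m+1}=\bigoplus_l k^{d_l}$. A point $x\in X(\bar k)$ is an essential singularity if $\operatorname{corank}\mathcal A^{(l)}(x)\ge2$ for some $l$. For a set $S$ of blocks, $x$ is a singular point of $X_S=\bigcap_{l\in S}Z(f_l)$ if the gradients $\nabla f_l(x)$, $l\in S$, are linearly dependent. A coincident singularity of $X$ is a non-essential singular point of $X$ that is a singular point of $X_S$ and of $X_T$ for two distinct strict subsets $S\ne T$ of the set of blocks. For a hyperplane $H=Z(h)$ in $\mathbb P^n_{\bar k}$, $\operatorname{sing}(X\cap H)$ denotes the closed subscheme of $X\cap H=Z(f_1,\dots,f_r,h)\subseteq\mathbb P^n_{\bar k}$ defined by the vanishing of the $(r+1)\times(r+1)$ minors of the Jacobian matrix of $(f_1,\dots,f_r,h)$ (if $X\cap H$ is a complete intersection of dimension $n-r-1$, this is its usual singular scheme). Suppose that $\mathfrak C$ has dimension $0$ and that $X$ is a complete intersection, i.e. $\dim X=n-r$. Let $\ell\subseteq\mathbb P^m_{\bar k}$ be a secant line of $\mathfrak C$ (a line that joins two distinct points of $\mathfrak C(\bar k)$ or is tangent to $\mathfrak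 C$ at a point) that, in case $r\ge2$, does not intersect any block space, and let $[H]=\psi(\ell)$. If $X\cap H$ contains no essential singularities and no coincident singularities of $X$, then $\operatorname{sing}(X\cap H)$ contains a closed subscheme of dimension $0$ and degree $n$. -/

import Mathlib

noncomputable section

open MvPolynomial

/-- A tensor in `k^(n+1) ⊗ (⨁ l, Sym₂ k^(d l))`: for each block `l` an `(n+1)`-tuple of symmetric
`d l × d l` matrices (the slices of the block). -/
structure BlockTensor (k : Type*) [Field k] (n : ℕ) {r : ℕ} (d : Fin r → ℕ) where
  slice : (l : Fin r) → Fin (n + 1) → Matrix (Fin (d l)) (Fin (d l)) k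
  symm : ∀ l i, (slice l i).IsSymm

namespace BlockTensor

variable {k : Type*} [Field k] {n r : ℕ} {d : Fin r → ℕ}

/-- Extension of scalars. -/
def baseChange (A : BlockTensor k n d) (K : Type*) [Field K] [Algebra k K] :
    BlockTensor K n d where
  slice l i := (A.slice l i).map (algebraMap k K)
  symm l i := (A.symm l i).map (algebraMap k K)

/-- The `i`-th slice `A_i` of the whole tensor: a block-diagonal symmetric matrix of size
`m + 1 = d_1 + ⋯ + d_r`. The coordinates of `k^(m+1)` are indexed by `Σ l, Fin (d l)`. -/
def bigSlice (A : BlockTensor k n d) (i : Fin (n + 1)) :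
    Matrix (Σ l, Fin (d l)) (Σ l, Fin (d l)) k :=
  Matrix.blockDiagonal' fun l => A.slice l i

/-- The contraction `A(·, y, z) ∈ k^(n+1)`. -/
def pair (A : BlockTensor k n d) (y z : (Σ l, Fin (d l)) → k) : Fin (n + 1) → k :=
  fun i => dotProduct y ((A.bigSlice i).mulVec z)

/-- The map `ψ` on vectors: `ψ(y) = A(·, y, y) = (yᵀ A_0 y, …, yᵀ A_n y)`. -/
def psi (A : BlockTensor k n d) (y : (Σ l, Fin (d l)) → k) : Fin (n + 1) → k :=
  A.pair y y

/-- The contraction `A^(l)(x, ·, ·)` of the `l`-th block by a vector `x`. -/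
def blockAt (A : BlockTensor k n d) (l : Fin r) (x : Fin (n + 1) → k) :
    Matrix (Fin (d l)) (Fin (d l)) k :=
  ∑ i, x i • A.slice l i

/-- The form `det A^(l)(𝐱, ·, ·) ∈ k[x_0, …, x_n]`, an equation of the symmetroid `X_l`. -/
def detForm (A : BlockTensor k n d) (l : Fin r) : MvPolynomial (Fin (n + 1)) k :=
  (∑ i, (X i : MvPolynomial (Fin (n + 1)) k) • (A.slice l i).map C).det

/-- The quadratic form `𝐲ᵀ A_i 𝐲 ∈ k[y_0, …, y_m]`. -/
def quadric (A : BlockTensor k n d) (i : Fin (n + 1)) : MvPolynomial (Σ l, Fin (d l)) k :=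
  dotProduct X (((A.bigSlice i).map C).mulVec X)

/-- The homogeneous ideal that defines the Cayley variety in `ℙ^m`. -/
def cayleyIdeal (A : BlockTensor k n d) : Ideal (MvPolynomial (Σ l, Fin (d l)) k) :=
  Ideal.span (Set.range A.quadric)

/-- The homogeneous ideal that defines `X = X_1 ∩ ⋯ ∩ X_r` in `ℙ^n`. -/
def symmetroidIdeal (A : BlockTensor k n d) : Ideal (MvPolynomial (Fin (n + 1)) k) :=
  Ideal.span (Set.range A.detForm)

end BlockTensor

/-- The closed subscheme of projective space defined by the homogeneous ideal `I` has dimension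
`e`: its affine cone has Krull dimension `e + 1`. -/
def HasProjDim {σ k : Type*} [Field k] (I : Ideal (MvPolynomial σ k)) (e : ℕ) : Prop :=
  ringKrullDim (MvPolynomial σ k ⧸ I) = (e : WithBot ℕ∞) + 1

/-- The ideal `I` is homogeneous: it contains the homogeneous components of its elements. -/
def IsHomogeneousIdeal {σ k : Type*} [Field k] (I : Ideal (MvPolynomial σ k)) : Prop :=
  ∀ f ∈ I, ∀ e, homogeneousComponent e f ∈ I

/-- The Hilbert function of the homogeneous ideal `I`: the dimension of the part of degree `e`
of `k[x] / I`. -/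
def hilbertFn {σ k : Type*} [Field k] (I : Ideal (MvPolynomial σ k)) (e : ℕ) : ℕ :=
  Module.finrank k (homogeneousSubmodule σ k e ⧸
    (I.restrictScalars k).comap (homogeneousSubmodule σ k e).subtype)

/-- For `N ≥ 1`: the closed subscheme of projective space defined by the homogeneous ideal `I` has
dimension `0` and degree `N`, that is, its Hilbert polynomial is the constant `N`. -/
def IsZeroDimOfDegree {σ k : Type*} [Field k] (I : Ideal (MvPolynomial σ k)) (N : ℕ) : Prop :=
  ∃ e₀, ∀ e ≥ e₀, hilbertFn I e = N

/-- The ideal of the singular scheme of the intersection `Z(g)` of `|ι|` hypersurfaces, by the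
Jacobian criterion: it is generated by the `g i` and by the maximal (`|ι| × |ι|`) minors of the
Jacobian matrix `(∂ g i / ∂ x j)`. -/
def singIdeal {ι σ k : Type*} [Fintype ι] [DecidableEq ι] [Field k]
    (g : ι → MvPolynomial σ k) : Ideal (MvPolynomial σ k) :=
  Ideal.span (Set.range g) ⊔
    Ideal.span (Set.range fun c : ι → σ =>
      (Matrix.of fun i j => pderiv (c j) (g i) : Matrix ι ι (MvPolynomial σ k)).det)

/-- The linear form `h_0 x_0 + ⋯ + h_n x_n`. -/
def linForm {k : Type*} [Field k] {n : ℕ} (h : Fin (n + 1) → k) :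
    MvPolynomial (Fin (n + 1)) k :=
  ∑ i, C (h i) * X i

namespace BlockTensor

variable {k : Type*} [Field k] {n r : ℕ} {d : Fin r → ℕ}

/-- The equations `f_1, …, f_r, h` of `X ∩ H`, where `H = Z(h)`. -/
def sectionEqs (A : BlockTensor k n d) (h : Fin (n + 1) → k) :
    Option (Fin r) → MvPolynomial (Fin (n + 1)) k
  | none => linForm h
  | some l => A.detForm l

/-- `X` is a complete intersection: its `r` equations cut out a scheme of dimension `n - r`
(with affine cone of dimension `n + 1 - r`). -/
def IsCompleteIntersection (A : BlockTensor k n d) : Prop :=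
  ringKrullDim (MvPolynomial (Fin (n + 1)) k ⧸ A.symmetroidIdeal) + (r : WithBot ℕ∞)
    = (n : WithBot ℕ∞) + 1

/-- The point `[x]` lies on `X`. -/
def OnX (A : BlockTensor k n d) (x : Fin (n + 1) → k) : Prop :=
  ∀ l, eval x (A.detForm l) = 0

/-- The row `(∂ f_l / ∂ x_0, …, ∂ f_l / ∂ x_n)(x)` of the Jacobian matrix. -/
def jacRow (A : BlockTensor k n d) (x : Fin (n + 1) → k) (l : Fin r) : Fin (n + 1) → k :=
  fun j => eval x (pderiv j (A.detForm l))

/-- The point `[x]` of `X` is a singular point of the intersection of the symmetroids `X_l` with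
`l ∈ S`: the corresponding rows of the Jacobian matrix are linearly dependent at `x`. -/
def SingularOn (A : BlockTensor k n d) (S : Finset (Fin r)) (x : Fin (n + 1) → k) : Prop :=
  ¬ LinearIndependent k fun l : S => A.jacRow x l

/-- `[x]` is an essential singularity of `X`: some block has corank at least `2` at `x`. -/
def IsEssential (A : BlockTensor k n d) (x : Fin (n + 1) → k) : Prop :=
  A.OnX x ∧ ∃ l, (A.blockAt l x).rank + 2 ≤ d l

/-- `[x]` is an accidental singularity of `X`: a singular point that is not essential. -/
def IsAccidental (A : BlockTensor k n d) (x : Fin (n + 1) → k) : Prop :=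
  A.OnX x ∧ A.SingularOn Finset.univ x ∧ ¬ A.IsEssential x

/-- `[x]` is a coincident singularity of `X`: an accidental singularity that is a singular point of
the intersections of symmetroids defined by two distinct strict subsets of the blocks. -/
def IsCoincident (A : BlockTensor k n d) (x : Fin (n + 1) → k) : Prop :=
  A.IsAccidental x ∧ ∃ S T : Finset (Fin r),
    S ≠ T ∧ S ≠ Finset.univ ∧ T ≠ Finset.univ ∧ A.SingularOn S x ∧ A.SingularOn T x

/-- The linear subspace `k^(d l) ⊆ k^(m+1)` whose projectivization is the `l`-th block space. -/
def blockSpace (k : Type*) [Field k] {r : ℕ} (d : Fin r → ℕ) (l : Fin r) :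
    Submodule k ((Σ l, Fin (d l)) → k) where
  carrier := {y | ∀ a, a.1 ≠ l → y a = 0}
  add_mem' hy hz a ha := by simp [hy a ha, hz a ha]
  zero_mem' _ _ := rfl
  smul_mem' c y hy a ha := by simp [hy a ha]

/-- Over an algebraically closed field: the line `ℙ(L)` is a secant line of the Cayley variety.
Either it joins two distinct points `[p]`, `[q]` of the Cayley variety, or it is tangent to it at
a point `[p]`; the derivative of `ψ` at `p` in the direction `q` is `2 A(·, p, q)`. -/
def IsSecant (A : BlockTensor k n d) (L : Submodule k ((Σ l, Fin (d l)) → k)) : Prop :=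
  ∃ p q : (Σ l, Fin (d l)) → k, LinearIndependent k ![p, q] ∧ L = Submodule.span k {p, q} ∧
    A.psi p = 0 ∧ (A.psi q = 0 ∨ A.pair p q = 0)

/-- The image under the rational map `ψ` of the line `ℙ(L)` is the single point `[h]`. -/
def PsiImageEq (A : BlockTensor k n d) (L : Submodule k ((Σ l, Fin (d l)) → k))
    (h : Fin (n + 1) → k) : Prop :=
  h ≠ 0 ∧ (∀ y ∈ L, ∃ c : k, A.psi y = c • h) ∧ ∃ y ∈ L, A.psi y ≠ 0

end BlockTensor

end

open MvPolynomial

/-! If `X ∩ H` has infinitely many singular points, n of them form the required subscheme, so let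
there be finitely many. Let `L` be the plane over the line `ℓ`. Since `ψ` contracts `ℓ` to `[h]`,
polarization makes A(·, y, z) proportional to h for all y, z in `L`; hence A(x, y, ·) is orthogonal
to `L` for x in `H` and y in `L`. A finite Cayley variety forces m + 1 ≤ n + 2, so `L`^⊥ has
dimension at most n, and x ↦ A(x, y, ·), for y in `L`, is a pencil of maps from the n-dimensional
space `H` to `L`^⊥. The number n in the theorem is the number of degenerate members of this pencil.

If A(x, y, ·) = 0, the gradient of f_l at x is a multiple of the contribution of y_l to ψ(y)
whenever y_l ≠ 0. These contributions sum to a multiple of h, so x is singular on `X ∩ H`, provided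
f_l(x) = 0 also for the blocks with y_l = 0. The argument works over any K-algebra
(`aeval_eq_zero_of_mem_singIdeal`), which is how multiplicities are obtained.

Suppose that no two nonzero vectors of `L` have disjoint block supports. Dimension counts show that
a vector of `L` misses at most one block. Some w in `L` has no kernel in `H`: otherwise finiteness
of the singular points gives a point with all of `L` in its kernel, which is essential unless every
block is missed by some vector of `L`, and in that case the Cayley variety would be infinite
(`not_projFinite_of_proportional`). Now Θ = -A(·, w)⁻¹ A(·, z) is an endomorphism of `H`. On the
generalized eigenspace V of μ its nilpotent part produces a singular point over a local algebra of
dimension at most dim V whose linear span contains V: over K[ε]/(ε^b) if z + μw misses no block, and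
over an extension of it by one socle element if one block, of size 2, is missed
(`hasPointAlgebra_maxGenEigenspace`). Together these points span `H`, which forces degree n
(`exists_isZeroDimOfDegree_of_hasPointAlgebra`).

If two vectors have disjoint supports, the avoidance of the block spaces and the same counts leave
four blocks of size 2 and n = 6. The singular scheme then contains intersections of two conics in
each of two planes that share at most a point, so its Hilbert function is at least 4 + 4 - 1 in
large degrees (`exists_isZeroDimOfDegree_of_disjoint`). -/

/-! ### Projective dimension theory: existence and finiteness of zeros up to scaling. -/

/-- A set of vectors that meets only finitely many lines through the origin. -/
def ProjFinite {K V : Type*} [Field K] [AddCommGroup V] [Module K V] (S : Set V) : Prop :=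
  ∃ F : Finset V, ∀ x ∈ S, ∃ y ∈ F, ∃ c : K, x = c • y

theorem ProjFinite.subset {K V : Type*} [Field K] [AddCommGroup V] [Module K V] {S T : Set V}
    (hT : ProjFinite (K := K) T) (h : S ⊆ T) : ProjFinite (K := K) S := by
  obtain ⟨F, hF⟩ := hT
  exact ⟨F, fun x hx => hF x (h hx)⟩

/-- A linear form that vanishes at no nonzero vector of a finite set. -/
theorem exists_dual_ne_zero_of_finset {K V : Type*} [Field K] [Infinite K] [AddCommGroup V]
    [Module K V] (F : Finset V) :
    ∃ f : Module.Dual K V, ∀ x ∈ F, x ≠ 0 → f x ≠ 0 := by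
  classical
  obtain ⟨f, hf⟩ := Module.exists_dual_forall_apply_ne_zero (K := K)
    (fun x : {x // x ∈ F.filter (· ≠ 0)} => (x : V)) (fun x => (Finset.mem_filter.1 x.2).2)
  exact ⟨f, fun x hx h0 => hf ⟨x, Finset.mem_filter.2 ⟨hx, h0⟩⟩⟩

theorem dual_apply_eq_sum {K σ : Type*} [Field K] [Fintype σ] [DecidableEq σ]
    (f : Module.Dual K (σ → K)) (x : σ → K) : f x = ∑ j, f (Pi.single j 1) * x j := by
  conv_lhs => rw [← Finset.univ_sum_single x, map_sum]
  refine Finset.sum_congr rfl fun j _ => ?_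
  rw [show (Pi.single j (x j) : σ → K) = x j • Pi.single j 1 by
    rw [← Pi.single_smul, smul_eq_mul, mul_one], map_smul, smul_eq_mul, mul_comm]

/-- The translation automorphism `X i ↦ X i + a i`. -/
noncomputable def translateEquiv {σ K : Type*} [Field K] (a : σ → K) :
    MvPolynomial σ K ≃ₐ[K] MvPolynomial σ K :=
  AlgEquiv.ofAlgHom (aeval fun i => X i + C (a i)) (aeval fun i => X i - C (a i))
    (by ext i; simp [algHom_C]) (by ext i; simp [algHom_C])

/-- Some maximal ideal has height equal to the dimension; by the Nullstellensatz it is the ideal of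
a point, and a translation moves that point to the origin. -/
theorem card_le_height_vanishingIdeal_zero {σ K : Type*} [Finite σ] [Field K] [IsAlgClosed K] :
    (Nat.card σ : ℕ∞) ≤ (vanishingIdeal K {(0 : σ → K)}).height := by
  have hdim : ringKrullDim (MvPolynomial σ K) = (Nat.card σ : WithBot ℕ∞) := by
    rw [MvPolynomial.ringKrullDim_of_isNoetherianRing, ringKrullDim_eq_zero_of_field, zero_add]
  have : FiniteRingKrullDim (MvPolynomial σ K) := by
    rw [finiteRingKrullDim_iff_ne_bot_and_top, hdim]
    exact ⟨by simp, by
      intro h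
      exact absurd (WithBot.coe_injective h) (by simp)⟩
  obtain ⟨p, hp, hph⟩ := Ideal.exists_isMaximal_height (R := MvPolynomial σ K)
  obtain ⟨a, rfl⟩ := eq_vanishingIdeal_singleton_of_isMaximal K hp
  have hcomap : (vanishingIdeal K {a}).comap (translateEquiv (-a)).toRingEquiv =
      vanishingIdeal K {(0 : σ → K)} := by
    ext p
    rw [Ideal.mem_comap, mem_vanishingIdeal_singleton_iff, mem_vanishingIdeal_singleton_iff]
    have : (aeval a).comp (translateEquiv (-a)).toAlgHom = aeval (0 : σ → K) := by
      ext i; simp [translateEquiv]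
    rw [← this]; rfl
  rw [← hcomap, RingEquiv.height_comap]
  rw [hdim] at hph
  exact_mod_cast hph.ge

/-- Fewer equations than unknowns, no constant terms: there is a nonzero solution. -/
theorem exists_ne_zero_forall_eval_eq_zero {σ ι K : Type*} [Finite σ] [Finite ι] [Field K]
    [IsAlgClosed K] (g : ι → MvPolynomial σ K) (hg : ∀ i, eval 0 (g i) = 0)
    (hcard : Nat.card ι < Nat.card σ) : ∃ x : σ → K, x ≠ 0 ∧ ∀ i, eval x (g i) = 0 := by
  by_contra! hne
  have hz : zeroLocus K (Ideal.span (Set.range g)) = {0} := by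
    rw [zeroLocus_span]
    ext x
    simp only [Set.mem_range, forall_exists_index, forall_apply_eq_imp_iff, Set.mem_ofPred_eq,
      Set.mem_singleton_iff]
    constructor
    · intro hx
      by_contra h0
      obtain ⟨i, hi⟩ := hne x h0
      exact hi (by simpa [aeval_eq_eval] using hx i)
    · rintro rfl i
      simpa [aeval_eq_eval] using hg i
  have hrad := vanishingIdeal_zeroLocus_eq_radical (K := K) (Ideal.span (Set.range g))
  rw [hz] at hrad
  -- Without a nonzero solution the ideal of the origin is the radical, hence a minimal prime, and
  -- Krull's height theorem bounds its height by the number of equations.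
  have hmin : vanishingIdeal K {(0 : σ → K)} ∈ (Ideal.span (Set.range g)).minimalPrimes := by
    refine ⟨⟨inferInstance, hrad ▸ Ideal.le_radical⟩, fun q hq _ => ?_⟩
    rw [hrad]
    exact hq.1.radical_le_iff.2 hq.2
  have h1 := Ideal.height_le_card_of_mem_minimalPrimes_span (Set.finite_range g) hmin
  have h2 := (card_le_height_vanishingIdeal_zero (σ := σ) (K := K)).trans h1
  have h3 : (Set.range g).ncard ≤ Nat.card ι := by
    rw [← Set.image_univ, ← Set.ncard_univ]
    exact Set.ncard_image_le
  have : Nat.card σ ≤ (Set.range g).ncard := by exact_mod_cast h2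
  omega

/-- Substitution of a linear parametrization `y ↦ ∑ j, y j • b j`. -/
noncomputable def linSubst {σ τ K : Type*} [Fintype τ] [Field K] (b : τ → σ → K) :
    MvPolynomial σ K →ₐ[K] MvPolynomial τ K :=
  aeval fun i => ∑ j, C (b j i) * X j

theorem aeval_linSubst {σ τ K E : Type*} [Fintype τ] [Field K] [CommRing E] [Algebra K E]
    (b : τ → σ → K) (y : τ → E) (p : MvPolynomial σ K) :
    aeval y (linSubst b p) = aeval (fun i => ∑ j, algebraMap K E (b j i) * y j) p := by
  have : (aeval y).comp (linSubst b) =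
      aeval (R := K) (fun i => ∑ j, algebraMap K E (b j i) * y j) := by
    ext i; simp [linSubst, algHom_C]
  rw [← this]; rfl

theorem eval_linSubst {σ τ K : Type*} [Fintype τ] [Field K]
    (b : τ → σ → K) (y : τ → K) (p : MvPolynomial σ K) :
    eval y (linSubst b p) = eval (∑ j, y j • b j) p := by
  have := aeval_linSubst b y p
  simp only [aeval_eq_eval, Algebra.algebraMap_self, RingHom.id_apply] at this
  rw [show (∑ j, y j • b j) = fun i => ∑ j, b j i * y j by
    ext i; simp [Finset.sum_apply, mul_comm]]
  exact this

theorem exists_mem_ne_zero_forall_eval_eq_zero {σ ι K : Type*} [Finite σ] [Finite ι] [Field K]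
    [IsAlgClosed K] (U : Submodule K (σ → K)) (g : ι → MvPolynomial σ K)
    (hg : ∀ i, eval 0 (g i) = 0) (hcard : Nat.card ι < Module.finrank K U) :
    ∃ x ∈ U, x ≠ 0 ∧ ∀ i, eval x (g i) = 0 := by
  classical
  have := Fintype.ofFinite σ
  let b := Module.finBasis K U
  obtain ⟨y, hy0, hy⟩ := exists_ne_zero_forall_eval_eq_zero
    (fun i => linSubst (fun j => (b j : σ → K)) (g i))
    (fun i => by rw [eval_linSubst]; simpa using hg i) (by simpa using hcard)
  refine ⟨∑ j, y j • (b j : σ → K), U.sum_mem fun j _ => U.smul_mem _ (b j).2, ?_, fun i => ?_⟩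
  · intro h0
    have h1 : ∑ j, y j • b j = 0 := by
      apply Subtype.ext
      simpa using h0
    exact hy0 (funext (Fintype.linearIndependent_iff.1 b.linearIndependent y h1))
  · rw [← eval_linSubst]; exact hy i

/-- At least two fewer equations than unknowns: infinitely many solutions up to scaling. -/
theorem not_projFinite_of_card_add_one_lt {σ ι K : Type*} [Finite σ] [Finite ι] [Field K]
    [IsAlgClosed K] (U : Submodule K (σ → K)) (g : ι → MvPolynomial σ K)
    (hg : ∀ i, eval 0 (g i) = 0) (hcard : Nat.card ι + 1 < Module.finrank K U) :
    ¬ ProjFinite (K := K) {x | x ∈ U ∧ x ≠ 0 ∧ ∀ i, eval x (g i) = 0} := by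
  classical
  have := Fintype.ofFinite σ
  have := Fintype.ofFinite ι
  rintro ⟨F, hF⟩
  obtain ⟨f, hf⟩ := exists_dual_ne_zero_of_finset (K := K) F
  -- The form `f` vanishes at no nonzero representative in `F`. As one additional equation it still
  -- leaves a nonzero solution, which then lies on none of the lines of `F`.
  obtain ⟨x, hxU, hx0, hx⟩ := exists_mem_ne_zero_forall_eval_eq_zero U
    (fun i : Option ι => i.elim (∑ j, C (f (Pi.single j 1)) * X j) g)
    (fun i => by cases i with
      | none => simp
      | some i => exact hg i) (by simpa using hcard)
  obtain ⟨y, hyF, c, rfl⟩ := hF x ⟨hxU, hx0, fun i => hx (some i)⟩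
  have h1 := hx none
  have h2 : f (c • y) = 0 := by
    rw [dual_apply_eq_sum f (c • y), ← h1]
    simp only [Option.elim, map_sum, map_mul, eval_C, eval_X]
  rw [map_smul, smul_eq_mul] at h2
  rcases mul_eq_zero.1 h2 with h | h
  · exact hx0 (by simp [h])
  · exact hf y hyF (fun h0 => hx0 (by simp [h0])) h

theorem aeval_mul_of_isHomogeneous {σ k E : Type*} [Field k] [CommRing E] [Algebra k E]
    {p : MvPolynomial σ k} {e : ℕ} (hp : p.IsHomogeneous e) (t : E) (x : σ → E) :
    aeval (fun i => t * x i) p = t ^ e * aeval x p := by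
  simp only [aeval_def, eval₂_eq, Finset.mul_sum]
  refine Finset.sum_congr rfl fun m hm => ?_
  simp only [mul_pow, Finset.prod_mul_distrib, Finset.prod_pow_eq_pow_sum]
  rw [show ∑ i ∈ m.support, m i = e from by
    have := hp (mem_support_iff.1 hm)
    simpa [Finsupp.weight_apply, Finsupp.sum] using this]
  ring

/-- The homogeneous prime ideal of the point `[y]` of projective space, for a vector `y` with
entries in an extension field. -/
noncomputable def pointIdeal {σ : Type*} (k : Type*) {K : Type*} [Field k] [Field K] [Algebra k K]
    (y : σ → K) : Ideal (MvPolynomial σ k) :=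
  RingHom.ker (aeval (R := k) fun i => (Polynomial.X * Polynomial.C (y i) : Polynomial K))

instance {σ k K : Type*} [Field k] [Field K] [Algebra k K] (y : σ → K) :
    (pointIdeal k y).IsPrime :=
  RingHom.ker_isPrime _

theorem aeval_polynomialC {σ k K : Type*} [Field k] [Field K] [Algebra k K] (y : σ → K)
    (p : MvPolynomial σ k) :
    aeval (fun i => (Polynomial.C (y i) : Polynomial K)) p = Polynomial.C (aeval y p) := by
  have : aeval (R := k) (fun i => (Polynomial.C (y i) : Polynomial K)) =
      (IsScalarTower.toAlgHom k K (Polynomial K)).comp (aeval y) := by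
    ext i; simp [Polynomial.algebraMap_eq]
  rw [this]
  simp [Polynomial.algebraMap_eq]

theorem mem_pointIdeal_of_isHomogeneous {σ k K : Type*} [Field k] [Field K] [Algebra k K]
    {y : σ → K} {p : MvPolynomial σ k} {e : ℕ} (hp : p.IsHomogeneous e) :
    p ∈ pointIdeal k y ↔ aeval y p = 0 := by
  rw [pointIdeal, RingHom.mem_ker, aeval_mul_of_isHomogeneous hp, aeval_polynomialC]
  simp only [mul_eq_zero, pow_eq_zero_iff', Polynomial.X_ne_zero, false_and, false_or,
    Polynomial.C_eq_zero]

/-- Points with the same prime are conjugate: once normalized by `y i = 1`, their coordinates are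
roots of the minimal polynomials of the coordinates of any one of them. -/
theorem finite_setOf_pointIdeal_eq {σ k K : Type*} [Finite σ] [Field k] [Field K] [Algebra k K]
    [Algebra.IsAlgebraic k K] (P : Ideal (MvPolynomial σ k)) (i : σ) :
    {y : σ → K | pointIdeal k y = P ∧ y i = 1}.Finite := by
  rcases Set.eq_empty_or_nonempty {y : σ → K | pointIdeal k y = P ∧ y i = 1} with h | ⟨z, hz, hz1⟩
  · rw [h]; exact Set.finite_empty
  refine (Set.Finite.pi' (t := fun j => (minpoly k (z j)).rootSet K)
    fun j => Polynomial.rootSet_finite _ _).subset ?_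
  rintro y ⟨hy, hy1⟩ j
  set q := minpoly k (z j)
  have hzint : IsIntegral k (z j) := (Algebra.IsAlgebraic.isAlgebraic (z j)).isIntegral
  -- The minimal polynomial of `z j`, homogenized with the variable `X i`.
  let p : MvPolynomial σ k :=
    ∑ a ∈ Finset.range (q.natDegree + 1), C (q.coeff a) * X j ^ a * X i ^ (q.natDegree - a)
  have hp : p.IsHomogeneous q.natDegree := by
    refine IsHomogeneous.sum _ _ _ fun a ha => ?_
    have := ((isHomogeneous_C_mul_X_pow (q.coeff a) j a).mul
      (isHomogeneous_X_pow (R := k) i (q.natDegree - a)))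
    rwa [Nat.add_sub_cancel' (by simpa [Nat.lt_succ_iff] using ha)] at this
  have heval : ∀ v : σ → K, v i = 1 → aeval v p = Polynomial.aeval (v j) q := by
    intro v hv
    simp [p, hv, Polynomial.aeval_eq_sum_range, Algebra.smul_def]
  have h1 : p ∈ pointIdeal k z := by
    rw [mem_pointIdeal_of_isHomogeneous hp, heval z hz1, minpoly.aeval]
  rw [hz, ← hy, mem_pointIdeal_of_isHomogeneous hp, heval y hy1] at h1
  rw [Polynomial.mem_rootSet]
  exact ⟨minpoly.ne_zero hzint, h1⟩

/-- A projective scheme of dimension at most `0` has finitely many geometric points. -/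
theorem projFinite_zeroLocus_of_ringKrullDim_le_one {σ ι k K : Type*} [Finite σ] [Field k] [Field K]
    [Algebra k K] [Algebra.IsAlgebraic k K] (g : ι → MvPolynomial σ k) (e : ι → ℕ)
    (hg : ∀ i, (g i).IsHomogeneous (e i))
    (hdim : ringKrullDim (MvPolynomial σ k ⧸ Ideal.span (Set.range g)) ≤ 1) :
    ProjFinite (K := K) {y : σ → K | ∀ i, aeval y (g i) = 0} := by
  classical
  set I := Ideal.span (Set.range g)
  have hfin : (⋃ P ∈ I.minimalPrimes, ⋃ i : σ,
      {y : σ → K | pointIdeal k y = P ∧ y i = 1}).Finite :=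
    (Ideal.finite_minimalPrimes_of_isNoetherianRing _ I).biUnion fun P _ =>
      Set.finite_iUnion fun i => finite_setOf_pointIdeal_eq P i
  refine ⟨insert 0 hfin.toFinset, fun y hy => ?_⟩
  by_cases hy0 : y = 0
  · exact ⟨0, Finset.mem_insert_self _ _, 0, by simp [hy0]⟩
  obtain ⟨i, hi⟩ := Function.ne_iff.1 hy0
  have hi : y i ≠ 0 := hi
  refine ⟨(y i)⁻¹ • y, Finset.mem_insert_of_mem ?_, y i, by
    rw [smul_smul, mul_inv_cancel₀ hi, one_smul]⟩
  set z := (y i)⁻¹ • y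
  have hz : ∀ j, aeval z (g j) = 0 := fun j => by
    have := aeval_mul_of_isHomogeneous (hg j) (y i)⁻¹ y
    rw [hy j, mul_zero] at this
    exact this
  have hzi : z i = 1 := by simp [z, hi]
  have hIP : I ≤ pointIdeal k z := by
    rw [Ideal.span_le]
    rintro _ ⟨j, rfl⟩
    exact (mem_pointIdeal_of_isHomogeneous (hg j)).2 (hz j)
  have hle : pointIdeal k z < vanishingIdeal k {(0 : σ → K)} := by
    refine lt_of_le_of_ne (fun p hp => ?_) fun h => ?_
    · rw [mem_vanishingIdeal_singleton_iff]
      have h1 : aeval (R := k) (0 : σ → K) =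
          ((Polynomial.aeval (R := K) (0 : K)).restrictScalars k).comp
          (aeval (R := k) fun i => (Polynomial.X * Polynomial.C (z i) : Polynomial K)) := by
        ext i; simp
      have h2 : aeval (R := k) (fun i => (Polynomial.X * Polynomial.C (z i) : Polynomial K)) p = 0 :=
        hp
      rw [h1, AlgHom.comp_apply, h2, map_zero]
    · have : (X i : MvPolynomial σ k) ∈ pointIdeal k z := by
        rw [h, mem_vanishingIdeal_singleton_iff]; simp
      rw [mem_pointIdeal_of_isHomogeneous (isHomogeneous_X k i), aeval_X, hzi] at this
      exact one_ne_zero this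
  -- The prime of the point is strictly contained in the irrelevant ideal, so in dimension at most 1
  -- it is a minimal prime over `I`. There are finitely many of those.
  rw [ringKrullDim_quotient, Order.krullDim_le_one_iff] at hdim
  have hmin := hdim ⟨⟨pointIdeal k z, inferInstance⟩, hIP⟩
  have hmem : pointIdeal k z ∈ I.minimalPrimes := by
    refine ⟨⟨inferInstance, hIP⟩, fun q hq hqz => ?_⟩
    rcases hmin with h | h
    · exact h (b := ⟨⟨q, hq.1⟩, hq.2⟩) hqz
    · exact absurd (h (b := ⟨⟨vanishingIdeal k {(0 : σ → K)}, inferInstance⟩, hIP.trans hle.le⟩)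
        hle.le) (fun h' => absurd h' (not_le_of_gt hle))
  rw [Set.Finite.mem_toFinset]
  simp only [Set.mem_iUnion]
  exact ⟨_, hmem, i, rfl, hzi⟩

/-! ### Adjugates of matrices with a given kernel vector, and dependent rows. -/

section Determinants

theorem derivation_prod {k R ι : Type*} [CommRing k] [CommRing R] [Algebra k R] [DecidableEq ι]
    (D : Derivation k R R) (s : Finset ι) (f : ι → R) :
    D (∏ i ∈ s, f i) = ∑ i ∈ s, (∏ j ∈ s.erase i, f j) * D (f i) := by
  induction s using Finset.induction_on with
  | empty => simp
  | insert a s ha ih =>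
    rw [Finset.prod_insert ha, Derivation.leibniz, ih, Finset.sum_insert ha,
      Finset.erase_insert ha, smul_eq_mul, smul_eq_mul, Finset.mul_sum, add_comm]
    congr 1
    refine Finset.sum_congr rfl fun i hi => ?_
    have hia : i ≠ a := fun h => ha (h ▸ hi)
    rw [Finset.erase_insert_of_ne (Ne.symm hia),
      Finset.prod_insert (fun h => ha (Finset.mem_of_mem_erase h)), mul_assoc]

/-- Jacobi's formula. -/
theorem derivation_det {k R m : Type*} [CommRing k] [CommRing R] [Algebra k R] [Fintype m]
    [DecidableEq m] (D : Derivation k R R) (M : Matrix m m R) :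
    D M.det = ∑ p, ∑ q, M.adjugate p q * D (M q p) := by
  have h1 : ∀ p, ∑ q, M.adjugate p q * D (M q p) = (M.updateCol p fun q => D (M q p)).det := by
    intro p
    rw [← Matrix.cramer_apply, Matrix.cramer_eq_adjugate_mulVec]
    rfl
  simp_rw [h1, Matrix.det_apply]
  rw [map_sum, Finset.sum_comm]
  refine Finset.sum_congr rfl fun σ _ => ?_
  rw [Units.smul_def, map_zsmul, derivation_prod, Finset.smul_sum]
  refine Finset.sum_congr rfl fun p _ => ?_
  rw [Units.smul_def, ← Finset.mul_prod_erase _ _ (Finset.mem_univ p), mul_comm]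
  congr 2
  · simp
  · refine Finset.prod_congr rfl fun j hj => ?_
    rw [Matrix.updateCol_ne (Finset.ne_of_mem_erase hj)]

/-- If `z` is in the kernel of `M` up to `e`-torsion, the columns of the adjugate are proportional
to `z` up to `e`-torsion. -/
theorem mul_adjugate_eq_of_smul_mulVec_eq_zero {R m : Type*} [CommRing R] [Fintype m]
    [DecidableEq m] {M : Matrix m m R} {z : m → R} {e : R} (hz : e • M.mulVec z = 0) (j p q : m) :
    e * (z j * M.adjugate p q) = e * (z p * M.adjugate j q) := by
  -- Cramer's rule: `M'` has determinant `M.adjugate p q`, shares the entry `(j, q)` of the adjugate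
  -- with `M`, and sends `z` to `z p` times a unit vector, up to `e`-torsion.
  set M' := M.updateRow q (Pi.single p 1)
  have h1 : e • M'.mulVec z = e • Pi.single q (z p) := by
    ext i
    by_cases hi : i = q
    · subst hi
      simp [M', Matrix.mulVec]
    · have := congrFun hz i
      simp only [Pi.smul_apply, Pi.zero_apply] at this
      simpa [M', Matrix.mulVec, Matrix.updateRow_ne hi, hi] using this
  have h2 : M'.adjugate j q = M.adjugate j q := by
    rw [Matrix.adjugate_apply, Matrix.adjugate_apply, Matrix.updateRow_idem]
  have h3 : M.adjugate p q = M'.det := Matrix.adjugate_apply M p q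
  have h4 := congrFun (congrArg M'.adjugate.mulVec h1) j
  rw [Matrix.mulVec_smul, Matrix.mulVec_smul, Matrix.mulVec_mulVec, Matrix.adjugate_mul,
    Matrix.smul_mulVec, Matrix.one_mulVec, Matrix.mulVec_single] at h4
  simp only [Pi.smul_apply, smul_eq_mul, MulOpposite.smul_eq_mul_unop, Matrix.col_apply,
    MulOpposite.unop_op] at h4
  rw [h2] at h4
  rw [h3]
  linear_combination h4

/-- Applied to columns and, by symmetry, to rows, the proportionality says that the adjugate is a
multiple of the rank one matrix z zᵀ. -/
theorem mul_sq_adjugate_eq_of_isSymm {R m : Type*} [CommRing R] [Fintype m]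
    [DecidableEq m] {M : Matrix m m R} (hM : M.IsSymm) {z : m → R} {e : R}
    (hz : e • M.mulVec z = 0) (j p q : m) :
    e * (z j ^ 2 * M.adjugate p q) = e * (M.adjugate j j * (z p * z q)) := by
  have h1 := mul_adjugate_eq_of_smul_mulVec_eq_zero hz j p q
  have h2 := mul_adjugate_eq_of_smul_mulVec_eq_zero hz j q j
  have h3 := hM.adjugate.apply q j
  linear_combination z j * h1 + z p * h2 + e * z p * z j * h3

theorem det_eq_zero_of_mulVec_eq_zero {R m : Type*} [CommRing R] [Fintype m]
    [DecidableEq m] {M : Matrix m m R} {z : m → R} (hz : M.mulVec z = 0) {j : m}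
    (hj : IsUnit (z j)) : M.det = 0 := by
  have := congrFun (congrArg M.adjugate.mulVec hz) j
  rw [Matrix.mulVec_mulVec, Matrix.adjugate_mul, Matrix.smul_mulVec, Matrix.one_mulVec] at this
  simp only [Pi.smul_apply, smul_eq_mul, Matrix.mulVec_zero, Pi.zero_apply] at this
  exact hj.mul_left_eq_zero.1 this

/-- Vanishing of the maximal minors of a matrix with rows `G none` and `G (some l)`, where the rows
in `S` are multiples of vectors `p l` whose sum is a multiple of `G none` up to a correction
`τ • a`, and `τ • a` is absorbed by one of the remaining rows. -/
theorem det_rows_eq_zero {R ι κ : Type*} [CommRing R] [Fintype ι] [DecidableEq ι]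
    (G : Option ι → κ → R) (S : Finset ι) (hS : S.Nonempty) (c : ι → R) (p : ι → κ → R)
    (hG : ∀ l ∈ S, G (some l) = c l • p l) (τ Q : R) (a : κ → R)
    (hsum : ∑ l ∈ S, p l + τ • a = Q • G none)
    (hτ : τ = 0 ∨ ∃ l₀ ∉ S, ∃ b : R, τ • G (some l₀) = (b * τ) • a) (f : Option ι → κ) :
    (Matrix.of fun i j => G i (f j) : Matrix (Option ι) (Option ι) R).det = 0 := by
  classical
  let D : Option ι → R := fun i => i.elim 1 fun l => if l ∈ S then c l else 1
  let M : Matrix (Option ι) (Option ι) R := fun i =>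
    i.elim (fun j => G none (f j)) fun l => if l ∈ S then fun j => p l (f j) else
      fun j => G (some l) (f j)
  have hM : (Matrix.of fun i j => G i (f j) : Matrix (Option ι) (Option ι) R) =
      Matrix.diagonal D * M := by
    ext i j
    rw [Matrix.diagonal_mul]
    cases i with
    | none => simp [D, M]
    | some l =>
      by_cases hl : l ∈ S
      · simp [D, M, hl, hG l hl]
      · simp [D, M, hl]
  rw [hM, Matrix.det_mul]
  suffices h : M.det = 0 by rw [h, mul_zero]
  obtain ⟨l₁, hl₁⟩ := hS
  -- Coefficients of the relation `hsum` between the rows of `M`. Only the multiple `-τ • a` is left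
  -- of it, so the row `l₁` may be traded for `a` at the cost of a factor `-τ`.
  let v : Option ι → R := fun i => i.elim (-Q) fun l => if l ∈ S then 1 else 0
  have hv : ∑ i, v i • M i = -τ • fun j => a (f j) := by
    ext j
    have := congrFun hsum (f j)
    simp only [Pi.add_apply, Finset.sum_apply, Pi.smul_apply, smul_eq_mul] at this
    have h2 : ∑ l, v (some l) * M (some l) j = ∑ l ∈ S, p l (f j) := by
      rw [← Finset.sum_filter_add_sum_filter_not Finset.univ (· ∈ S)]
      rw [Finset.sum_eq_zero (s := Finset.univ.filter (· ∉ S)) (fun l hl => by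
        simp [v, (Finset.mem_filter.1 hl).2]), add_zero, Finset.filter_mem_eq_inter,
        Finset.univ_inter]
      exact Finset.sum_congr rfl fun l hl => by simp [v, M, hl]
    rw [Finset.sum_apply, Fintype.sum_option]
    simp only [Pi.smul_apply, smul_eq_mul]
    rw [h2]
    simp only [v, M, Option.elim]
    linear_combination this
  have h1 : M.det = -τ * (M.updateRow (some l₁) fun j => a (f j)).det := by
    have h := Matrix.det_updateRow_sum M (some l₁) v
    rw [hv, Matrix.det_updateRow_smul] at h
    rw [h]
    simp [v, hl₁]
  rcases hτ with h0 | ⟨l₀, hl₀, b, hb⟩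
  · rw [h1, h0]; simp
  · set N := M.updateRow (some l₁) fun j => a (f j)
    have hne : some l₀ ≠ some l₁ := fun h => hl₀ (Option.some_injective _ h ▸ hl₁)
    have hN0 : N (some l₀) = fun j => G (some l₀) (f j) := by
      have : N (some l₀) = M (some l₀) := Matrix.updateRow_ne hne
      rw [this]
      simp [M, hl₀]
    have hN1 : N (some l₁) = fun j => a (f j) := by
      ext j
      simp [N]
    -- The factor τ turns the row `l₀` into a multiple of `a`, which already occupies the row `l₁`.
    have h2 : τ * N.det = (b * τ) * (N.updateRow (some l₀) (N (some l₁))).det := by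
      have h : (b * τ) • N (some l₁) = τ • N (some l₀) := by
        ext j
        simpa [hN0, hN1] using (congrFun hb (f j)).symm
      rw [← Matrix.det_updateRow_smul N (some l₀) (b * τ), h, Matrix.det_updateRow_smul,
        Matrix.updateRow_eq_self]
    have h3 : (N.updateRow (some l₀) (N (some l₁))).det = 0 :=
      Matrix.det_zero_of_row_eq hne (by
        ext j; simp [Matrix.updateRow_ne hne.symm])
    rw [h3, mul_zero] at h2
    rw [h1]
    linear_combination -h2

end Determinants

/-! ### Contractions over K-algebras and singular points from kernel vectors. -/

namespace BlockTensor

variable {K : Type*} [Field K] {n r : ℕ} {d : Fin r → ℕ} (B : BlockTensor K n d)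
variable {E : Type*} [CommRing E] [Algebra K E]

/-- The contraction of the `l`-th block by a vector `x` with entries in a `K`-algebra. -/
noncomputable def blockMat (l : Fin r) (x : Fin (n + 1) → E) : Matrix (Fin (d l)) (Fin (d l)) E :=
  ∑ i, x i • (B.slice l i).map (algebraMap K E)

/-- The contraction `A(x, y, ·)` over a `K`-algebra. -/
noncomputable def act (x : Fin (n + 1) → E) (y : (Σ l, Fin (d l)) → E) : (Σ l, Fin (d l)) → E :=
  fun a => (B.blockMat a.1 x).mulVec (fun j => y ⟨a.1, j⟩) a.2

/-- The contribution of the `l`-th block to `A(·, y, z)`, over a `K`-algebra. -/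
noncomputable def blockPair (l : Fin r) (y z : Fin (d l) → E) : Fin (n + 1) → E :=
  fun i => ∑ p, ∑ q, algebraMap K E (B.slice l i p q) * (y p * z q)

theorem blockMat_apply (l : Fin r) (x : Fin (n + 1) → E) (p q : Fin (d l)) :
    B.blockMat l x p q = ∑ i, x i * algebraMap K E (B.slice l i p q) := by
  simp [blockMat, Matrix.sum_apply]

theorem blockMat_isSymm (l : Fin r) (x : Fin (n + 1) → E) : (B.blockMat l x).IsSymm := by
  ext p q
  rw [Matrix.transpose_apply, blockMat_apply, blockMat_apply]
  exact Finset.sum_congr rfl fun i _ => by rw [(B.symm l i).apply]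

theorem blockMat_add (l : Fin r) (x x' : Fin (n + 1) → E) :
    B.blockMat l (x + x') = B.blockMat l x + B.blockMat l x' := by
  simp [blockMat, add_smul, Finset.sum_add_distrib]

theorem blockMat_smul (l : Fin r) (c : E) (x : Fin (n + 1) → E) :
    B.blockMat l (c • x) = c • B.blockMat l x := by
  simp [blockMat, mul_smul, Finset.smul_sum]

theorem blockMat_eq_blockAt (l : Fin r) (x : Fin (n + 1) → K) :
    B.blockMat l x = B.blockAt l x := by
  simp [blockMat, blockAt]

theorem act_apply (x : Fin (n + 1) → E) (y : (Σ l, Fin (d l)) → E) (a : Σ l, Fin (d l)) :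
    B.act x y a = ∑ j, ∑ i, x i * algebraMap K E (B.slice a.1 i a.2 j) * y ⟨a.1, j⟩ := by
  simp [act, Matrix.mulVec, dotProduct, blockMat_apply, Finset.sum_mul]

theorem act_add_left (x x' : Fin (n + 1) → E) (y : (Σ l, Fin (d l)) → E) :
    B.act (x + x') y = B.act x y + B.act x' y := by
  ext a; simp [act, blockMat_add, Matrix.add_mulVec]

theorem act_smul_left (c : E) (x : Fin (n + 1) → E) (y : (Σ l, Fin (d l)) → E) :
    B.act (c • x) y = c • B.act x y := by
  ext a; simp [act, blockMat_smul, Matrix.smul_mulVec]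

theorem act_add_right (x : Fin (n + 1) → E) (y y' : (Σ l, Fin (d l)) → E) :
    B.act x (y + y') = B.act x y + B.act x y' := by
  ext a
  exact congrFun (Matrix.mulVec_add (B.blockMat a.1 x) (fun j => y ⟨a.1, j⟩)
    (fun j => y' ⟨a.1, j⟩)) a.2

theorem act_smul_right (c : E) (x : Fin (n + 1) → E) (y : (Σ l, Fin (d l)) → E) :
    B.act x (c • y) = c • B.act x y := by
  ext a
  exact congrFun (Matrix.mulVec_smul (B.blockMat a.1 x) c (fun j => y ⟨a.1, j⟩)) a.2

theorem act_algebraMap (x : Fin (n + 1) → K) (y : (Σ l, Fin (d l)) → K) :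
    B.act (fun i => algebraMap K E (x i)) (fun a => algebraMap K E (y a)) =
      fun a => algebraMap K E (B.act x y a) := by
  ext a
  simp [act_apply, map_sum]

theorem pair_eq_sum_blockPair (y z : (Σ l, Fin (d l)) → K) (i : Fin (n + 1)) :
    B.pair y z i = ∑ l, B.blockPair l (fun j => y ⟨l, j⟩) (fun j => z ⟨l, j⟩) i := by
  simp only [pair, bigSlice, dotProduct, Matrix.mulVec, blockPair, Fintype.sum_sigma]
  refine Finset.sum_congr rfl fun l _ => Finset.sum_congr rfl fun p _ => ?_
  rw [Finset.sum_eq_single l]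
  · rw [Finset.mul_sum]
    exact Finset.sum_congr rfl fun q _ => by
      rw [Matrix.blockDiagonal'_apply_eq]; simp; ring
  · intro l' _ hl'
    exact Finset.sum_eq_zero fun q _ => by
      rw [Matrix.blockDiagonal'_apply_ne _ _ _ hl'.symm, zero_mul]
  · simp

theorem sum_mul_pair (x : Fin (n + 1) → K) (y z : (Σ l, Fin (d l)) → K) :
    ∑ i, x i * B.pair y z i = ∑ a, y a * B.act x z a := by
  simp only [pair_eq_sum_blockPair, blockPair, act_apply, Fintype.sum_sigma, Finset.mul_sum]
  rw [Finset.sum_comm]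
  refine Finset.sum_congr rfl fun l _ => ?_
  rw [Finset.sum_comm]
  refine Finset.sum_congr rfl fun p _ => ?_
  rw [Finset.sum_comm]
  refine Finset.sum_congr rfl fun q _ => Finset.sum_congr rfl fun i _ => ?_
  simp; ring

theorem aeval_detForm (l : Fin r) (x : Fin (n + 1) → E) :
    aeval x (B.detForm l) = (B.blockMat l x).det := by
  rw [detForm, AlgHom.map_det]
  congr 1
  ext p q
  simp [blockMat_apply, Matrix.sum_apply, map_sum]

theorem aeval_pderiv_detForm (l : Fin r) (x : Fin (n + 1) → E) (i : Fin (n + 1)) :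
    aeval x (pderiv i (B.detForm l)) =
      ∑ p, ∑ q, (B.blockMat l x).adjugate p q * algebraMap K E (B.slice l i q p) := by
  rw [detForm, derivation_det, map_sum]
  refine Finset.sum_congr rfl fun p _ => ?_
  rw [map_sum]
  refine Finset.sum_congr rfl fun q _ => ?_
  rw [map_mul]
  congr 1
  · have h := AlgHom.map_adjugate (aeval (R := K) x)
      (∑ i, (X i : MvPolynomial (Fin (n + 1)) K) • (B.slice l i).map C)
    have h' : (aeval (R := K) x).mapMatrix
        (∑ i, (X i : MvPolynomial (Fin (n + 1)) K) • (B.slice l i).map C) = B.blockMat l x := by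
      ext p q
      simp [blockMat_apply, Matrix.sum_apply, map_sum]
    rw [h'] at h
    rw [← h]
    rfl
  · simp only [Matrix.sum_apply, Matrix.smul_apply, Matrix.map_apply, smul_eq_mul, map_sum,
      Derivation.leibniz, pderiv_C, pderiv_X]
    rw [Finset.sum_eq_single i]
    · simp
    · intro j _ hj
      simp [hj]
    · simp

/-- The gradient of `det` at a matrix with kernel vector `z`, up to torsion. -/
theorem mul_aeval_pderiv_detForm (l : Fin r) (x : Fin (n + 1) → E) {z : Fin (d l) → E} {e : E}
    (hz : e • (B.blockMat l x).mulVec z = 0) (j : Fin (d l)) (i : Fin (n + 1)) :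
    e * (z j ^ 2 * aeval x (pderiv i (B.detForm l))) =
      e * ((B.blockMat l x).adjugate j j * B.blockPair l z z i) := by
  rw [aeval_pderiv_detForm, blockPair]
  simp only [Finset.mul_sum]
  refine Finset.sum_congr rfl fun p _ => Finset.sum_congr rfl fun q _ => ?_
  have := mul_sq_adjugate_eq_of_isSymm (B.blockMat_isSymm l x) hz j p q
  rw [(B.symm l i).apply]
  linear_combination algebraMap K E (B.slice l i p q) * this

theorem blockPair_smul (l : Fin r) (e : E) (z : Fin (d l) → E) :
    B.blockPair l (e • z) (e • z) = e ^ 2 • B.blockPair l z z := by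
  ext i
  simp only [blockPair, Pi.smul_apply, smul_eq_mul, Finset.mul_sum]
  refine Finset.sum_congr rfl fun p _ => Finset.sum_congr rfl fun q _ => ?_
  ring

/-- The equations of the singular scheme of `X ∩ H` vanish at a point `x` over a `K`-algebra if
`A(x, y, ·) = 0` for a vector `y` with `ψ(y)` proportional to `h`, provided that the components of
`y` in the blocks of `S` are unimodular and those in the other blocks vanish, up to at most one
component of the form `e • w` with `w` unimodular. -/
theorem aeval_eq_zero_of_mem_singIdeal (x : Fin (n + 1) → E) (y : (Σ l, Fin (d l)) → E)
    (h : Fin (n + 1) → K) (S : Finset (Fin r)) (hS : S.Nonempty) (hact : B.act x y = 0)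
    (hh : ∑ i, algebraMap K E (h i) * x i = 0)
    (hpsi : ∃ Q : E, ∀ i, ∑ l, B.blockPair l (fun j => y ⟨l, j⟩) (fun j => y ⟨l, j⟩) i =
      Q * algebraMap K E (h i))
    (hunit : ∀ l ∈ S, ∃ j, IsUnit (y ⟨l, j⟩)) (hf : ∀ l ∉ S, (B.blockMat l x).det = 0)
    (hrest : (∀ l ∉ S, ∀ j, y ⟨l, j⟩ = 0) ∨ ∃ l₀ ∉ S, (∀ l ∉ S, l ≠ l₀ → ∀ j, y ⟨l, j⟩ = 0) ∧
      ∃ (e : E) (w : Fin (d l₀) → E), (∃ j, IsUnit (w j)) ∧ ∀ j, y ⟨l₀, j⟩ = e * w j)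
    {p : MvPolynomial (Fin (n + 1)) K} (hp : p ∈ singIdeal (B.sectionEqs h)) :
    aeval x p = 0 := by
  have hact' : ∀ l, (B.blockMat l x).mulVec (fun j => y ⟨l, j⟩) = 0 := fun l => by
    ext j
    exact congrFun hact ⟨l, j⟩
  have hlin : ∀ j, aeval x (pderiv j (linForm h)) = algebraMap K E (h j) := by
    intro j
    rw [linForm, map_sum, map_sum, Finset.sum_eq_single j]
    · simp
    · intro i _ hi
      simp [hi]
    · simp
  suffices singIdeal (B.sectionEqs h) ≤ RingHom.ker (aeval (R := K) x) from this hp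
  rw [singIdeal, sup_le_iff, Ideal.span_le, Ideal.span_le]
  constructor
  · rintro _ ⟨l, rfl⟩
    rw [SetLike.mem_coe, RingHom.mem_ker]
    cases l with
    | none => simpa [sectionEqs, linForm] using hh
    | some l =>
      change aeval x (B.detForm l) = 0
      rw [aeval_detForm]
      by_cases hl : l ∈ S
      · obtain ⟨j, hj⟩ := hunit l hl
        exact det_eq_zero_of_mulVec_eq_zero (hact' l) hj
      · exact hf l hl
  · rintro _ ⟨f, rfl⟩
    rw [SetLike.mem_coe, RingHom.mem_ker, AlgHom.map_det]
    let G : Option (Fin r) → Fin (n + 1) → E := fun i j => aeval x (pderiv j (B.sectionEqs h i))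
    let P : Fin r → Fin (n + 1) → E := fun l =>
      B.blockPair l (fun j => y ⟨l, j⟩) (fun j => y ⟨l, j⟩)
    have hP0 : ∀ l, (∀ j, y ⟨l, j⟩ = 0) → P l = 0 := fun l hl => by
      ext i; simp [P, blockPair, hl]
    -- A unit coordinate of y in the block allows division by its square in the formula for the
    -- gradient.
    have hGP : ∀ l ∈ S, ∃ c : E, G (some l) = c • P l := by
      intro l hl
      obtain ⟨j, hj⟩ := hunit l hl
      obtain ⟨u, hu⟩ := hj.pow 2
      refine ⟨↑u⁻¹ * (B.blockMat l x).adjugate j j, funext fun i => ?_⟩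
      have := B.mul_aeval_pderiv_detForm l x (z := fun j => y ⟨l, j⟩) (e := 1)
        (by rw [hact' l, smul_zero]) j i
      rw [one_mul, one_mul, ← hu] at this
      change aeval x (pderiv i (B.detForm l)) = _
      rw [Pi.smul_apply, smul_eq_mul, mul_assoc, ← this, ← mul_assoc, Units.inv_mul, one_mul]
    choose! c hc using hGP
    obtain ⟨Q, hQ⟩ := hpsi
    have hnone : G none = fun i => algebraMap K E (h i) := funext hlin
    have hQ' : ∑ l, P l = Q • G none := by
      ext i
      rw [Finset.sum_apply, hnone]
      exact hQ i
    have key : ∃ (τ : E) (a : Fin (n + 1) → E), ∑ l ∈ S, P l + τ • a = Q • G none ∧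
        (τ = 0 ∨ ∃ l₀ ∉ S, ∃ b : E, τ • G (some l₀) = (b * τ) • a) := by
      rcases hrest with h0 | ⟨l₀, hl₀, h0, e, w, ⟨j, hj⟩, hew⟩
      · refine ⟨0, 0, ?_, Or.inl rfl⟩
        rw [smul_zero, add_zero, ← hQ']
        exact Finset.sum_subset (Finset.subset_univ S) fun l _ hl => hP0 l (h0 l hl)
      -- The component e • w contributes e² A(·, w, w) to ψ(y). As w is a kernel vector only up to
      -- e-torsion, the gradient of f_{l₀} is proportional to A(·, w, w) only after multiplication
      -- by e, and τ = e² suffices for that.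
      · refine ⟨e ^ 2, B.blockPair l₀ w w, ?_, Or.inr ⟨l₀, hl₀, ?_⟩⟩
        · have hw : (fun j => y ⟨l₀, j⟩) = e • w := funext hew
          have : e ^ 2 • B.blockPair l₀ w w = P l₀ := by
            rw [← blockPair_smul, ← hw]
          rw [this, add_comm (∑ l ∈ S, P l), ← Finset.sum_insert hl₀, ← hQ']
          refine Finset.sum_subset (Finset.subset_univ _) fun l _ hl => ?_
          rw [Finset.mem_insert, not_or] at hl
          exact hP0 l (h0 l hl.2 hl.1)
        · obtain ⟨u, hu⟩ := hj.pow 2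
          refine ⟨↑u⁻¹ * (B.blockMat l₀ x).adjugate j j, funext fun i => ?_⟩
          have hz : e • (B.blockMat l₀ x).mulVec w = 0 := by
            rw [← Matrix.mulVec_smul, ← hact' l₀]
            congr 1
            exact (funext hew).symm
          have := B.mul_aeval_pderiv_detForm l₀ x hz j i
          rw [← hu] at this
          change e ^ 2 * aeval x (pderiv i (B.detForm l₀)) = _
          rw [Pi.smul_apply, smul_eq_mul]
          have hu1 : (↑u⁻¹ : E) * u = 1 := Units.inv_mul u
          linear_combination (e * ↑u⁻¹) * this -
            e ^ 2 * aeval x (pderiv i (B.detForm l₀)) * hu1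
    obtain ⟨τ, a, hsum, hτ⟩ := key
    exact det_rows_eq_zero G S hS c P hc τ Q a hsum hτ f

end BlockTensor

/-! ### Homogeneity of the ideals in play. -/

section Homogeneity

variable {σ K : Type*} [Field K]

attribute [local instance] MvPolynomial.gradedAlgebra in
theorem isHomogeneousIdeal_span {s : Set (MvPolynomial σ K)}
    (hs : ∀ p ∈ s, ∃ e, p.IsHomogeneous e) : IsHomogeneousIdeal (Ideal.span s) := by
  have h : (Ideal.span s).IsHomogeneous (homogeneousSubmodule σ K) :=
    Ideal.homogeneous_span _ s fun p hp => by
      obtain ⟨e, he⟩ := hs p hp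
      exact ⟨e, (mem_homogeneousSubmodule e p).2 he⟩
  exact fun f hf e => homogeneousComponent_mem_of_mem h hf e

theorem isHomogeneous_det {m : Type*} [Fintype m] [DecidableEq m]
    (M : Matrix m m (MvPolynomial σ K)) (e : m → ℕ) (hM : ∀ i j, (M i j).IsHomogeneous (e i)) :
    M.det.IsHomogeneous (∑ i, e i) := by
  rw [Matrix.det_apply]
  refine IsHomogeneous.sum _ _ _ fun τ _ => ?_
  rw [Units.smul_def, ← Int.cast_smul_eq_zsmul (R := K)]
  refine (homogeneousSubmodule σ K _).smul_mem _ ?_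
  rw [mem_homogeneousSubmodule, ← Equiv.sum_comp τ e]
  exact IsHomogeneous.prod _ _ _ fun i _ => hM _ _

theorem isHomogeneousIdeal_singIdeal {ι : Type*} [Fintype ι] [DecidableEq ι]
    (g : ι → MvPolynomial σ K) (e : ι → ℕ) (hg : ∀ i, (g i).IsHomogeneous (e i)) :
    IsHomogeneousIdeal (singIdeal g) := by
  rw [singIdeal, ← Ideal.span_union]
  refine isHomogeneousIdeal_span ?_
  rintro _ (⟨i, rfl⟩ | ⟨c, rfl⟩)
  · exact ⟨e i, hg i⟩
  · exact ⟨_, isHomogeneous_det _ (fun i => e i - 1) fun i j => (hg i).pderiv⟩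

theorem isHomogeneous_linForm {n : ℕ} (h : Fin (n + 1) → K) : (linForm h).IsHomogeneous 1 :=
  IsHomogeneous.sum _ _ _ fun _ _ => isHomogeneous_C_mul_X _ _

theorem BlockTensor.isHomogeneous_detForm {n r : ℕ} {d : Fin r → ℕ} (B : BlockTensor K n d)
    (l : Fin r) : (B.detForm l).IsHomogeneous (d l) := by
  have h : ∀ p q, ((∑ i, (X i : MvPolynomial (Fin (n + 1)) K) •
      (B.slice l i).map (C : K → MvPolynomial (Fin (n + 1)) K)) p q).IsHomogeneous 1 := by
    intro p q
    rw [Matrix.sum_apply]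
    refine IsHomogeneous.sum _ _ _ fun i _ => ?_
    simpa [mul_comm] using isHomogeneous_C_mul_X (B.slice l i p q) i
  simpa [BlockTensor.detForm] using isHomogeneous_det _ (fun _ => 1) h

theorem BlockTensor.isHomogeneousIdeal_singIdeal_sectionEqs {n r : ℕ} {d : Fin r → ℕ}
    (B : BlockTensor K n d) (h : Fin (n + 1) → K) :
    IsHomogeneousIdeal (singIdeal (B.sectionEqs h)) :=
  isHomogeneousIdeal_singIdeal _ (fun i => i.elim 1 d) fun i => by
    cases i with
    | none => exact isHomogeneous_linForm h
    | some l => exact B.isHomogeneous_detForm l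

end Homogeneity

/-! ### Hilbert functions and points over finite-dimensional algebras. -/

section HilbertFunction

variable {σ K : Type*} [Field K] {E : Type*} [CommRing E] [Algebra K E]

/-- The largest homogeneous ideal of polynomials that vanish at a point `x` with coordinates in a
`K`-algebra. -/
noncomputable def homogIdealAt (x : σ → E) : Ideal (MvPolynomial σ K) :=
  RingHom.ker (aeval (R := K) fun i => (Polynomial.X * Polynomial.C (x i) : Polynomial E))

theorem coeff_aeval_X_mul_C (x : σ → E) (p : MvPolynomial σ K) (e : ℕ) :
    (aeval (fun i => (Polynomial.X * Polynomial.C (x i) : Polynomial E)) p).coeff e =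
      aeval x (homogeneousComponent e p) := by
  have hC : ∀ q : MvPolynomial σ K,
      aeval (fun i => (Polynomial.C (x i) : Polynomial E)) q = Polynomial.C (aeval x q) := by
    intro q
    have : aeval (R := K) (fun i => (Polynomial.C (x i) : Polynomial E)) =
        (IsScalarTower.toAlgHom K E (Polynomial E)).comp (aeval x) := by
      ext i; simp [Polynomial.algebraMap_eq]
    rw [this]
    simp [Polynomial.algebraMap_eq]
  conv_lhs => rw [← sum_homogeneousComponent p]
  simp_rw [map_sum, aeval_mul_of_isHomogeneous (homogeneousComponent_isHomogeneous _ p), hC,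
    Polynomial.finsetSum_coeff, mul_comm (Polynomial.X ^ _), Polynomial.coeff_C_mul_X_pow]
  rw [Finset.sum_ite_eq]
  split_ifs with h
  · rfl
  · rw [homogeneousComponent_eq_zero _ _ (by simpa using h), map_zero]

theorem mem_homogIdealAt {x : σ → E} {p : MvPolynomial σ K} :
    p ∈ homogIdealAt x ↔ ∀ e, aeval x (homogeneousComponent e p) = 0 := by
  rw [homogIdealAt, RingHom.mem_ker, Polynomial.ext_iff]
  simp_rw [coeff_aeval_X_mul_C, Polynomial.coeff_zero]

theorem mem_homogIdealAt_of_isHomogeneous {x : σ → E} {p : MvPolynomial σ K} {e : ℕ}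
    (hp : p.IsHomogeneous e) : p ∈ homogIdealAt x ↔ aeval x p = 0 := by
  rw [mem_homogIdealAt]
  constructor
  · intro h
    simpa [homogeneousComponent_eq_self hp] using h e
  · intro h e'
    rw [homogeneousComponent_of_mem hp]
    split_ifs <;> simp [h]

theorem isHomogeneousIdeal_homogIdealAt (x : σ → E) :
    IsHomogeneousIdeal (homogIdealAt (K := K) x) := fun f hf e =>
  (mem_homogIdealAt_of_isHomogeneous (homogeneousComponent_isHomogeneous e f)).2
    (mem_homogIdealAt.1 hf e)

/-- Evaluation of forms of degree `e` at a point. -/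
noncomputable def evalForms (x : σ → E) (e : ℕ) : homogeneousSubmodule σ K e →ₗ[K] E :=
  (aeval (R := K) x).toLinearMap ∘ₗ (homogeneousSubmodule σ K e).subtype

theorem hilbertFn_eq_finrank_range {V : Type*} [AddCommGroup V] [Module K V]
    (I : Ideal (MvPolynomial σ K)) (e : ℕ) (f : homogeneousSubmodule σ K e →ₗ[K] V)
    (hf : ∀ p, f p = 0 ↔ (p : MvPolynomial σ K) ∈ I) :
    hilbertFn I e = Module.finrank K (LinearMap.range f) := by
  have h : (I.restrictScalars K).comap (homogeneousSubmodule σ K e).subtype = LinearMap.ker f := by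
    ext p
    rw [Submodule.mem_comap, LinearMap.mem_ker, hf]
    rfl
  rw [hilbertFn, h]
  exact (f.quotKerEquivRange).finrank_eq

theorem finrank_range_le_hilbertFn [Finite σ] {V : Type*} [AddCommGroup V] [Module K V]
    (I : Ideal (MvPolynomial σ K)) (e : ℕ) (f : homogeneousSubmodule σ K e →ₗ[K] V)
    (hf : ∀ p : homogeneousSubmodule σ K e, (p : MvPolynomial σ K) ∈ I → f p = 0) :
    Module.finrank K (LinearMap.range f) ≤ hilbertFn I e := by
  have : Module.Finite K (homogeneousSubmodule σ K e) :=
    Module.Finite.iff_fg.2 (homogeneousSubmodule_fg σ K e)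
  have h : (I.restrictScalars K).comap (homogeneousSubmodule σ K e).subtype ≤ LinearMap.ker f :=
    fun p hp => hf p hp
  rw [hilbertFn, ← Submodule.range_liftQ _ f h]
  exact LinearMap.finrank_range_le _

/-- In a finite-dimensional algebra that is not too small there is an ideal of given colength. -/
theorem exists_ideal_finrank_quotient_eq [IsAlgClosed K] [FiniteDimensional K E] {N : ℕ}
    (hN : N ≤ Module.finrank K E) : ∃ 𝔞 : Ideal E, Module.finrank K (E ⧸ 𝔞) = N := by
  have : IsNoetherianRing E := IsNoetherianRing.of_finite K E
  obtain ⟨𝔞, h𝔞, hmax⟩ := set_has_maximal_iff_noetherian.2 this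
    {𝔞 : Ideal E | N ≤ Module.finrank K (E ⧸ 𝔞)}
    ⟨⊥, hN.trans (LinearEquiv.ofBijective (Ideal.Quotient.mkₐ K (⊥ : Ideal E)).toLinearMap
      ⟨(injective_iff_map_eq_zero _).2 fun a ha => by
        simpa [Ideal.Quotient.eq_zero_iff_mem] using ha,
        Ideal.Quotient.mk_surjective⟩).finrank_eq.le⟩
  refine ⟨𝔞, le_antisymm ?_ h𝔞⟩
  by_contra! hlt
  have hnt : Nontrivial (E ⧸ 𝔞) := Module.nontrivial_of_finrank_pos (R := K) (by omega)
  -- The residue field at an associated prime is K, so the annihilated element spans a line that is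
  -- an ideal of the quotient. Adding it to 𝔞 lowers the colength by at most one, contrary to
  -- maximality if the colength exceeds `N`.
  obtain ⟨P, hP⟩ := associatedPrimes.nonempty E (E ⧸ 𝔞)
  obtain ⟨hPp, x, hx⟩ := isAssociatedPrime_iff.1 hP
  have hPx : ∀ s, s ∈ P ↔ s • x = 0 := fun s => by
    rw [hx, Submodule.mem_colon_singleton, Submodule.mem_bot]
  have hsc : ∀ s : E, ∃ c : K, s • x = c • x := by
    intro s
    obtain ⟨c, hc⟩ := (IsAlgClosed.algebraMap_bijective_of_isIntegral (k := K)
      (K := E ⧸ P)).2 (Ideal.Quotient.mk P s)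
    refine ⟨c, ?_⟩
    have : s - algebraMap K E c ∈ P := by
      rw [← Ideal.Quotient.mk_eq_mk_iff_sub_mem, ← hc]
      rfl
    rw [hPx, sub_smul, sub_eq_zero] at this
    rw [this, algebraMap_smul]
  obtain ⟨a, rfl⟩ := Ideal.Quotient.mk_surjective x
  have ha : a ∉ 𝔞 := fun h => hPp.ne_top ((Ideal.eq_top_iff_one _).2 ((hPx 1).2 (by
    rw [one_smul]; exact Ideal.Quotient.eq_zero_iff_mem.2 h)))
  have hlt' : 𝔞 < 𝔞 ⊔ Ideal.span {a} := lt_of_le_of_ne le_sup_left fun h => ha (by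
    rw [h]; exact Ideal.mem_sup_right (Ideal.mem_span_singleton_self a))
  refine hmax _ ?_ hlt'
  let π : (E ⧸ 𝔞) →ₗ[K] (E ⧸ (𝔞 ⊔ Ideal.span {a})) :=
    (Ideal.Quotient.factorₐ K (le_sup_left : 𝔞 ≤ 𝔞 ⊔ Ideal.span {a})).toLinearMap
  have hπ : Function.Surjective π := Ideal.Quotient.factor_surjective le_sup_left
  have hker : LinearMap.ker π ≤ Submodule.span K {Ideal.Quotient.mk 𝔞 a} := by
    intro b hb
    obtain ⟨b, rfl⟩ := Ideal.Quotient.mk_surjective b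
    have hb' : b ∈ 𝔞 ⊔ Ideal.span {a} := Ideal.Quotient.eq_zero_iff_mem.1 hb
    obtain ⟨u, hu, v, hv, rfl⟩ := Submodule.mem_sup.1 hb'
    obtain ⟨s, rfl⟩ := Ideal.mem_span_singleton'.1 hv
    obtain ⟨c, hc⟩ := hsc s
    rw [map_add, Ideal.Quotient.eq_zero_iff_mem.2 hu, zero_add, Submodule.mem_span_singleton]
    exact ⟨c, hc.symm⟩
  have h1 := LinearMap.finrank_range_add_finrank_ker π
  rw [LinearMap.range_eq_top.2 hπ, finrank_top] at h1
  have h2 := (Submodule.finrank_mono hker).trans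
    (finrank_span_le_card (R := K) {Ideal.Quotient.mk 𝔞 a})
  rw [Set.toFinset_singleton, Finset.card_singleton] at h2
  change N ≤ Module.finrank K (E ⧸ (𝔞 ⊔ Ideal.span {a}))
  omega

/-- A closed subscheme of dimension `0` and degree `N` from a point over a finite-dimensional
algebra on which forms of large degree surject. -/
theorem exists_isZeroDimOfDegree_of_surjective [IsAlgClosed K] [FiniteDimensional K E]
    {J : Ideal (MvPolynomial σ K)} (hJ : IsHomogeneousIdeal J) (x : σ → E)
    (hx : ∀ p ∈ J, aeval x p = 0) (e₀ : ℕ)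
    (hsurj : ∀ e ≥ e₀, Function.Surjective (evalForms (K := K) x e)) {N : ℕ}
    (hN : N ≤ Module.finrank K E) :
    ∃ I : Ideal (MvPolynomial σ K), IsHomogeneousIdeal I ∧ J ≤ I ∧ IsZeroDimOfDegree I N := by
  obtain ⟨𝔞, h𝔞⟩ := exists_ideal_finrank_quotient_eq (K := K) hN
  let x' : σ → E ⧸ 𝔞 := fun i => Ideal.Quotient.mkₐ K 𝔞 (x i)
  have hx' : ∀ p : MvPolynomial σ K, aeval x' p = Ideal.Quotient.mkₐ K 𝔞 (aeval x p) := fun p => by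
    rw [← AlgHom.comp_apply]
    congr 1
    ext i; simp [x']
  refine ⟨homogIdealAt x', isHomogeneousIdeal_homogIdealAt x', fun p hp => ?_, e₀, fun e he => ?_⟩
  · rw [mem_homogIdealAt]
    intro e
    rw [hx', hx _ (hJ p hp e), map_zero]
  · rw [hilbertFn_eq_finrank_range _ e (evalForms x' e) fun p =>
      (mem_homogIdealAt_of_isHomogeneous p.2).symm, LinearMap.range_eq_top.2, finrank_top, h𝔞]
    intro b
    obtain ⟨b, rfl⟩ := Ideal.Quotient.mk_surjective b
    obtain ⟨p, rfl⟩ := hsurj e he b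
    exact ⟨p, hx' p⟩

end HilbertFunction

/-! ### Zero-dimensional subschemes of a given degree. -/

section ZeroDimensional

variable {σ K : Type*} [Field K]

/-- The linear form on `K^σ` as a polynomial. -/
noncomputable def dualForm [Fintype σ] [DecidableEq σ] (f : Module.Dual K (σ → K)) :
    MvPolynomial σ K :=
  ∑ j, C (f (Pi.single j 1)) * X j

theorem eval_dualForm [Fintype σ] [DecidableEq σ] (f : Module.Dual K (σ → K)) (x : σ → K) :
    eval x (dualForm f) = f x := by
  rw [dual_apply_eq_sum f x]
  simp [dualForm]

theorem isHomogeneous_dualForm [Fintype σ] [DecidableEq σ] (f : Module.Dual K (σ → K)) :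
    (dualForm f).IsHomogeneous 1 :=
  IsHomogeneous.sum _ _ _ fun _ _ => isHomogeneous_C_mul_X _ _

theorem exists_pairwise_not_proportional {V : Type*} [AddCommGroup V] [Module K V] {S : Set V}
    (hS : ¬ ProjFinite (K := K) S) (m : ℕ) :
    ∃ v : Fin m → V, (∀ i, v i ∈ S ∧ v i ≠ 0) ∧ ∀ i j, i ≠ j → v i ∉ Submodule.span K {v j} := by
  classical
  induction m with
  | zero => exact ⟨Fin.elim0, fun i => i.elim0, fun i => i.elim0⟩
  | succ m ih =>
    obtain ⟨v, hv, hv'⟩ := ih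
    obtain ⟨x, hxS, hx⟩ : ∃ x ∈ S, ¬ ∃ y ∈ insert 0 (Finset.univ.image v), ∃ c : K,
        x = c • y := by
      by_contra hcon
      exact hS ⟨_, fun x hx => by_contra fun h => hcon ⟨x, hx, h⟩⟩
    have hx0 : x ≠ 0 := fun h => hx ⟨0, Finset.mem_insert_self _ _, 0, by simp [h]⟩
    have hxv : ∀ i, x ∉ Submodule.span K {v i} := fun i h => by
      obtain ⟨c, hc⟩ := Submodule.mem_span_singleton.1 h
      exact hx ⟨v i, by simp, c, hc.symm⟩
    have hvx : ∀ i, v i ∉ Submodule.span K {x} := fun i h => by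
      obtain ⟨c, hc⟩ := Submodule.mem_span_singleton.1 h
      have hc0 : c ≠ 0 := fun h0 => (hv i).2 (by rw [← hc, h0, zero_smul])
      exact hxv i (Submodule.mem_span_singleton.2 ⟨c⁻¹, by
        rw [← hc, smul_smul, inv_mul_cancel₀ hc0, one_smul]⟩)
    refine ⟨Fin.cons x v, fun i => ?_, fun i j hij => ?_⟩
    · refine Fin.cases ⟨hxS, hx0⟩ (fun i => hv i) i
    · induction i using Fin.cases with
      | zero =>
        induction j using Fin.cases with
        | zero => exact absurd rfl hij
        | succ j => simpa using hxv j
      | succ i =>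
        induction j using Fin.cases with
        | zero => simpa using hvx i
        | succ j => simpa using hv' i j fun h => hij (by rw [h])

/-- A projective scheme with infinitely many points contains closed subschemes of dimension `0`
of every degree. -/
theorem exists_isZeroDimOfDegree_of_not_projFinite [Finite σ] [IsAlgClosed K]
    {J : Ideal (MvPolynomial σ K)} (hJ : IsHomogeneousIdeal J)
    (h : ¬ ProjFinite (K := K) {x : σ → K | ∀ p ∈ J, eval x p = 0}) (N : ℕ) :
    ∃ I : Ideal (MvPolynomial σ K), IsHomogeneousIdeal I ∧ J ≤ I ∧ IsZeroDimOfDegree I N := by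
  classical
  have := Fintype.ofFinite σ
  obtain ⟨v, hv, hv'⟩ := exists_pairwise_not_proportional h N
  let x : σ → Fin N → K := fun i a => v a i
  have hx : ∀ (p : MvPolynomial σ K) a, aeval x p a = eval (v a) p := by
    intro p a
    have : (Pi.evalAlgHom K (fun _ : Fin N => K) a).comp (aeval x) = aeval (v a) := by
      ext i; simp [x]
    rw [← aeval_eq_eval, ← this]
    rfl
  refine exists_isZeroDimOfDegree_of_surjective hJ x (fun p hp => funext fun a => ?_) N
    (fun e he => ?_) (by simp)
  · rw [hx]
    exact (hv a).1 p hp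
  · have hf : ∀ a b, ∃ f : Module.Dual K (σ → K), f (v a) ≠ 0 ∧ (a ≠ b → f (v b) = 0) := by
      intro a b
      by_cases hab : a = b
      · obtain ⟨f, hf⟩ := exists_dual_ne_zero_of_finset (K := K) {v a}
        exact ⟨f, hf _ (by simp) (hv a).2, fun h => absurd hab h⟩
      · obtain ⟨f, hf, hf'⟩ := Submodule.exists_le_ker_of_notMem (hv' a b hab)
        exact ⟨f, hf, fun _ => hf' (Submodule.mem_span_singleton_self _)⟩
    choose f hf hf' using hf
    rw [← LinearMap.range_eq_top, eq_top_iff, ← (Pi.basisFun K (Fin N)).span_eq, Submodule.span_le]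
    rintro _ ⟨a, rfl⟩
    -- An interpolation form: each factor is nonzero at `v a`, and for every other `b` some factor
    -- vanishes at `v b`. The power raises the degree to `e`.
    let p : MvPolynomial σ K := (∏ b, dualForm (f a b)) * dualForm (f a a) ^ (e - N)
    have hp : p.IsHomogeneous e := by
      have := (IsHomogeneous.prod Finset.univ (fun b => dualForm (f a b)) (fun _ => 1)
        fun b _ => isHomogeneous_dualForm _).mul ((isHomogeneous_dualForm (f a a)).pow (e - N))
      simpa [Nat.add_sub_cancel' he] using this
    have hpb : ∀ b, eval (v b) p = (∏ b', f a b' (v b)) * f a a (v b) ^ (e - N) := fun b => by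
      simp [p, eval_dualForm, map_prod]
    have hpa : eval (v a) p ≠ 0 := by
      rw [hpb]
      exact mul_ne_zero (Finset.prod_ne_zero_iff.2 fun b _ => hf a b) (pow_ne_zero _ (hf a a))
    refine ⟨(eval (v a) p)⁻¹ • ⟨p, hp⟩, ?_⟩
    rw [map_smul]
    ext b
    change (eval (v a) p)⁻¹ * aeval x p b = _
    rw [hx]
    by_cases hab : a = b
    · subst hab
      simp [inv_mul_cancel₀ hpa]
    · rw [hpb b, Finset.prod_eq_zero (Finset.mem_univ b) (hf' a b hab)]
      simp [hab]

theorem homogeneousComponent_mul_of_isHomogeneous {y : MvPolynomial σ K} {m : ℕ}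
    (hy : y.IsHomogeneous m) (q : MvPolynomial σ K) (e : ℕ) :
    homogeneousComponent (e + m) (y * q) = y * homogeneousComponent e q := by
  conv_lhs => rw [← sum_homogeneousComponent q, Finset.mul_sum, map_sum]
  have : ∀ i, homogeneousComponent (e + m) (y * homogeneousComponent i q) =
      if i = e then y * homogeneousComponent e q else 0 := by
    intro i
    have h := hy.mul (homogeneousComponent_isHomogeneous i q)
    rw [homogeneousComponent_of_mem h]
    by_cases hi : i = e
    · subst hi; simp [add_comm]
    · rw [if_neg (by omega), if_neg hi]
  simp_rw [this]
  rw [Finset.sum_ite_eq']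
  split_ifs with h
  · rfl
  · rw [homogeneousComponent_eq_zero _ _ (by simpa using h), mul_zero]

theorem homogeneousComponent_zero_mul_of_isHomogeneous_one {y : MvPolynomial σ K}
    (hy : y.IsHomogeneous 1) (q : MvPolynomial σ K) :
    homogeneousComponent 0 (y * q) = 0 := by
  rw [homogeneousComponent_zero, ← constantCoeff_eq, map_mul, constantCoeff_eq,
    hy.coeff_eq_zero (by simp), zero_mul, C_0]

/-- If multiplication by the linear form `y` is injective modulo `J` in degrees at least `e₁`, then
dehomogenizing with respect to `y` loses nothing in these degrees. -/
theorem mem_of_isHomogeneous_of_mem_sup {J : Ideal (MvPolynomial σ K)} (hJ : IsHomogeneousIdeal J)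
    {y : MvPolynomial σ K} (hy : y.IsHomogeneous 1) {e₁ : ℕ}
    (hinj : ∀ e ≥ e₁, ∀ p : MvPolynomial σ K, p.IsHomogeneous e → y * p ∈ J → p ∈ J)
    {p : MvPolynomial σ K} (hp : p.IsHomogeneous e₁) (hpJ : p ∈ J ⊔ Ideal.span {y - 1}) :
    p ∈ J := by
  obtain ⟨j, hj, w, hw, hjw⟩ := Submodule.mem_sup.1 hpJ
  obtain ⟨q, rfl⟩ := Ideal.mem_span_singleton'.1 hw
  have hq : ∀ e, homogeneousComponent e p = homogeneousComponent e j +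
      homogeneousComponent e (y * q) - homogeneousComponent e q := by
    intro e
    rw [← map_add, ← map_sub, ← hjw]
    congr 1
    ring
  have hpe : ∀ e, e ≠ e₁ → homogeneousComponent e p = 0 := fun e he => by
    rw [homogeneousComponent_of_mem hp, if_neg he]
  -- Comparison of components in p = j + q (y - 1): away from degree `e₁`, the component of q in
  -- degree e + 1 is y times the one in degree e, modulo `J`. Below `e₁` one ascends from degree 0.
  have hlow : ∀ e < e₁, homogeneousComponent e q ∈ J := by
    intro e
    induction e with
    | zero =>
      intro he
      have h := hq 0
      rw [hpe 0 he.ne, homogeneousComponent_zero_mul_of_isHomogeneous_one hy] at h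
      rw [show homogeneousComponent 0 q = homogeneousComponent 0 j by linear_combination h]
      exact hJ j hj 0
    | succ e ih =>
      intro he
      have h := hq (e + 1)
      rw [hpe _ he.ne, homogeneousComponent_mul_of_isHomogeneous hy] at h
      rw [show homogeneousComponent (e + 1) q = homogeneousComponent (e + 1) j +
        y * homogeneousComponent e q by linear_combination h]
      exact J.add_mem (hJ j hj _) (J.mul_mem_left _ (ih (by omega)))
  have hmain : homogeneousComponent e₁ q ∈ J → p ∈ J := by
    intro hqJ
    have h := hq e₁
    rw [homogeneousComponent_eq_self hp] at h
    rw [h]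
    refine J.sub_mem (J.add_mem (hJ j hj _) ?_) hqJ
    rcases e₁ with _ | e
    · rw [homogeneousComponent_zero_mul_of_isHomogeneous_one hy]; exact J.zero_mem
    · rw [homogeneousComponent_mul_of_isHomogeneous hy]
      exact J.mul_mem_left _ (hlow e (by omega))
  apply hmain
  -- From `e₁` upwards one descends from beyond the degree of q, cancelling y by `hinj`.
  have hup : ∀ t e, e₁ ≤ e → q.totalDegree < e + t → homogeneousComponent e q ∈ J := by
    intro t
    induction t with
    | zero =>
      intro e _ ht
      rw [homogeneousComponent_eq_zero _ _ (by simpa using ht)]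
      exact J.zero_mem
    | succ t ih =>
      intro e he ht
      have h1 := ih (e + 1) (by omega) (by omega)
      have h := hq (e + 1)
      rw [hpe _ (by omega), homogeneousComponent_mul_of_isHomogeneous hy] at h
      refine hinj e he _ (homogeneousComponent_isHomogeneous e q) ?_
      rw [show y * homogeneousComponent e q = homogeneousComponent (e + 1) q -
        homogeneousComponent (e + 1) j by linear_combination -h]
      exact J.sub_mem h1 (hJ j hj _)
  exact hup (q.totalDegree + 1) e₁ le_rfl (by omega)

/-- If the linear form `y` vanishes at no point of the scheme defined by `J`, multiplication by `y`
is surjective modulo `J` in large degrees. -/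
theorem exists_forall_eq_add_mul [Finite σ] [IsAlgClosed K] {J : Ideal (MvPolynomial σ K)}
    (hJ : IsHomogeneousIdeal J) {y : MvPolynomial σ K} (hy : y.IsHomogeneous 1)
    (hzero : ∀ x : σ → K, x ≠ 0 → (∀ p ∈ J, eval x p = 0) → eval x y ≠ 0) :
    ∃ c, ∀ e ≥ c, ∀ p : MvPolynomial σ K, p.IsHomogeneous (e + 1) →
      ∃ q : MvPolynomial σ K, q.IsHomogeneous e ∧ p - y * q ∈ J := by
  classical
  have := Fintype.ofFinite σ
  -- J and y have no common zero besides the origin, so by the Nullstellensatz J + (y) contains a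
  -- power of the irrelevant ideal.
  have hrad : Ideal.span (Set.range (X : σ → MvPolynomial σ K)) ≤
      (J ⊔ Ideal.span {y}).radical := by
    rw [← vanishingIdeal_zeroLocus_eq_radical (K := K), Ideal.span_le]
    rintro _ ⟨i, rfl⟩ x hx
    rw [aeval_X]
    have hx0 : x = 0 := by
      by_contra h0
      refine hzero x h0 (fun p hp => ?_) ?_
      · rw [← aeval_eq_eval]; exact hx p (Ideal.mem_sup_left hp)
      · rw [← aeval_eq_eval]
        exact hx y (Ideal.mem_sup_right (Ideal.mem_span_singleton_self y))
    rw [hx0]; rfl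
  obtain ⟨c, hc⟩ := Ideal.exists_pow_le_of_le_radical_of_fg hrad (IsNoetherian.noetherian _)
  refine ⟨c, fun e he p hp => ?_⟩
  have hpm : p ∈ Ideal.span (Set.range (X : σ → MvPolynomial σ K)) ^ (e + 1) := by
    rw [Ideal.mem_span_pow_iff_exists_isHomogeneous]
    exact ⟨map C p, hp.map C, by rw [eval_map]; exact eval₂_eta p⟩
  obtain ⟨j, hj, w, hw, hjw⟩ := Submodule.mem_sup.1 (hc (Ideal.pow_le_pow_right (by omega) hpm))
  obtain ⟨q, rfl⟩ := Ideal.mem_span_singleton'.1 hw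
  refine ⟨homogeneousComponent e q, homogeneousComponent_isHomogeneous e q, ?_⟩
  have h : homogeneousComponent (e + 1) p = homogeneousComponent (e + 1) j +
      y * homogeneousComponent e q := by
    rw [← homogeneousComponent_mul_of_isHomogeneous hy, ← map_add, ← hjw, mul_comm q]
  rw [homogeneousComponent_eq_self hp] at h
  rw [h, add_sub_cancel_right]
  exact hJ j hj _

/-- A projective scheme with finitely many points whose Hilbert function is at least `N` in large
degrees contains a closed subscheme of dimension `0` and degree `N`. -/
theorem exists_isZeroDimOfDegree_of_projFinite [Finite σ] [IsAlgClosed K]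
    {J : Ideal (MvPolynomial σ K)} (hJ : IsHomogeneousIdeal J)
    (h : ProjFinite (K := K) {x : σ → K | ∀ p ∈ J, eval x p = 0}) {N e₀ : ℕ}
    (hN : ∀ e ≥ e₀, N ≤ hilbertFn J e) :
    ∃ I : Ideal (MvPolynomial σ K), IsHomogeneousIdeal I ∧ J ≤ I ∧ IsZeroDimOfDegree I N := by
  classical
  have := Fintype.ofFinite σ
  obtain ⟨F, hF⟩ := h
  obtain ⟨f, hf⟩ := exists_dual_ne_zero_of_finset (K := K) F
  set y := dualForm f
  have hy : y.IsHomogeneous 1 := isHomogeneous_dualForm f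
  have hfin : ∀ e, Module.Finite K (homogeneousSubmodule σ K e) := fun e =>
    Module.Finite.iff_fg.2 (homogeneousSubmodule_fg σ K e)
  obtain ⟨c, hc⟩ := exists_forall_eq_add_mul hJ hy (fun x hx0 hx => by
    obtain ⟨v, hvF, a, rfl⟩ := hF x hx
    rw [eval_dualForm, map_smul, smul_eq_mul]
    exact mul_ne_zero (fun h => hx0 (by simp [h])) (hf v hvF fun h => hx0 (by simp [h])))
  let W : (e : ℕ) → Submodule K (homogeneousSubmodule σ K e) := fun e =>
    (J.restrictScalars K).comap (homogeneousSubmodule σ K e).subtype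
  let mul : (e : ℕ) → homogeneousSubmodule σ K e →ₗ[K] homogeneousSubmodule σ K (e + 1) := fun e =>
    ((LinearMap.mulLeft K y).comp (homogeneousSubmodule σ K e).subtype).codRestrict _ fun p => by
      rw [add_comm e 1]
      exact hy.mul p.2
  have hmulW : ∀ e, W e ≤ (W (e + 1)).comap (mul e) := fun e p hp => J.mul_mem_left y hp
  let φ : (e : ℕ) → (homogeneousSubmodule σ K e ⧸ W e) →ₗ[K]
      (homogeneousSubmodule σ K (e + 1) ⧸ W (e + 1)) := fun e => (W e).mapQ _ (mul e) (hmulW e)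
  have hφ : ∀ e ≥ c, Function.Surjective (φ e) := by
    intro e he b
    obtain ⟨p, rfl⟩ := Submodule.Quotient.mk_surjective _ b
    obtain ⟨q, hq, hpq⟩ := hc e he p p.2
    refine ⟨Submodule.Quotient.mk ⟨q, hq⟩, ?_⟩
    rw [eq_comm, Submodule.mapQ_apply, Submodule.Quotient.eq]
    exact hpq
  have hanti : ∀ e ≥ c, hilbertFn J (e + 1) ≤ hilbertFn J e := fun e he =>
    LinearMap.finrank_le_finrank_of_surjective (hφ e he)
  -- From degree `c` on the Hilbert function does not increase, so it is constant from a place where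
  -- it is minimal; there the surjections given by multiplication by `y` are bijective.
  obtain ⟨e₁, he₁, hmin⟩ : ∃ e₁, max c e₀ ≤ e₁ ∧
      ∀ e ≥ e₁, hilbertFn J e₁ ≤ hilbertFn J e := by
    let T := (hilbertFn J) '' Set.Ici (max c e₀)
    obtain ⟨e₁, he₁, he₁'⟩ := Nat.sInf_mem (s := T) ⟨_, max c e₀, Set.mem_Ici.2 le_rfl, rfl⟩
    refine ⟨e₁, he₁, fun e he => ?_⟩
    rw [he₁']
    exact Nat.sInf_le ⟨e, le_trans he₁ he, rfl⟩
  have hce : c ≤ e₁ := (le_max_left _ _).trans he₁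
  have hconst : ∀ t, hilbertFn J (e₁ + t) = hilbertFn J e₁ := by
    intro t
    induction t with
    | zero => rfl
    | succ t ih =>
      refine le_antisymm ?_ (hmin _ (by omega))
      rw [← ih]
      exact hanti _ (hce.trans (Nat.le_add_right _ _))
  have hinj : ∀ e ≥ e₁, ∀ p : MvPolynomial σ K, p.IsHomogeneous e → y * p ∈ J → p ∈ J := by
    intro e he p hp hyp
    obtain ⟨t, rfl⟩ := Nat.exists_eq_add_of_le he
    have hbij : Function.Injective (φ (e₁ + t)) :=
      (LinearMap.injective_iff_surjective_of_finrank_eq_finrank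
        ((hconst t).trans (hconst (t + 1)).symm)).2 (hφ _ (by omega))
    have : φ (e₁ + t) (Submodule.Quotient.mk ⟨p, hp⟩) = 0 := by
      rw [Submodule.mapQ_apply, Submodule.Quotient.mk_eq_zero]
      exact hyp
    rw [map_eq_zero_iff _ hbij, Submodule.Quotient.mk_eq_zero] at this
    exact this
  -- The coordinate ring of the chart y = 1, which contains the whole scheme; its dimension is the
  -- stable value of the Hilbert function.
  let 𝔟 : Ideal (MvPolynomial σ K) := J ⊔ Ideal.span {y - 1}
  let x : σ → MvPolynomial σ K ⧸ 𝔟 := fun i => Ideal.Quotient.mkₐ K 𝔟 (X i)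
  have hx : ∀ p : MvPolynomial σ K, aeval x p = Ideal.Quotient.mkₐ K 𝔟 p := fun p => by
    have : aeval x = Ideal.Quotient.mkₐ K 𝔟 := by ext i; simp [x]
    rw [this]
  have hy1 : aeval x y = 1 := by
    rw [hx, ← sub_eq_zero, ← map_one (Ideal.Quotient.mkₐ K 𝔟), ← map_sub]
    exact Ideal.Quotient.eq_zero_iff_mem.2
      (Ideal.mem_sup_right (Ideal.mem_span_singleton_self _))
  have hxJ : ∀ p ∈ J, aeval x p = 0 := fun p hp => by
    rw [hx]
    exact Ideal.Quotient.eq_zero_iff_mem.2 (Ideal.mem_sup_left hp)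
  have hup : ∀ e, LinearMap.range (evalForms (K := K) x e) ≤
      LinearMap.range (evalForms (K := K) x (e + 1)) := by
    rintro e _ ⟨p, rfl⟩
    refine ⟨mul e p, ?_⟩
    change aeval x (y * (p : MvPolynomial σ K)) = aeval x (p : MvPolynomial σ K)
    rw [map_mul, hy1, one_mul]
  have hupmono : Monotone fun e => LinearMap.range (evalForms (K := K) x e) :=
    monotone_nat_of_le_succ hup
  have hdown : ∀ t, LinearMap.range (evalForms (K := K) x (c + t)) ≤
      LinearMap.range (evalForms (K := K) x c) := by
    intro t
    induction t with
    | zero => exact le_rfl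
    | succ t ih =>
      rintro _ ⟨p, rfl⟩
      obtain ⟨q, hq, hpq⟩ := hc (c + t) (by omega) p p.2
      apply ih
      refine ⟨⟨q, hq⟩, ?_⟩
      have := hxJ _ hpq
      rw [map_sub, map_mul, hy1, one_mul, sub_eq_zero] at this
      exact this.symm
  have htop : ∀ e ≥ c, LinearMap.range (evalForms (K := K) x e) = ⊤ := by
    intro e he
    rw [eq_top_iff]
    rintro b -
    obtain ⟨p, rfl⟩ := Ideal.Quotient.mk_surjective b
    have hp : Ideal.Quotient.mk 𝔟 p = aeval x p := (hx p).symm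
    rw [hp, ← sum_homogeneousComponent p, map_sum]
    refine Submodule.sum_mem _ fun i _ => hupmono he (hdown i (hupmono (by omega : i ≤ c + i)
      ⟨⟨homogeneousComponent i p, homogeneousComponent_isHomogeneous i p⟩, rfl⟩))
  have hEfin : FiniteDimensional K (MvPolynomial σ K ⧸ 𝔟) :=
    Module.Finite.of_surjective (evalForms (K := K) x c) (LinearMap.range_eq_top.1 (htop c le_rfl))
  refine exists_isZeroDimOfDegree_of_surjective hJ x hxJ c
    (fun e he => LinearMap.range_eq_top.1 (htop e he)) ?_
  have hE : hilbertFn J e₁ = Module.finrank K (MvPolynomial σ K ⧸ 𝔟) := by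
    rw [hilbertFn_eq_finrank_range J e₁ (evalForms (K := K) x e₁) fun p => ?_,
      htop e₁ (by omega), finrank_top]
    constructor
    · intro hp
      have hp' : Ideal.Quotient.mk 𝔟 (p : MvPolynomial σ K) = 0 := (hx p).symm.trans hp
      exact mem_of_isHomogeneous_of_mem_sup hJ hy hinj p.2 (Ideal.Quotient.eq_zero_iff_mem.1 hp')
    · exact fun hp => hxJ p hp
  rw [← hE]
  exact hN e₁ (by omega)

end ZeroDimensional

/-! ### Kernels in the hyperplane and bounds for their dimension. -/

namespace BlockTensor

variable {K : Type*} [Field K] {n r : ℕ} {d : Fin r → ℕ} (B : BlockTensor K n d)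

/-- The hyperplane `Z(h)`, as a linear subspace. -/
def hyperplane (h : Fin (n + 1) → K) : Submodule K (Fin (n + 1) → K) where
  carrier := {x | ∑ i, h i * x i = 0}
  add_mem' {x x'} hx hx' := by
    have hx : ∑ i, h i * x i = 0 := hx
    have hx' : ∑ i, h i * x' i = 0 := hx'
    change ∑ i, h i * (x i + x' i) = 0
    simp [mul_add, Finset.sum_add_distrib, hx, hx']
  zero_mem' := by simp
  smul_mem' c x hx := by
    have hx : ∑ i, h i * x i = 0 := hx
    change ∑ i, h i * (c * x i) = 0
    simp_rw [mul_left_comm _ c]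
    rw [← Finset.mul_sum, hx, mul_zero]

theorem mem_hyperplane {h x : Fin (n + 1) → K} : x ∈ hyperplane h ↔ ∑ i, h i * x i = 0 := Iff.rfl

theorem finrank_hyperplane {h : Fin (n + 1) → K} (hh : h ≠ 0) :
    Module.finrank K (hyperplane h) = n := by
  let f : Module.Dual K (Fin (n + 1) → K) := ∑ i, h i • LinearMap.proj i
  have hfx : ∀ x, f x = ∑ i, h i * x i := fun x => by simp [f]
  have hf : f ≠ 0 := fun h0 => hh (by
    ext i
    have := LinearMap.congr_fun h0 (Pi.single i 1)
    rw [hfx] at this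
    simpa [Pi.single_apply] using this)
  have : hyperplane h = LinearMap.ker f := by
    ext x; rw [mem_hyperplane, LinearMap.mem_ker, hfx]
  rw [this]
  have := Module.Dual.finrank_ker_add_one_of_ne_zero hf
  simpa using this

/-- The linear map `x ↦ A(x, y, ·)`. -/
noncomputable def actLin (y : (Σ l, Fin (d l)) → K) :
    (Fin (n + 1) → K) →ₗ[K] ((Σ l, Fin (d l)) → K) where
  toFun x := B.act x y
  map_add' x x' := B.act_add_left x x' y
  map_smul' c x := B.act_smul_left c x y

/-- The points `x` of the hyperplane `Z(h)` with `A(x, y, ·) = 0`. -/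
noncomputable def kerSpace (h : Fin (n + 1) → K) (y : (Σ l, Fin (d l)) → K) :
    Submodule K (Fin (n + 1) → K) :=
  hyperplane h ⊓ LinearMap.ker (B.actLin y)

theorem mem_kerSpace {h x : Fin (n + 1) → K} {y : (Σ l, Fin (d l)) → K} :
    x ∈ B.kerSpace h y ↔ ∑ i, h i * x i = 0 ∧ B.act x y = 0 := Iff.rfl

open Classical in
/-- The blocks in which a vector has a nonzero component. -/
noncomputable def blockSupport (y : (Σ l, Fin (d l)) → K) : Finset (Fin r) :=
  Finset.univ.filter fun l => ∃ j, y ⟨l, j⟩ ≠ 0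

theorem mem_blockSupport {y : (Σ l, Fin (d l)) → K} {l : Fin r} :
    l ∈ blockSupport y ↔ ∃ j, y ⟨l, j⟩ ≠ 0 := by
  simp [blockSupport]

theorem notMem_blockSupport {y : (Σ l, Fin (d l)) → K} {l : Fin r} :
    l ∉ blockSupport y ↔ ∀ j, y ⟨l, j⟩ = 0 := by
  simp [blockSupport]

theorem blockSupport_nonempty {y : (Σ l, Fin (d l)) → K} (hy : y ≠ 0) :
    (blockSupport y).Nonempty := by
  obtain ⟨⟨l, j⟩, hj⟩ := Function.ne_iff.1 hy
  exact ⟨l, mem_blockSupport.2 ⟨j, hj⟩⟩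

theorem eval_detForm (l : Fin r) (x : Fin (n + 1) → K) :
    eval x (B.detForm l) = (B.blockMat l x).det := by
  rw [← aeval_eq_eval]
  exact B.aeval_detForm l x

theorem eval_zero_detForm (hd : ∀ l, 2 ≤ d l) (l : Fin r) : eval 0 (B.detForm l) = 0 := by
  have : Nonempty (Fin (d l)) := ⟨⟨0, by have := hd l; omega⟩⟩
  rw [eval_detForm, show B.blockMat l (0 : Fin (n + 1) → K) = 0 by simp [blockMat],
    Matrix.det_zero]

theorem eval_quadric (i : Fin (n + 1)) (y : (Σ l, Fin (d l)) → K) :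
    eval y (B.quadric i) = B.psi y i := by
  simp [quadric, psi, pair, dotProduct, Matrix.mulVec, map_sum]

theorem isHomogeneous_quadric (i : Fin (n + 1)) : (B.quadric i).IsHomogeneous 2 := by
  refine IsHomogeneous.sum _ _ _ fun a _ => ?_
  refine (isHomogeneous_X K a).mul (n := 1) (IsHomogeneous.sum _ _ _ fun b _ => ?_)
  exact isHomogeneous_C_mul_X _ _

/-- The number of quadrics needed to cut out finitely many points. -/
theorem sum_le_add_two [IsAlgClosed K] (hC : ProjFinite (K := K) {y | B.psi y = 0}) :
    ∑ l, d l ≤ n + 2 := by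
  by_contra! hlt
  refine not_projFinite_of_card_add_one_lt (⊤ : Submodule K ((Σ l, Fin (d l)) → K)) B.quadric
    (fun i => ?_) ?_ (hC.subset fun y hy => funext fun i => ?_)
  · rw [eval_quadric]; simp [psi, pair]
  · rw [finrank_top, Module.finrank_fintype_fun_eq_card]
    simpa using hlt
  · rw [← eval_quadric]
    exact hy.2.2 i

variable {L : Submodule K ((Σ l, Fin (d l)) → K)} {h : Fin (n + 1) → K}

/-- Points `x` of `X ∩ H` with a kernel vector in `L` are singular on `X ∩ H`. -/
theorem eval_eq_zero_of_mem_kerSpace (hpair : ∀ y ∈ L, ∀ z ∈ L, ∃ c : K, B.pair y z = c • h)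
    {y : (Σ l, Fin (d l)) → K} (hy : y ∈ L) (hy0 : y ≠ 0) {x : Fin (n + 1) → K}
    (hx : x ∈ B.kerSpace h y) (hf : ∀ l ∉ blockSupport y, eval x (B.detForm l) = 0)
    {p : MvPolynomial (Fin (n + 1)) K} (hp : p ∈ singIdeal (B.sectionEqs h)) : eval x p = 0 := by
  rw [← aeval_eq_eval]
  obtain ⟨c, hc⟩ := hpair y hy y hy
  refine B.aeval_eq_zero_of_mem_singIdeal x y h (blockSupport y) (blockSupport_nonempty hy0) hx.2
    hx.1 ⟨c, fun i => ?_⟩ (fun l hl => ?_) (fun l hl => ?_)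
    (Or.inl fun l hl => notMem_blockSupport.1 hl) hp
  · rw [← pair_eq_sum_blockPair, hc]; rfl
  · obtain ⟨j, hj⟩ := mem_blockSupport.1 hl
    exact ⟨j, hj.isUnit⟩
  · rw [← eval_detForm]; exact hf l hl

theorem onX_of_mem_kerSpace {y : (Σ l, Fin (d l)) → K} {x : Fin (n + 1) → K}
    (hx : x ∈ B.kerSpace h y) (hf : ∀ l ∉ blockSupport y, eval x (B.detForm l) = 0) :
    B.OnX x := by
  intro l
  by_cases hl : l ∈ blockSupport y
  · obtain ⟨j, hj⟩ := mem_blockSupport.1 hl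
    rw [eval_detForm]
    refine det_eq_zero_of_mulVec_eq_zero (z := fun j => y ⟨l, j⟩) ?_ hj.isUnit
    ext j
    exact congrFun hx.2 ⟨l, j⟩
  · exact hf l hl

theorem card_sigma_subtype (S : Finset (Fin r)) :
    Fintype.card {a : Σ l, Fin (d l) // a.1 ∈ S} = ∑ l ∈ S, d l := by
  rw [Fintype.card_subtype]
  have : Finset.univ.filter (fun a : Σ l, Fin (d l) => a.1 ∈ S) =
      S.sigma fun l => (Finset.univ : Finset (Fin (d l))) := by
    ext a; simp
  rw [this, Finset.card_sigma]
  simp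

/-- Lower bound for the dimension of the space of `x` in the hyperplane with `A(x, y, ·) = 0`. -/
theorem add_le_finrank_kerSpace (hh : h ≠ 0)
    (hpair : ∀ y ∈ L, ∀ z ∈ L, ∃ c : K, B.pair y z = c • h)
    {y : (Σ l, Fin (d l)) → K} (hy : y ∈ L) {k : ℕ} (v : Fin k → (Σ l, Fin (d l)) → K)
    (hv : ∀ i, v i ∈ L)
    (hli : LinearIndependent K fun i => fun a : {a : Σ l, Fin (d l) // a.1 ∈ blockSupport y} =>
      v i a) :
    n + k ≤ Module.finrank K (B.kerSpace h y) + ∑ l ∈ blockSupport y, d l := by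
  set S := blockSupport y
  let V : Matrix (Fin k) {a : Σ l, Fin (d l) // a.1 ∈ S} K := Matrix.of fun i a => v i a
  let ρ : ((Σ l, Fin (d l)) → K) →ₗ[K] ({a : Σ l, Fin (d l) // a.1 ∈ S} → K) :=
    LinearMap.funLeft K K Subtype.val
  let φ : hyperplane h →ₗ[K] ({a : Σ l, Fin (d l) // a.1 ∈ S} → K) :=
    ρ ∘ₗ B.actLin y ∘ₗ (hyperplane h).subtype
  have hoff : ∀ x : Fin (n + 1) → K, ∀ a, a.1 ∉ S → B.act x y a = 0 := by
    intro x a ha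
    rw [act_apply]
    exact Finset.sum_eq_zero fun j _ => Finset.sum_eq_zero fun i _ => by
      rw [notMem_blockSupport.1 ha j, mul_zero]
  -- The pairing of `v i` with A(x, y, ·) is that of x with A(·, v i, y), a multiple of h, so it
  -- vanishes on the hyperplane. Each independent restriction of a vector of `L` thus cuts the
  -- target down by one dimension.
  have hrange : LinearMap.range φ ≤ LinearMap.ker V.mulVecLin := by
    rintro _ ⟨x, rfl⟩
    ext i
    obtain ⟨c, hc⟩ := hpair (v i) (hv i) y hy
    have h1 := B.sum_mul_pair x (v i) y
    rw [hc] at h1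
    have h2 : ∑ j, (x : Fin (n + 1) → K) j * (c • h) j = 0 := by
      have := x.2
      rw [mem_hyperplane] at this
      calc ∑ j, (x : Fin (n + 1) → K) j * (c • h) j = c * ∑ j, h j * (x : Fin (n + 1) → K) j := by
            rw [Finset.mul_sum]
            exact Finset.sum_congr rfl fun j _ => by simp; ring
        _ = 0 := by rw [this, mul_zero]
    rw [h2] at h1
    change ∑ a : {a : Σ l, Fin (d l) // a.1 ∈ S}, v i a * B.act x y a = 0
    rw [h1, ← Finset.sum_subtype (Finset.univ.filter fun a : Σ l, Fin (d l) => a.1 ∈ S)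
      (by simp) (fun a => v i a * B.act x y a), Finset.sum_filter]
    exact Finset.sum_congr rfl fun a _ => by
      split_ifs with ha
      · rfl
      · rw [hoff x a ha, mul_zero]
  have hker : Module.finrank K (LinearMap.ker φ) ≤ Module.finrank K (B.kerSpace h y) := by
    have hmap : (LinearMap.ker φ).map (hyperplane h).subtype ≤ B.kerSpace h y := by
      rintro _ ⟨x, hx, rfl⟩
      refine ⟨x.2, ?_⟩
      change B.act x y = 0
      ext a
      by_cases ha : a.1 ∈ S
      · exact congrFun hx ⟨a, ha⟩
      · exact hoff x a ha
    rw [← Submodule.finrank_map_subtype_eq]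
    exact Submodule.finrank_mono hmap
  have h1 := LinearMap.finrank_range_add_finrank_ker φ
  rw [finrank_hyperplane hh] at h1
  have h2 := Submodule.finrank_mono hrange
  have h3 := LinearMap.finrank_range_add_finrank_ker V.mulVecLin
  have h4 : V.rank = k := by
    have := LinearIndependent.rank_matrix (M := V) hli
    simpa using this
  rw [Matrix.rank] at h4
  rw [h4, Module.finrank_fintype_fun_eq_card, card_sigma_subtype] at h3
  omega

/-- In a larger space the equations of the blocks missed by y would leave infinitely many points up
to scaling, all of them singular on `X ∩ H`. -/
theorem finrank_kerSpace_le [IsAlgClosed K] (hd : ∀ l, 2 ≤ d l)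
    (hpair : ∀ y ∈ L, ∀ z ∈ L, ∃ c : K, B.pair y z = c • h)
    (hfin : ProjFinite (K := K) {x | ∀ p ∈ singIdeal (B.sectionEqs h), eval x p = 0})
    {y : (Σ l, Fin (d l)) → K} (hy : y ∈ L) (hy0 : y ≠ 0) :
    Module.finrank K (B.kerSpace h y) ≤ (blockSupport y)ᶜ.card + 1 := by
  by_contra! hlt
  refine not_projFinite_of_card_add_one_lt (B.kerSpace h y)
    (fun l : {l // l ∉ blockSupport y} => B.detForm l) (fun l => B.eval_zero_detForm hd l) ?_
    (hfin.subset fun x hx p hp => B.eval_eq_zero_of_mem_kerSpace hpair hy hy0 hx.1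
      (fun l hl => hx.2.2 ⟨l, hl⟩) hp)
  rw [Nat.card_eq_fintype_card, Fintype.card_subtype]
  rw [show Finset.univ.filter (fun l => l ∉ blockSupport y) = (blockSupport y)ᶜ by ext l; simp]
  exact hlt

end BlockTensor

/-! ### Contracted lines: block supports and common kernels. -/

namespace BlockTensor

variable {K : Type*} [Field K] {n r : ℕ} {d : Fin r → ℕ}

/-- The situation of a line `ℙ(L)` contracted by `ψ` to the point `[h]`, when `X ∩ H` has only
finitely many singular points. -/
structure IsContracted (B : BlockTensor K n d) (L : Submodule K ((Σ l, Fin (d l)) → K))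
    (h : Fin (n + 1) → K) : Prop where
  two_le : ∀ l, 2 ≤ d l
  finrank_eq : Module.finrank K L = 2
  ne_zero : h ≠ 0
  pair_mem : ∀ y ∈ L, ∀ z ∈ L, ∃ c : K, B.pair y z = c • h
  cayley_finite : ProjFinite (K := K) {y | B.psi y = 0}
  sing_finite : ProjFinite (K := K) {x | ∀ p ∈ singIdeal (B.sectionEqs h), eval x p = 0}
  inf_blockSpace : ∀ l, blockSpace K d l ≠ ⊤ → L ⊓ blockSpace K d l = ⊥
  not_essential : ∀ x : Fin (n + 1) → K, x ≠ 0 → B.OnX x → ∑ i, h i * x i = 0 → ¬ B.IsEssential x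

namespace IsContracted

variable {B : BlockTensor K n d} {L : Submodule K ((Σ l, Fin (d l)) → K)} {h : Fin (n + 1) → K}

theorem two_mul_card_le (hB : B.IsContracted L h) (S : Finset (Fin r)) :
    2 * S.card ≤ ∑ l ∈ S, d l := by
  have := Finset.card_nsmul_le_sum S d 2 fun l _ => hB.two_le l
  simpa [mul_comm] using this

/-- A point of `X ∩ H` with two independent kernel vectors in one block is essential. -/
theorem exists_notMem_blockSupport (hB : B.IsContracted L h) {x : Fin (n + 1) → K} (hx0 : x ≠ 0)
    (hX : B.OnX x) (hx : ∑ i, h i * x i = 0) (hact : ∀ y ∈ L, B.act x y = 0) (l : Fin r) :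
    ∃ y ∈ L, y ≠ 0 ∧ l ∉ blockSupport y := by
  by_contra! hcon
  refine hB.not_essential x hx0 hX hx ⟨hX, l, ?_⟩
  let π : L →ₗ[K] (Fin (d l) → K) :=
    (LinearMap.funLeft K K fun j => (⟨l, j⟩ : Σ l, Fin (d l))) ∘ₗ L.subtype
  -- If every nonzero vector of `L` meets the block l, then `L` embeds into the kernel of that
  -- block, so the corank is at least 2.
  have hπ : Function.Injective π := by
    refine (injective_iff_map_eq_zero π).2 fun y hy => ?_
    by_contra hy0
    obtain ⟨j, hj⟩ := mem_blockSupport.1 (hcon y y.2 fun h => hy0 (Subtype.ext h))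
    exact hj (congrFun hy j)
  have hle : LinearMap.range π ≤ LinearMap.ker (B.blockAt l x).mulVecLin := by
    rintro _ ⟨y, rfl⟩
    rw [LinearMap.mem_ker, ← blockMat_eq_blockAt]
    ext j
    exact congrFun (hact y y.2) ⟨l, j⟩
  have h1 := Submodule.finrank_mono hle
  rw [LinearMap.finrank_range_of_inj hπ, hB.finrank_eq] at h1
  have h2 := LinearMap.finrank_range_add_finrank_ker (B.blockAt l x).mulVecLin
  rw [Module.finrank_fintype_fun_eq_card, Fintype.card_fin] at h2
  rw [Matrix.rank]
  omega

variable [IsAlgClosed K]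

theorem finrank_le (hB : B.IsContracted L h) {y : (Σ l, Fin (d l)) → K} (hy : y ∈ L)
    (hy0 : y ≠ 0) : Module.finrank K (B.kerSpace h y) ≤ (blockSupport y)ᶜ.card + 1 :=
  B.finrank_kerSpace_le hB.two_le hB.pair_mem hB.sing_finite hy hy0

theorem sum_add_sum_compl_le (hB : B.IsContracted L h) (S : Finset (Fin r)) :
    ∑ l ∈ S, d l + ∑ l ∈ Sᶜ, d l ≤ n + 2 := by
  rw [Finset.sum_add_sum_compl]
  exact B.sum_le_add_two hB.cayley_finite

end IsContracted

/-- No two nonzero vectors of `L` have disjoint block supports. -/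
def SupportsMeet (L : Submodule K ((Σ l, Fin (d l)) → K)) : Prop :=
  ∀ y ∈ L, y ≠ 0 → ∀ z ∈ L, z ≠ 0 → ∃ l, l ∈ blockSupport y ∧ l ∈ blockSupport z

namespace IsContracted

variable {B : BlockTensor K n d} {L : Submodule K ((Σ l, Fin (d l)) → K)} {h : Fin (n + 1) → K}
variable [IsAlgClosed K]

/-- When supports meet, no nonzero vector of `L` vanishes on the support of y, so restriction to it
keeps both dimensions of `L` and the count applies with k = 2. -/
theorem add_two_le (hB : B.IsContracted L h) (hL : SupportsMeet L) {y : (Σ l, Fin (d l)) → K}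
    (hy : y ∈ L) (hy0 : y ≠ 0) :
    n + 2 ≤ Module.finrank K (B.kerSpace h y) + ∑ l ∈ blockSupport y, d l := by
  let b := Module.finBasisOfFinrankEq K L hB.finrank_eq
  refine B.add_le_finrank_kerSpace hB.ne_zero hB.pair_mem hy (fun i => (b i : _ → K))
    (fun i => (b i).2) ?_
  rw [Fintype.linearIndependent_iff]
  intro c hc
  have h0 : ∑ i, c i • b i = 0 := by
    by_contra hne
    obtain ⟨l, hl, hl'⟩ := hL y hy hy0 (∑ i, c i • b i : L) (Subtype.mem _)
      (fun h => hne (Subtype.ext h))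
    obtain ⟨j, hj⟩ := mem_blockSupport.1 hl'
    apply hj
    have := congrFun hc ⟨⟨l, j⟩, hl⟩
    simpa [Finset.sum_apply] using this
  exact Fintype.linearIndependent_iff.1 b.linearIndependent c h0

theorem sum_compl_le (hB : B.IsContracted L h) (hL : SupportsMeet L) {y : (Σ l, Fin (d l)) → K}
    (hy : y ∈ L) (hy0 : y ≠ 0) :
    ∑ l ∈ (blockSupport y)ᶜ, d l ≤ Module.finrank K (B.kerSpace h y) := by
  have h1 := hB.add_two_le hL hy hy0
  have h2 := hB.sum_add_sum_compl_le (blockSupport y)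
  omega

/-- With c missed blocks, each of size at least 2, the two bounds on the kernel give 2c ≤ dim ≤ c +
1. -/
theorem card_compl_le (hB : B.IsContracted L h) (hL : SupportsMeet L)
    {y : (Σ l, Fin (d l)) → K} (hy : y ∈ L) (hy0 : y ≠ 0) : (blockSupport y)ᶜ.card ≤ 1 := by
  have h1 := hB.sum_compl_le hL hy hy0
  have h2 := hB.finrank_le hy hy0
  have h3 := hB.two_mul_card_le (blockSupport y)ᶜ
  omega

theorem compl_eq_singleton (hB : B.IsContracted L h) (hL : SupportsMeet L)
    {y : (Σ l, Fin (d l)) → K} (hy : y ∈ L) (hy0 : y ≠ 0) {l : Fin r} (hl : l ∉ blockSupport y) :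
    (blockSupport y)ᶜ = {l} := by
  have h1 := hB.card_compl_le hL hy hy0
  rw [Finset.card_le_one] at h1
  ext l'
  rw [Finset.mem_singleton]
  exact ⟨fun h' => h1 _ h' _ (by simpa using hl), fun h' => by subst h'; simpa using hl⟩

/-- A missed block makes the kernel at least 2-dimensional, so its single equation still has a
nonzero zero there. -/
theorem exists_onX_mem_kerSpace (hB : B.IsContracted L h) (hL : SupportsMeet L)
    {y : (Σ l, Fin (d l)) → K} (hy : y ∈ L) (hy0 : y ≠ 0) (hker : B.kerSpace h y ≠ ⊥) :
    ∃ x ∈ B.kerSpace h y, x ≠ 0 ∧ ∀ l ∉ blockSupport y, eval x (B.detForm l) = 0 := by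
  have hlt : (blockSupport y)ᶜ.card < Module.finrank K (B.kerSpace h y) := by
    have h1 := hB.sum_compl_le hL hy hy0
    have h2 := hB.card_compl_le hL hy hy0
    have h3 := hB.two_mul_card_le (blockSupport y)ᶜ
    have h4 : 0 < Module.finrank K (B.kerSpace h y) :=
      Nat.pos_of_ne_zero fun h0 => hker (Submodule.finrank_eq_zero.1 h0)
    omega
  obtain ⟨x, hx, hx0, hxf⟩ := exists_mem_ne_zero_forall_eval_eq_zero (B.kerSpace h y)
    (fun l : {l // l ∉ blockSupport y} => B.detForm l)
    (fun l => B.eval_zero_detForm hB.two_le l) (by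
      rw [Nat.card_eq_fintype_card, Fintype.card_subtype]
      rwa [show Finset.univ.filter (fun l => l ∉ blockSupport y) = (blockSupport y)ᶜ by
        ext l; simp])
  exact ⟨x, hx, hx0, fun l hl => hxf ⟨l, hl⟩⟩

/-- If all vectors of `L` are in kernels, some point of `X ∩ H` has all of `L` in its kernel. -/
theorem exists_forall_act_eq_zero (hB : B.IsContracted L h) (hL : SupportsMeet L)
    (hker : ∀ y ∈ L, y ≠ 0 → B.kerSpace h y ≠ ⊥) :
    ∃ x : Fin (n + 1) → K, x ≠ 0 ∧ B.OnX x ∧ ∑ i, h i * x i = 0 ∧ ∀ y ∈ L, B.act x y = 0 := by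
  let b := Module.finBasisOfFinrankEq K L hB.finrank_eq
  let z : (Σ l, Fin (d l)) → K := (b 0).1
  let w : (Σ l, Fin (d l)) → K := (b 1).1
  have hne : ∀ c : K, z + c • w ≠ 0 := by
    intro c h0
    have h1 : (1 : K) • b 0 + c • b 1 = 0 := by
      apply Subtype.ext
      simpa using h0
    have := Fintype.linearIndependent_iff.1 b.linearIndependent ![1, c]
      (by simpa [Fin.sum_univ_two] using h1) 0
    simp at this
  have hmem : ∀ c : K, z + c • w ∈ L := fun c => L.add_mem (b 0).2 (L.smul_mem c (b 1).2)
  choose x hx hx0 hxf using fun c : K =>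
    hB.exists_onX_mem_kerSpace hL (hmem c) (hne c) (hker _ (hmem c) (hne c))
  obtain ⟨F, hF⟩ := hB.sing_finite
  choose f hfF a hfa using fun c : K => hF (x c) fun p hp =>
    B.eval_eq_zero_of_mem_kerSpace hB.pair_mem (hmem c) (hne c) (hx c) (hxf c) hp
  have : Infinite K := IsAlgClosed.instInfinite
  -- There are infinitely many vectors z + cw but finitely many singular points, so one point serves
  -- two values of c, and then its kernel contains both z and w.
  obtain ⟨c, c', hcc, hff⟩ := Finite.exists_ne_map_eq_of_infinite fun c => (⟨f c, hfF c⟩ : F)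
  have hff : f c = f c' := congrArg Subtype.val hff
  have ha' : a c' ≠ 0 := fun h0 => hx0 c' (by rw [hfa, h0, zero_smul])
  have hxx : x c = (a c * (a c')⁻¹) • x c' := by
    rw [hfa c, hfa c', hff, smul_smul, mul_assoc, inv_mul_cancel₀ ha', mul_one]
  have h1 : B.act (x c) (z + c • w) = 0 := (hx c).2
  have h2 : B.act (x c) (z + c' • w) = 0 := by
    have : B.act (x c') (z + c' • w) = 0 := (hx c').2
    rw [hxx, act_smul_left, this, smul_zero]
  have hw : B.act (x c) w = 0 := by
    rw [act_add_right, act_smul_right] at h1 h2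
    have h3 : (c - c') • B.act (x c) w = 0 := by
      rw [sub_smul, sub_eq_zero]
      exact add_left_cancel (h1.trans h2.symm)
    exact (smul_eq_zero.1 h3).resolve_left (sub_ne_zero.2 hcc)
  have hz : B.act (x c) z = 0 := by
    rw [act_add_right, act_smul_right, hw, smul_zero, add_zero] at h1
    exact h1
  refine ⟨x c, hx0 c, B.onX_of_mem_kerSpace (hx c) (hxf c), (hx c).1, fun y hy => ?_⟩
  have hy' := congrArg Subtype.val (b.sum_repr ⟨y, hy⟩)
  rw [Fin.sum_univ_two] at hy'
  have hy'' : y = (b.repr ⟨y, hy⟩ 0) • z + (b.repr ⟨y, hy⟩ 1) • w := hy'.symm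
  rw [hy'', act_add_right, act_smul_right, act_smul_right, hz, hw, smul_zero, smul_zero, add_zero]

end IsContracted

end BlockTensor

/-! ### A vector of the pencil without kernel. -/

namespace BlockTensor

variable {K : Type*} [Field K] {n r : ℕ} {d : Fin r → ℕ}

/-- Two vectors that are blockwise proportional to a common vector `v`. -/
theorem pair_eq_sum_of_proportional (B : BlockTensor K n d) (v : (Σ l, Fin (d l)) → K)
    {y z : (Σ l, Fin (d l)) → K} {s t : Fin r → K} (hy : ∀ l j, y ⟨l, j⟩ = s l * v ⟨l, j⟩)
    (hz : ∀ l j, z ⟨l, j⟩ = t l * v ⟨l, j⟩) (i : Fin (n + 1)) :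
    B.pair y z i = ∑ l, s l * t l * B.blockPair l (fun j => v ⟨l, j⟩) (fun j => v ⟨l, j⟩) i := by
  rw [pair_eq_sum_blockPair]
  refine Finset.sum_congr rfl fun l _ => ?_
  simp only [blockPair, Finset.mul_sum]
  refine Finset.sum_congr rfl fun p _ => Finset.sum_congr rfl fun q _ => ?_
  rw [hy, hz]
  ring

variable [IsAlgClosed K]

/-- If `L` contains two vectors that are blockwise proportional to `v`, with ratios `(s l : t l)`
taking three distinct values, and `ψ` contracts `L` to a point, then the Cayley variety is
infinite. -/
theorem not_projFinite_of_proportional (B : BlockTensor K n d) (h : Fin (n + 1) → K)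
    (v : (Σ l, Fin (d l)) → K) (hv : ∀ l, l ∈ blockSupport v)
    {z w : (Σ l, Fin (d l)) → K} {s t : Fin r → K} (hz : ∀ l j, z ⟨l, j⟩ = s l * v ⟨l, j⟩)
    (hw : ∀ l j, w ⟨l, j⟩ = t l * v ⟨l, j⟩)
    (hzz : ∃ c : K, B.pair z z = c • h) (hzw : ∃ c : K, B.pair z w = c • h)
    (hww : ∃ c : K, B.pair w w = c • h) {l₀ l₁ l₂ : Fin r} (h0 : s l₀ = 0 ∧ t l₀ = 1)
    (h1 : s l₁ = 1 ∧ t l₁ = 0) (h2 : s l₂ = 1 ∧ t l₂ ≠ 0) :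
    ¬ ProjFinite (K := K) {y | B.psi y = 0} := by
  classical
  rintro ⟨F, hF⟩
  obtain ⟨q₀, hq₀⟩ := hzz
  obtain ⟨q₁, hq₁⟩ := hzw
  obtain ⟨q₂, hq₂⟩ := hww
  let g : Unit → MvPolynomial (Fin 3) K := fun _ => C q₀ * X 0 + C q₁ * X 1 + C q₂ * X 2
  refine not_projFinite_of_card_add_one_lt (⊤ : Submodule K (Fin 3 → K)) g (fun _ => by simp [g])
    (by simp) ?_
  choose j hj using fun l => mem_blockSupport.1 (hv l)
  let ρ : ((Σ l, Fin (d l)) → K) → Fin r → K := fun f l => (f ⟨l, j l⟩ / v ⟨l, j l⟩) ^ 2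
  -- Recovers μ from the values of the binary form μ₀s² + μ₁st + μ₂t² at the ratios (0 : 1), (1 :
  -- 0), (1 : t l₂); these values are the squared block factors of a point.
  let R : ((Σ l, Fin (d l)) → K) → Fin 3 → K := fun f =>
    ![ρ f l₁, (ρ f l₂ - ρ f l₁ - t l₂ ^ 2 * ρ f l₀) / t l₂, ρ f l₀]
  refine ⟨F.image R, fun μ hμ => ?_⟩
  have hμq : q₀ * μ 0 + q₁ * μ 1 + q₂ * μ 2 = 0 := by simpa [g] using hμ.2.2 ()
  -- Scaling the blocks of v by square roots of the values of the binary form makes ψ equal to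
  -- μ₀ψ(z) + μ₁A(·, z, w) + μ₂ψ(w) = (μ₀q₀ + μ₁q₁ + μ₂q₂) h. One linear condition on μ leaves a
  -- projective line of points of the Cayley variety.
  choose u hu using fun l => IsAlgClosed.exists_pow_nat_eq
    (μ 0 * s l ^ 2 + μ 1 * (s l * t l) + μ 2 * t l ^ 2) (n := 2) two_pos
  let y : (Σ l, Fin (d l)) → K := fun a => u a.1 * v a
  have hy : B.psi y = 0 := by
    ext i
    have e1 := B.pair_eq_sum_of_proportional v (y := y) (z := y) (s := u) (t := u)
      (fun _ _ => rfl) (fun _ _ => rfl) i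
    have e2 := B.pair_eq_sum_of_proportional v hz hz i
    have e3 := B.pair_eq_sum_of_proportional v hz hw i
    have e4 := B.pair_eq_sum_of_proportional v hw hw i
    rw [hq₀] at e2
    rw [hq₁] at e3
    rw [hq₂] at e4
    rw [Pi.smul_apply, smul_eq_mul] at e2 e3 e4
    rw [psi, e1, Pi.zero_apply]
    have e5 : ∀ l, u l * u l = μ 0 * (s l * s l) + μ 1 * (s l * t l) + μ 2 * (t l * t l) :=
      fun l => by linear_combination hu l
    simp_rw [e5, add_mul, Finset.sum_add_distrib, mul_assoc (μ _), ← Finset.mul_sum]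
    rw [← e2, ← e3, ← e4]
    linear_combination h i * hμq
  obtain ⟨f, hf, c, hc⟩ := hF y hy
  refine ⟨R f, Finset.mem_image_of_mem R hf, c ^ 2, ?_⟩
  have hρ : ∀ l, μ 0 * s l ^ 2 + μ 1 * (s l * t l) + μ 2 * t l ^ 2 = c ^ 2 * ρ f l := by
    intro l
    have e1 : u l * v ⟨l, j l⟩ = c * f ⟨l, j l⟩ := congrFun hc ⟨l, j l⟩
    have e2 : u l = c * (f ⟨l, j l⟩ / v ⟨l, j l⟩) := by
      rw [mul_div_assoc', eq_div_iff (hj l), e1]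
    rw [← hu l, e2, mul_pow]
  have r0 := hρ l₀
  have r1 := hρ l₁
  have r2 := hρ l₂
  rw [h0.1, h0.2] at r0
  rw [h1.1, h1.2] at r1
  rw [h2.1] at r2
  ext i
  fin_cases i
  · simp [R]; linear_combination r1
  · simp only [R, Pi.smul_apply, smul_eq_mul, Fin.mk_one, Matrix.cons_val_one, Matrix.cons_val_zero]
    rw [mul_div_assoc', eq_div_iff h2.2]
    linear_combination r2 - r1 - t l₂ ^ 2 * r0
  · simp [R]; linear_combination r0

namespace IsContracted

variable {B : BlockTensor K n d} {L : Submodule K ((Σ l, Fin (d l)) → K)} {h : Fin (n + 1) → K}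

/-- Otherwise each block is missed by a vector of `L` that misses no other block. Two of these span
`L`, and they are blockwise proportional with at least three different ratios, which contradicts the
finiteness of the Cayley variety. -/
theorem exists_forall_mem_blockSupport (hB : B.IsContracted L h) (hL : SupportsMeet L) :
    ∃ l, ∀ y ∈ L, y ≠ 0 → l ∈ blockSupport y := by
  by_contra! hcon
  choose y hyL hy0 hys using hcon
  have hcompl : ∀ l l', l' ≠ l → l' ∈ blockSupport (y l) := fun l l' hne => by
    have := hB.compl_eq_singleton hL (hyL l) (hy0 l) (hys l)
    by_contra hl'
    exact hne (Finset.mem_singleton.1 (this ▸ Finset.mem_compl.2 hl'))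
  obtain ⟨u, hu⟩ : ∃ u : L, u ≠ 0 := by
    have : Nontrivial L := Module.nontrivial_of_finrank_pos (R := K) (by rw [hB.finrank_eq]; simp)
    exact exists_ne 0
  obtain ⟨l₀, -⟩ := blockSupport_nonempty (y := u.1) fun h' => hu (Subtype.ext h')
  obtain ⟨l₁, hl₁⟩ := blockSupport_nonempty (hy0 l₀)
  have h10 : l₁ ≠ l₀ := fun h' => hys l₀ (h' ▸ hl₁)
  -- The third ratio comes from a block where the supports of z and w meet.
  obtain ⟨l₂, hl₂, hl₂'⟩ := hL _ (hyL l₀) (hy0 l₀) _ (hyL l₁) (hy0 l₁)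
  have h20 : l₂ ≠ l₀ := fun h' => hys l₀ (h' ▸ hl₂)
  have h21 : l₂ ≠ l₁ := fun h' => hys l₁ (h' ▸ hl₂')
  set z := y l₀ with hz
  set w := y l₁ with hw
  have hli : LinearIndependent K ![(⟨z, hyL l₀⟩ : L), ⟨w, hyL l₁⟩] := by
    rw [LinearIndependent.pair_iff]
    intro a b hab
    have hab' : ∀ c, a * z c + b * w c = 0 := fun c => congrFun (congrArg Subtype.val hab) c
    obtain ⟨j, hj⟩ := mem_blockSupport.1 (hcompl l₁ l₀ h10.symm)
    obtain ⟨j', hj'⟩ := mem_blockSupport.1 (hcompl l₀ l₁ h10)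
    have e1 := hab' ⟨l₀, j⟩
    have e2 := hab' ⟨l₁, j'⟩
    rw [show z ⟨l₀, j⟩ = 0 from notMem_blockSupport.1 (hys l₀) j, mul_zero, zero_add] at e1
    rw [show w ⟨l₁, j'⟩ = 0 from notMem_blockSupport.1 (hys l₁) j', mul_zero, add_zero] at e2
    exact ⟨(mul_eq_zero.1 e2).resolve_right hj', (mul_eq_zero.1 e1).resolve_right hj⟩
  let b := basisOfLinearIndependentOfCardEqFinrank hli (by simp [hB.finrank_eq])
  have hspan : ∀ u ∈ L, ∃ α β : K, ∀ a, u a = α * z a + β * w a := by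
    intro u hu
    have hu' := congrArg Subtype.val (b.sum_repr ⟨u, hu⟩)
    rw [Fin.sum_univ_two] at hu'
    refine ⟨b.repr ⟨u, hu⟩ 0, b.repr ⟨u, hu⟩ 1, fun a => ?_⟩
    have := congrFun hu' a
    simpa [b] using this.symm
  -- The combination of z and w that vanishes in block l is a proportionality between their
  -- components there. Block l₀, where z vanishes, is excluded.
  have hκ : ∀ l, ∃ κ : K, l ≠ l₀ → ∀ j, w ⟨l, j⟩ = κ * z ⟨l, j⟩ := by
    intro l
    by_cases hl : l = l₀
    · exact ⟨0, fun h' => absurd hl h'⟩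
    obtain ⟨α, β, hαβ⟩ := hspan (y l) (hyL l)
    obtain ⟨j, hj⟩ := mem_blockSupport.1 (hcompl l₀ l hl)
    have hβ : β ≠ 0 := by
      rintro rfl
      have e1 := hαβ ⟨l, j⟩
      rw [notMem_blockSupport.1 (hys l) j, zero_mul, add_zero] at e1
      have hα : α = 0 := (mul_eq_zero.1 e1.symm).resolve_right hj
      exact hy0 l (funext fun a => by rw [hαβ a, hα]; simp)
    refine ⟨-α / β, fun _ j' => ?_⟩
    have e1 := hαβ ⟨l, j'⟩
    rw [notMem_blockSupport.1 (hys l) j'] at e1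
    field_simp
    linear_combination -e1
  choose κ hκ using hκ
  let v : (Σ l, Fin (d l)) → K := fun a => if a.1 = l₀ then w a else z a
  refine B.not_projFinite_of_proportional h v (fun l => ?_) (z := z) (w := w)
    (s := fun l => if l = l₀ then 0 else 1) (t := fun l => if l = l₀ then 1 else κ l)
    (fun l j => ?_) (fun l j => ?_) (hB.pair_mem _ (hyL l₀) _ (hyL l₀))
    (hB.pair_mem _ (hyL l₀) _ (hyL l₁)) (hB.pair_mem _ (hyL l₁) _ (hyL l₁)) (l₀ := l₀) (l₁ := l₁)
    (l₂ := l₂) (by simp) ?_ ?_ hB.cayley_finite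
  · by_cases hl : l = l₀
    · obtain ⟨j, hj⟩ := mem_blockSupport.1 (hcompl l₁ l (hl ▸ h10.symm))
      exact mem_blockSupport.2 ⟨j, by simpa [v, hl] using hj⟩
    · obtain ⟨j, hj⟩ := mem_blockSupport.1 (hcompl l₀ l hl)
      exact mem_blockSupport.2 ⟨j, by simpa [v, hl] using hj⟩
  · by_cases hl : l = l₀
    · subst hl
      simpa using notMem_blockSupport.1 (hys l) j
    · simp [v, hl]
  · by_cases hl : l = l₀
    · simp [v, hl]
    · simpa [v, hl] using hκ l hl j
  · obtain ⟨j, hj⟩ := mem_blockSupport.1 (hcompl l₀ l₁ h10)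
    have e1 := hκ l₁ h10 j
    rw [show w ⟨l₁, j⟩ = 0 from notMem_blockSupport.1 (hys l₁) j] at e1
    simp only [h10, if_false, true_and]
    exact (mul_eq_zero.1 e1.symm).resolve_right hj
  · obtain ⟨j, hj⟩ := mem_blockSupport.1 (hcompl l₁ l₂ h21)
    simp only [h20, if_false, true_and]
    intro h0
    apply hj
    rw [← hw, hκ l₂ h20 j, h0, zero_mul]

/-- Some vector of `L` is in no kernel of a point of `H`. -/
theorem exists_kerSpace_eq_bot (hB : B.IsContracted L h) (hL : SupportsMeet L) :
    ∃ w ∈ L, w ≠ 0 ∧ B.kerSpace h w = ⊥ := by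
  by_contra! hcon
  obtain ⟨x, hx0, hX, hx, hact⟩ := hB.exists_forall_act_eq_zero hL hcon
  obtain ⟨l, hl⟩ := hB.exists_forall_mem_blockSupport hL
  obtain ⟨y, hy, hy0, hyl⟩ := hB.exists_notMem_blockSupport hx0 hX hx hact l
  exact hyl (hl y hy hy0)

end IsContracted

end BlockTensor

/-! ### Nilpotent endomorphisms with small kernel. -/

section Nilpotent

variable {K V : Type*} [Field K] [AddCommGroup V] [Module K V] [FiniteDimensional K V]

theorem Module.End.pow_finrank_eq_zero {T : Module.End K V} (hT : IsNilpotent T) :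
    T ^ Module.finrank K V = 0 := by
  have h := LinearMap.aeval_self_charpoly T
  rwa [hT.charpoly_eq_X_pow_finrank, map_pow, Polynomial.aeval_X] at h

/-- A nilpotent endomorphism with kernel of dimension at most one is cyclic. -/
theorem Module.End.exists_span_pow_eq_top {T : Module.End K V} (hT : IsNilpotent T)
    (hker : Module.finrank K (LinearMap.ker T) ≤ 1) :
    ∃ y : V, Submodule.span K (Set.range fun i : ℕ => (T ^ i) y) = ⊤ := by
  -- The range has codimension at most one, so one vector generates modulo the range; iterating, as
  -- in Nakayama's lemma, it generates the whole space.
  obtain ⟨y, hy⟩ : ∃ y : V, Submodule.span K {y} ⊔ LinearMap.range T = ⊤ := by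
    by_cases htop : LinearMap.range T = ⊤
    · exact ⟨0, by simp [htop]⟩
    obtain ⟨y, hy⟩ : ∃ y, y ∉ LinearMap.range T := by
      by_contra! h
      exact htop (Submodule.eq_top_iff'.2 h)
    refine ⟨y, Submodule.eq_top_of_finrank_eq (le_antisymm (Submodule.finrank_le _) ?_)⟩
    have hlt : LinearMap.range T < Submodule.span K {y} ⊔ LinearMap.range T :=
      lt_of_le_of_ne le_sup_right fun h => hy (h ▸ le_sup_left (a := Submodule.span K {y})
        (Submodule.mem_span_singleton_self y))
    have h1 := Submodule.finrank_lt_finrank_of_lt hlt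
    have h2 := LinearMap.finrank_range_add_finrank_ker T
    omega
  refine ⟨y, ?_⟩
  set W := Submodule.span K (Set.range fun i : ℕ => (T ^ i) y)
  have hW : ∀ i, (T ^ i) y ∈ W := fun i => Submodule.subset_span ⟨i, rfl⟩
  have key : ∀ i, ∀ x, ∃ u ∈ W, ∃ v, x = u + (T ^ i) v := by
    intro i
    induction i with
    | zero => exact fun x => ⟨0, W.zero_mem, x, by simp⟩
    | succ i ih =>
      intro x
      obtain ⟨u, hu, v, rfl⟩ := ih x
      obtain ⟨a, ha, b, hb, rfl⟩ := Submodule.mem_sup.1 (hy ▸ Submodule.mem_top (x := v))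
      obtain ⟨c, rfl⟩ := Submodule.mem_span_singleton.1 ha
      obtain ⟨v', rfl⟩ := hb
      refine ⟨u + c • (T ^ i) y, W.add_mem hu (W.smul_mem c (hW i)), v', ?_⟩
      rw [map_add, map_smul, pow_succ, add_assoc]
      rfl
  obtain ⟨N, hN⟩ := hT
  refine Submodule.eq_top_iff'.2 fun x => ?_
  obtain ⟨u, hu, v, rfl⟩ := key N x
  rwa [hN, LinearMap.zero_apply, add_zero]

/-- A nilpotent endomorphism with kernel of dimension two is cyclic up to a vector of the kernel
outside the range. -/
theorem Module.End.exists_span_pow_sup_eq_top {T : Module.End K V} (hT : IsNilpotent T)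
    (hker : Module.finrank K (LinearMap.ker T) = 2) {v : V} (hv : T v = 0)
    (hv' : v ∉ LinearMap.range T) :
    ∃ y : V, Submodule.span K (Set.range fun i : ℕ => (T ^ i) y) ⊔ Submodule.span K {v} = ⊤ ∧
      (T ^ (Module.finrank K V - 1)) y = 0 := by
  set N := Submodule.span K {v}
  have hv0 : v ≠ 0 := fun h => hv' (h ▸ Submodule.zero_mem _)
  have hN1 : Module.finrank K N = 1 := finrank_span_singleton hv0
  have hNker : N ≤ LinearMap.ker T := (Submodule.span_singleton_le_iff_mem _ _).2 hv
  -- N meets the range of T only in 0. Hence the endomorphism induced on V / N has kernel ker T / N,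
  -- of dimension at most one, and is cyclic.
  have hdisj : ∀ x, T x ∈ N → T x = 0 := by
    intro x hx
    obtain ⟨c, hc⟩ := Submodule.mem_span_singleton.1 hx
    by_cases hc0 : c = 0
    · rw [← hc, hc0, zero_smul]
    · exact absurd ⟨c⁻¹ • x, by rw [map_smul, ← hc, smul_smul, inv_mul_cancel₀ hc0, one_smul]⟩ hv'
  have hcomap : N ≤ N.comap T := fun x hx => by
    rw [Submodule.mem_comap, LinearMap.mem_ker.1 (hNker hx)]
    exact N.zero_mem
  let T' : Module.End K (V ⧸ N) := N.mapQ N T hcomap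
  have hpow : ∀ i x, (T' ^ i) (N.mkQ x) = N.mkQ ((T ^ i) x) := by
    intro i
    induction i with
    | zero => exact fun x => rfl
    | succ i ih =>
      intro x
      rw [pow_succ', pow_succ', Module.End.mul_apply, Module.End.mul_apply, ih]
      rfl
  have hT' : IsNilpotent T' := by
    obtain ⟨k, hk⟩ := hT
    refine ⟨k, LinearMap.ext fun x => ?_⟩
    obtain ⟨x, rfl⟩ := N.mkQ_surjective x
    rw [hpow, hk]
    simp
  have hfin : Module.finrank K (V ⧸ N) = Module.finrank K V - 1 := by
    have := N.finrank_quotient_add_finrank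
    omega
  have hker' : Module.finrank K (LinearMap.ker T') ≤ 1 := by
    have hle : LinearMap.ker T' ≤ (LinearMap.ker T).map N.mkQ := by
      intro x hx
      obtain ⟨x, rfl⟩ := N.mkQ_surjective x
      have : N.mkQ (T x) = 0 := hx
      rw [Submodule.mkQ_apply, Submodule.Quotient.mk_eq_zero] at this
      exact ⟨x, hdisj x this, rfl⟩
    refine (Submodule.finrank_mono hle).trans ?_
    let f := N.mkQ.domRestrict (LinearMap.ker T)
    have h1 := LinearMap.finrank_range_add_finrank_ker f
    have h2 : 0 < Module.finrank K (LinearMap.ker f) := by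
      have : Nontrivial (LinearMap.ker f) := by
        refine ⟨⟨⟨v, hv⟩, ?_⟩, 0, fun h => hv0 ?_⟩
        · change N.mkQ v = 0
          rw [Submodule.mkQ_apply, Submodule.Quotient.mk_eq_zero]
          exact Submodule.mem_span_singleton_self v
        · exact congrArg (fun a => ((a : LinearMap.ker T) : V)) (congrArg Subtype.val h)
      exact Module.finrank_pos
    have h3 : LinearMap.range f = (LinearMap.ker T).map N.mkQ := LinearMap.range_domRestrict _ _
    rw [← h3]
    omega
  obtain ⟨y, hy⟩ := Module.End.exists_span_pow_eq_top hT' hker'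
  obtain ⟨y, rfl⟩ := N.mkQ_surjective y
  have hfin2 : 2 ≤ Module.finrank K V := hker ▸ Submodule.finrank_le _
  refine ⟨y, ?_, ?_⟩
  · have h1 : (Submodule.span K (Set.range fun i : ℕ => (T ^ i) y)).map N.mkQ = ⊤ := by
      rw [Submodule.map_span, ← Set.range_comp, ← hy]
      congr 2
      ext i
      exact (hpow i y).symm
    have h2 := congrArg (Submodule.comap N.mkQ) h1
    rwa [Submodule.comap_map_eq, Submodule.ker_mkQ, Submodule.comap_top] at h2
  -- On V / N the power dim V - 1 vanishes, so it sends y into N. The exponent is positive, so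
  -- `hdisj` makes the value itself zero.
  · have h1 : N.mkQ ((T ^ (Module.finrank K V - 1)) y) = 0 := by
      rw [← hpow, ← hfin, Module.End.pow_finrank_eq_zero hT', LinearMap.zero_apply]
    rw [Submodule.mkQ_apply, Submodule.Quotient.mk_eq_zero] at h1
    obtain ⟨m, hm⟩ : ∃ m, Module.finrank K V - 1 = m + 1 := ⟨Module.finrank K V - 2, by omega⟩
    rw [hm, pow_succ', Module.End.mul_apply] at h1 ⊢
    exact hdisj _ h1

end Nilpotent

/-! ### Local algebras: truncated polynomials and extension by a socle element. -/

section Truncated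

open scoped Polynomial

/-- The algebra of truncated polynomials `K[ε] / (ε ^ b)`. -/
abbrev TruncPoly (K : Type*) [Field K] (b : ℕ) : Type _ := AdjoinRoot (Polynomial.X ^ b : K[X])

namespace TruncPoly

variable {K : Type*} [Field K] {b : ℕ}

/-- The generator of the algebra of truncated polynomials. -/
noncomputable def gen (K : Type*) [Field K] (b : ℕ) : TruncPoly K b := AdjoinRoot.root _

theorem gen_pow : gen K b ^ b = 0 := by
  have := AdjoinRoot.eval₂_root (Polynomial.X ^ b : K[X])
  rwa [Polynomial.eval₂_pow, Polynomial.eval₂_X] at this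

theorem finrank_eq : Module.finrank K (TruncPoly K b) = b := by
  rw [(AdjoinRoot.powerBasis (pow_ne_zero b (Polynomial.X_ne_zero (R := K)))).finrank,
    AdjoinRoot.powerBasis_dim, Polynomial.natDegree_X_pow]

instance : FiniteDimensional K (TruncPoly K b) :=
  (AdjoinRoot.powerBasis (pow_ne_zero b (Polynomial.X_ne_zero (R := K)))).finite

theorem eq_zero_of_sum_eq_zero {c : ℕ → K} (h : ∑ i ∈ Finset.range b, c i • gen K b ^ i = 0) :
    ∀ i < b, c i = 0 := by
  have h1 : AdjoinRoot.mk (Polynomial.X ^ b : K[X])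
      (∑ i ∈ Finset.range b, Polynomial.C (c i) * Polynomial.X ^ i) = 0 := by
    rw [map_sum, ← h]
    refine Finset.sum_congr rfl fun i _ => ?_
    rw [map_mul, map_pow, AdjoinRoot.mk_X, AdjoinRoot.mk_C, Algebra.smul_def]
    rfl
  rw [AdjoinRoot.mk_eq_zero, Polynomial.X_pow_dvd_iff] at h1
  intro i hi
  have := h1 i hi
  simpa [Polynomial.finsetSum_coeff, Polynomial.coeff_C_mul, Polynomial.coeff_X_pow, hi] using this

/-- The residue map of the local algebra of truncated polynomials. -/
noncomputable def aug (hb : b ≠ 0) : TruncPoly K b →ₐ[K] K :=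
  AdjoinRoot.liftAlgHom _ (Algebra.ofId K K) 0 (by simp [hb])

/-- The top power spans the socle, where multiplication only sees residues. This is the condition on
`s` required by `SocleExt`. -/
theorem mul_gen_pow (hb : b ≠ 0) (f : TruncPoly K b) :
    f * gen K b ^ (b - 1) = aug hb f • gen K b ^ (b - 1) := by
  induction f using AdjoinRoot.induction_on with
  | ih p =>
    have h1 : aug hb (AdjoinRoot.mk (Polynomial.X ^ b : K[X]) p) = p.coeff 0 := by
      rw [aug, AdjoinRoot.liftAlgHom_mk]
      simp [Polynomial.coeff_zero_eq_eval_zero, Polynomial.eval₂_at_zero]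
    rw [h1]
    nth_rewrite 1 [← Polynomial.divX_mul_X_add p]
    rw [map_add, map_mul, AdjoinRoot.mk_X, AdjoinRoot.mk_C, add_mul, mul_assoc]
    change _ * (gen K b * gen K b ^ (b - 1)) + _ = _
    rw [← pow_succ', Nat.sub_add_cancel (Nat.one_le_iff_ne_zero.2 hb), gen_pow, mul_zero, zero_add,
      Algebra.smul_def]
    rfl

end TruncPoly

end Truncated

section SocleExtension

variable {K O : Type*} [Field K] [CommRing O] [Algebra K O]

/-- The extension `O ⊕ K t` of an augmented algebra `O` by a generator `t` with `f t = α(f) t` for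
`f` in `O` and `t ^ 2 = q t + κ s`, where the element `s` of `O` satisfies `f s = α(f) s`. -/
@[ext]
structure SocleExt (α : O →ₐ[K] K) (s : O) (hs : ∀ f, f * s = α f • s) (q κ : K) where
  /-- The component in `O`. -/
  base : O
  /-- The coefficient of `t`. -/
  coeff : K

namespace SocleExt

variable {α : O →ₐ[K] K} {s : O} {hs : ∀ f, f * s = α f • s} {q κ : K}

instance : Zero (SocleExt α s hs q κ) := ⟨⟨0, 0⟩⟩

instance : One (SocleExt α s hs q κ) := ⟨⟨1, 0⟩⟩

instance : Add (SocleExt α s hs q κ) := ⟨fun a b => ⟨a.base + b.base, a.coeff + b.coeff⟩⟩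

instance : Neg (SocleExt α s hs q κ) := ⟨fun a => ⟨-a.base, -a.coeff⟩⟩

instance : SMul K (SocleExt α s hs q κ) := ⟨fun c a => ⟨c • a.base, c * a.coeff⟩⟩

instance : Mul (SocleExt α s hs q κ) :=
  ⟨fun a b => ⟨a.base * b.base + (κ * a.coeff * b.coeff) • s,
    α a.base * b.coeff + α b.base * a.coeff + q * a.coeff * b.coeff⟩⟩

@[simp] theorem base_zero : (0 : SocleExt α s hs q κ).base = 0 := rfl
@[simp] theorem coeff_zero : (0 : SocleExt α s hs q κ).coeff = 0 := rfl
@[simp] theorem base_one : (1 : SocleExt α s hs q κ).base = 1 := rfl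
@[simp] theorem coeff_one : (1 : SocleExt α s hs q κ).coeff = 0 := rfl

variable (a b : SocleExt α s hs q κ)

@[simp] theorem base_add : (a + b).base = a.base + b.base := rfl
@[simp] theorem coeff_add : (a + b).coeff = a.coeff + b.coeff := rfl
@[simp] theorem base_neg : (-a).base = -a.base := rfl
@[simp] theorem coeff_neg : (-a).coeff = -a.coeff := rfl
@[simp] theorem base_smul (c : K) : (c • a).base = c • a.base := rfl
@[simp] theorem coeff_smul (c : K) : (c • a).coeff = c * a.coeff := rfl
@[simp] theorem base_mul :
    (a * b).base = a.base * b.base + (κ * a.coeff * b.coeff) • s := rfl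
@[simp] theorem coeff_mul :
    (a * b).coeff = α a.base * b.coeff + α b.base * a.coeff + q * a.coeff * b.coeff := rfl

instance : CommRing (SocleExt α s hs q κ) where
  add_assoc a b c := by ext <;> simp [add_assoc]
  zero_add a := by ext <;> simp
  add_zero a := by ext <;> simp
  add_comm a b := by ext <;> simp [add_comm]
  neg_add_cancel a := by ext <;> simp
  left_distrib a b c := by
    ext
    · simp [mul_add, add_smul]
      abel
    · simp
      ring
  right_distrib a b c := by
    ext
    · simp [mul_add, add_mul, add_smul]
      abel
    · simp
      ring
  zero_mul a := by ext <;> simp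
  mul_zero a := by ext <;> simp
  mul_assoc a b c := by
    ext
    · simp only [base_mul, coeff_mul, add_mul, mul_add, smul_mul_assoc, mul_smul_comm, hs,
        mul_comm s, smul_smul]
      simp only [add_assoc, mul_assoc, ← add_smul]
      congr 2
      ring
    · simp only [base_mul, coeff_mul, map_add, map_mul, map_smul, smul_eq_mul]
      ring
  one_mul a := by ext <;> simp
  mul_one a := by ext <;> simp
  mul_comm a b := by
    ext
    · simp [mul_comm a.base, mul_right_comm]
    · simp
      ring
  nsmul := nsmulRec
  zsmul := zsmulRec

instance : Module K (SocleExt α s hs q κ) where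
  one_smul a := by ext <;> simp
  mul_smul c c' a := by ext <;> simp [mul_smul, mul_assoc]
  smul_zero c := by ext <;> simp
  smul_add c a b := by ext <;> simp [mul_add]
  add_smul c c' a := by ext <;> simp [add_smul, add_mul]
  zero_smul a := by ext <;> simp

instance : Algebra K (SocleExt α s hs q κ) :=
  Algebra.ofModule
    (fun c a b => by
      ext
      · simp [smul_add, smul_smul, mul_assoc, mul_left_comm]
      · simp
        ring)
    (fun c a b => by
      ext
      · simp [smul_add, smul_smul, mul_assoc, mul_left_comm]
      · simp
        ring)

/-- The inclusion of the base. -/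
def incl : O →ₐ[K] SocleExt α s hs q κ where
  toFun f := ⟨f, 0⟩
  map_one' := rfl
  map_mul' f g := by ext <;> simp
  map_zero' := rfl
  map_add' f g := by ext <;> simp
  commutes' c := by
    rw [Algebra.algebraMap_eq_smul_one, Algebra.algebraMap_eq_smul_one]
    ext <;> simp

@[simp] theorem base_incl (f : O) : (incl f : SocleExt α s hs q κ).base = f := rfl
@[simp] theorem coeff_incl (f : O) : (incl f : SocleExt α s hs q κ).coeff = 0 := rfl

/-- The added generator. -/
def gen : SocleExt α s hs q κ := ⟨0, 1⟩

@[simp] theorem base_gen : (gen : SocleExt α s hs q κ).base = 0 := rfl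
@[simp] theorem coeff_gen : (gen : SocleExt α s hs q κ).coeff = 1 := rfl

theorem incl_mul_gen (f : O) : (incl f : SocleExt α s hs q κ) * gen = α f • gen := by
  ext <;> simp

theorem gen_sq : (gen : SocleExt α s hs q κ) ^ 2 = q • gen + κ • incl s := by
  rw [sq]
  ext <;> simp

theorem eq_zero_of_incl_add_smul_gen {f : O} {c : K}
    (h : (incl f : SocleExt α s hs q κ) + c • gen = 0) : f = 0 ∧ c = 0 := by
  simpa using SocleExt.ext_iff.1 h

variable (α s hs q κ) in
/-- The underlying vector space. -/
def equivProd : SocleExt α s hs q κ ≃ₗ[K] O × K where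
  toFun a := (a.base, a.coeff)
  invFun p := ⟨p.1, p.2⟩
  map_add' _ _ := rfl
  map_smul' _ _ := rfl
  left_inv _ := rfl
  right_inv _ := rfl

variable [FiniteDimensional K O]

instance : FiniteDimensional K (SocleExt α s hs q κ) :=
  (equivProd α s hs q κ).symm.finiteDimensional

theorem finrank_eq : Module.finrank K (SocleExt α s hs q κ) = Module.finrank K O + 1 := by
  rw [(equivProd α s hs q κ).finrank_eq, Module.finrank_prod, Module.finrank_self]

end SocleExt

end SocleExtension

universe u

/-! ### Singular points over local algebras from nilpotent pencils. -/

section DualForm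

variable {K σ : Type*} [Field K] [Fintype σ] [DecidableEq σ] {E : Type*} [CommRing E] [Algebra K E]

theorem aeval_dualForm (f : Module.Dual K (σ → K)) (x : σ → E) :
    aeval x (dualForm f) = ∑ j, algebraMap K E (f (Pi.single j 1)) * x j := by
  simp [dualForm]

theorem aeval_dualForm_add (f : Module.Dual K (σ → K)) (x x' : σ → E) :
    aeval (x + x') (dualForm f) = aeval x (dualForm f) + aeval x' (dualForm f) := by
  simp [aeval_dualForm, mul_add, Finset.sum_add_distrib]

theorem aeval_dualForm_smul_algebraMap (f : Module.Dual K (σ → K)) (a : E) (u : σ → K) :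
    aeval (a • fun j => algebraMap K E (u j)) (dualForm f) = f u • a := by
  rw [aeval_dualForm, dual_apply_eq_sum f u, Algebra.smul_def (A := E), map_sum, Finset.sum_mul]
  refine Finset.sum_congr rfl fun j _ => ?_
  rw [Pi.smul_apply, smul_eq_mul, map_mul]
  ring

theorem aeval_dualForm_sum {ι : Type*} (f : Module.Dual K (σ → K)) (s : Finset ι) (x : ι → σ → E) :
    aeval (∑ i ∈ s, x i) (dualForm f) = ∑ i ∈ s, aeval (x i) (dualForm f) := by
  classical
  induction s using Finset.induction_on with
  | empty => simp [aeval_dualForm]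
  | insert i s hi ih => rw [Finset.sum_insert hi, Finset.sum_insert hi, aeval_dualForm_add, ih]

end DualForm

theorem Matrix.det_add_smul_of_eq_two {R : Type*} [CommRing R] {m : ℕ} (hm : m = 2)
    (P Q : Matrix (Fin m) (Fin m) R) (t : R) :
    (P + t • Q).det = P.det + t * (P.adjugate * Q).trace + t ^ 2 * Q.det := by
  subst hm
  rw [Matrix.trace_fin_two, Matrix.mul_apply, Matrix.mul_apply, Matrix.adjugate_fin_two]
  simp only [Matrix.det_fin_two, Fin.sum_univ_two, Matrix.add_apply, Matrix.smul_apply,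
    smul_eq_mul, Matrix.of_apply, Matrix.cons_val_zero, Matrix.cons_val_one]
  ring

namespace BlockTensor

variable {K : Type*} [Field K] {n r : ℕ} {d : Fin r → ℕ} (B : BlockTensor K n d)
variable {E : Type*} [CommRing E] [Algebra K E]

theorem act_sum_left {ι : Type*} (s : Finset ι) (x : ι → Fin (n + 1) → E)
    (y : (Σ l, Fin (d l)) → E) : B.act (∑ i ∈ s, x i) y = ∑ i ∈ s, B.act (x i) y := by
  classical
  induction s using Finset.induction_on with
  | empty => ext a; simp [act_apply]
  | insert i s hi ih => rw [Finset.sum_insert hi, Finset.sum_insert hi, act_add_left, ih]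

theorem blockMat_sum {ι : Type*} (l : Fin r) (s : Finset ι) (x : ι → Fin (n + 1) → E) :
    B.blockMat l (∑ i ∈ s, x i) = ∑ i ∈ s, B.blockMat l (x i) := by
  classical
  induction s using Finset.induction_on with
  | empty => simp [blockMat]
  | insert i s hi ih => rw [Finset.sum_insert hi, Finset.sum_insert hi, blockMat_add, ih]

theorem blockMat_map {E' : Type*} [CommRing E'] [Algebra K E'] (φ : E →ₐ[K] E') (l : Fin r)
    (x : Fin (n + 1) → E) : B.blockMat l (fun i => φ (x i)) = φ.mapMatrix (B.blockMat l x) := by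
  ext p q
  simp [blockMat_apply, map_sum]

theorem act_map {E' : Type*} [CommRing E'] [Algebra K E'] (φ : E →ₐ[K] E')
    (x : Fin (n + 1) → E) (y : (Σ l, Fin (d l)) → E) :
    B.act (fun i => φ (x i)) (fun a => φ (y a)) = fun a => φ (B.act x y a) := by
  ext a
  simp [act_apply, map_sum]

theorem sum_blockPair_add_mul (z w : (Σ l, Fin (d l)) → K) (ε : E) (i : Fin (n + 1)) :
    ∑ l, B.blockPair l (fun j => algebraMap K E (z ⟨l, j⟩) + ε * algebraMap K E (w ⟨l, j⟩))
      (fun j => algebraMap K E (z ⟨l, j⟩) + ε * algebraMap K E (w ⟨l, j⟩)) i =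
    algebraMap K E (B.pair z z i) + ε * (algebraMap K E (B.pair z w i) +
      algebraMap K E (B.pair w z i)) + ε ^ 2 * algebraMap K E (B.pair w w i) := by
  simp only [pair_eq_sum_blockPair, blockPair, map_sum, map_mul, Finset.mul_sum,
    ← Finset.sum_add_distrib, Algebra.algebraMap_self, RingHom.id_apply]
  refine Finset.sum_congr rfl fun l _ => Finset.sum_congr rfl fun p _ =>
    Finset.sum_congr rfl fun q _ => ?_
  ring

/-- The pencil spanned by `z` and `w` together with a nilpotent endomorphism `T` of a space of
points `ι v` of the hyperplane `Z(h)`, such that `A(ι v, z, ·) = -A(ι (T v), w, ·)`. -/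
structure IsNilpotentPencil (h : Fin (n + 1) → K) (z w : (Σ l, Fin (d l)) → K) {V : Type*}
    [AddCommGroup V] [Module K V] (T : Module.End K V) (ι : V →ₗ[K] (Fin (n + 1) → K)) :
    Prop where
  nilpotent : IsNilpotent T
  mem_hyperplane : ∀ v, ∑ i, h i * ι v i = 0
  act_eq : ∀ v, B.act (ι v) z = -B.act (ι (T v)) w
  pair_zz : ∃ c : K, B.pair z z = c • h
  pair_zw : ∃ c : K, B.pair z w = c • h
  pair_wz : ∃ c : K, B.pair w z = c • h
  pair_ww : ∃ c : K, B.pair w w = c • h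
  mem_blockSupport : ∀ l, l ∈ blockSupport w
  ne_zero : z ≠ 0
  card_compl_le : (blockSupport z)ᶜ.card ≤ 1

/-- A point `x` with coordinates in a finite algebra of dimension at most `dim V`, on which `J`
vanishes, such that the linear forms vanishing at `x` vanish on the image of `V`. -/
def HasPointAlgebra {σ : Type*} [Fintype σ] [DecidableEq σ] {K : Type u} [Field K]
    (J : Ideal (MvPolynomial σ K)) {V : Type*}
    [AddCommGroup V] [Module K V] (ι : V →ₗ[K] (σ → K)) : Prop :=
  ∃ (E : Type u) (_ : CommRing E) (_ : Algebra K E) (_ : FiniteDimensional K E) (x : σ → E),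
    Module.finrank K E ≤ Module.finrank K V ∧ (∀ p ∈ J, aeval x p = 0) ∧
    ∀ f : Module.Dual K (σ → K), aeval x (dualForm f) = 0 → ∀ v, f (ι v) = 0

namespace IsNilpotentPencil

variable {B} {h : Fin (n + 1) → K} {z w : (Σ l, Fin (d l)) → K} {V : Type*}
  [AddCommGroup V] [Module K V] {T : Module.End K V} {ι : V →ₗ[K] (Fin (n + 1) → K)}

/-- The kernel vector is z + εw: a unit in some coordinate of each block that meets z, because ε is
nilpotent, and ε times a unimodular vector in the at most one block missed by z. -/
theorem aeval_eq_zero (hP : B.IsNilpotentPencil h z w T ι) {ε : E} (hε : IsNilpotent ε)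
    {x : Fin (n + 1) → E} (hh : ∑ i, algebraMap K E (h i) * x i = 0)
    (hact : B.act x (fun a => algebraMap K E (z a) + ε * algebraMap K E (w a)) = 0)
    (hf : ∀ l ∉ blockSupport z, (B.blockMat l x).det = 0)
    {p : MvPolynomial (Fin (n + 1)) K} (hp : p ∈ singIdeal (B.sectionEqs h)) : aeval x p = 0 := by
  obtain ⟨c₁, h₁⟩ := hP.pair_zz
  obtain ⟨c₂, h₂⟩ := hP.pair_zw
  obtain ⟨c₃, h₃⟩ := hP.pair_wz
  obtain ⟨c₄, h₄⟩ := hP.pair_ww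
  refine B.aeval_eq_zero_of_mem_singIdeal x _ h (blockSupport z)
    (blockSupport_nonempty hP.ne_zero) hact hh
    ⟨algebraMap K E c₁ + ε * (algebraMap K E c₂ + algebraMap K E c₃) + ε ^ 2 * algebraMap K E c₄,
      fun i => ?_⟩ (fun l hl => ?_) hf ?_ hp
  · rw [sum_blockPair_add_mul, h₁, h₂, h₃, h₄]
    simp only [Pi.smul_apply, smul_eq_mul, map_mul]
    ring
  · obtain ⟨j, hj⟩ := BlockTensor.mem_blockSupport.1 hl
    refine ⟨j, ?_⟩
    have hnil : IsNilpotent (ε * algebraMap K E (w ⟨l, j⟩)) :=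
      (Commute.all _ _).isNilpotent_mul_right hε
    exact hnil.isUnit_add_left_of_commute (hj.isUnit.map (algebraMap K E)) (Commute.all _ _)
  · by_cases hS : ∀ l, l ∈ blockSupport z
    · exact Or.inl fun l hl => absurd (hS l) hl
    push Not at hS
    obtain ⟨l₀, hl₀⟩ := hS
    refine Or.inr ⟨l₀, hl₀, fun l hl hne => absurd ?_ hne, ε,
      fun j => algebraMap K E (w ⟨l₀, j⟩), ?_, fun j => ?_⟩
    · exact Finset.card_le_one.1 hP.card_compl_le l (by simpa using hl) l₀ (by simpa using hl₀)
    · obtain ⟨j, hj⟩ := BlockTensor.mem_blockSupport.1 (hP.mem_blockSupport l₀)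
      exact ⟨j, hj.isUnit.map (algebraMap K E)⟩
    · simp [notMem_blockSupport.1 hl₀ j]

variable (T ι) in
/-- The point `∑ i, ε ^ i ι (T ^ (b - 1 - i) y)` over the truncated polynomials. -/
noncomputable def chainPoint (b : ℕ) (y : V) : Fin (n + 1) → TruncPoly K b :=
  ∑ i ∈ Finset.range b, TruncPoly.gen K b ^ i •
    fun j => algebraMap K (TruncPoly K b) (ι ((T ^ (b - (i + 1))) y) j)

variable {b : ℕ} {y : V}

theorem sum_mul_chainPoint (hP : B.IsNilpotentPencil h z w T ι) :
    ∑ i, algebraMap K (TruncPoly K b) (h i) * chainPoint T ι b y i = 0 := by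
  simp only [chainPoint, Finset.sum_apply, Pi.smul_apply, smul_eq_mul, Finset.mul_sum]
  rw [Finset.sum_comm]
  refine Finset.sum_eq_zero fun i _ => ?_
  have := congrArg (algebraMap K (TruncPoly K b)) (hP.mem_hyperplane ((T ^ (b - (i + 1))) y))
  rw [map_sum, map_zero] at this
  simp_rw [mul_left_comm, ← Finset.mul_sum, ← map_mul]
  rw [this, mul_zero]

/-- The contributions of z and of εw telescope along the chain; the two end terms vanish because T^b
y = 0 and ε^b = 0. -/
theorem act_chainPoint (hP : B.IsNilpotentPencil h z w T ι) (hy : (T ^ b) y = 0) :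
    B.act (chainPoint T ι b y) (fun a => algebraMap K (TruncPoly K b) (z a) +
      TruncPoly.gen K b * algebraMap K (TruncPoly K b) (w a)) = 0 := by
  set g := TruncPoly.gen K b
  let A : ℕ → (Σ l, Fin (d l)) → TruncPoly K b := fun i a =>
    g ^ i * algebraMap K (TruncPoly K b) (B.act (ι ((T ^ (b - i)) y)) w a)
  have hsplit : (fun a => algebraMap K (TruncPoly K b) (z a) +
      g * algebraMap K (TruncPoly K b) (w a)) =
      (fun a => algebraMap K (TruncPoly K b) (z a)) +
      g • fun a => algebraMap K (TruncPoly K b) (w a) := rfl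
  have h1 : B.act (chainPoint T ι b y) (fun a => algebraMap K (TruncPoly K b) (z a)) =
      -∑ i ∈ Finset.range b, A i := by
    rw [chainPoint, act_sum_left, ← Finset.sum_neg_distrib]
    refine Finset.sum_congr rfl fun i hi => ?_
    rw [act_smul_left, act_algebraMap]
    ext a
    have h' : T ((T ^ (b - (i + 1))) y) = (T ^ (b - i)) y := by
      rw [← Module.End.mul_apply, ← pow_succ']
      congr 2
      have := Finset.mem_range.1 hi
      omega
    simp [A, g, hP.act_eq, h']
  have h2 : g • B.act (chainPoint T ι b y) (fun a => algebraMap K (TruncPoly K b) (w a)) =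
      ∑ i ∈ Finset.range b, A (i + 1) := by
    rw [chainPoint, act_sum_left, Finset.smul_sum]
    refine Finset.sum_congr rfl fun i _ => ?_
    rw [act_smul_left, act_algebraMap]
    ext a
    simp [A, g, pow_succ', mul_assoc]
  have h3 : A 0 = 0 := by
    ext a
    simp [A, hy, act_apply]
  have h4 : A b = 0 := by
    ext a
    simp [A, g, TruncPoly.gen_pow]
  have h5 : ∑ i ∈ Finset.range b, A (i + 1) = ∑ i ∈ Finset.range b, A i := by
    have e1 := Finset.sum_range_succ A b
    have e2 := Finset.sum_range_succ' A b
    rw [h3, add_zero] at e2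
    rw [h4, add_zero] at e1
    rw [← e2, e1]
  rw [hsplit, act_add_right, act_smul_right, h1, h2, h5, neg_add_cancel]

/-- The powers of ε are linearly independent, so a linear form that vanishes at the chain point
vanishes on each of its coefficients. -/
theorem apply_pow_eq_zero (hy : (T ^ b) y = 0) {f : Module.Dual K (Fin (n + 1) → K)}
    (hf : aeval (chainPoint T ι b y) (dualForm f) = 0) (i : ℕ) : f (ι ((T ^ i) y)) = 0 := by
  by_cases hi : i < b
  · rw [chainPoint, aeval_dualForm_sum] at hf
    simp only [aeval_dualForm_smul_algebraMap] at hf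
    have := TruncPoly.eq_zero_of_sum_eq_zero (c := fun i => f (ι ((T ^ (b - (i + 1))) y))) hf
      (b - 1 - i) (by omega)
    rwa [show b - (b - 1 - i + 1) = i by omega] at this
  · have : (T ^ i) y = 0 := by
      rw [show i = (i - b) + b by omega, pow_add, Module.End.mul_apply, hy, map_zero]
    rw [this, map_zero, map_zero]

theorem apply_eq_zero_of_mem_span {f : Module.Dual K (Fin (n + 1) → K)}
    (hf : ∀ i, f (ι ((T ^ i) y)) = 0) {v : V}
    (hv : v ∈ Submodule.span K (Set.range fun i : ℕ => (T ^ i) y)) : f (ι v) = 0 := by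
  have : Submodule.span K (Set.range fun i : ℕ => (T ^ i) y) ≤ LinearMap.ker (f ∘ₗ ι) := by
    rw [Submodule.span_le]
    rintro _ ⟨i, rfl⟩
    exact hf i
  exact this hv

theorem isNilpotent_gen : IsNilpotent (TruncPoly.gen K b) := ⟨b, TruncPoly.gen_pow⟩

variable [FiniteDimensional K V]

theorem hasPointAlgebra_of_finrank_le_one (hP : B.IsNilpotentPencil h z w T ι)
    (hz : ∀ l, l ∈ blockSupport z) (hker : Module.finrank K (LinearMap.ker T) ≤ 1) :
    HasPointAlgebra (singIdeal (B.sectionEqs h)) ι := by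
  obtain ⟨y, hy⟩ := Module.End.exists_span_pow_eq_top hP.nilpotent hker
  have hy0 : (T ^ Module.finrank K V) y = 0 := by
    rw [Module.End.pow_finrank_eq_zero hP.nilpotent, LinearMap.zero_apply]
  refine ⟨TruncPoly K (Module.finrank K V), inferInstance, inferInstance, inferInstance,
    chainPoint T ι _ y, TruncPoly.finrank_eq.le, fun p hp => ?_, fun f hf v => ?_⟩
  · exact hP.aeval_eq_zero isNilpotent_gen hP.sum_mul_chainPoint (hP.act_chainPoint hy0)
      (fun l hl => absurd (hz l) hl) hp
  · exact apply_eq_zero_of_mem_span (apply_pow_eq_zero hy0 hf) (hy ▸ Submodule.mem_top)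

/-- The chain point need not satisfy f_{l₀} = 0 in the missed block. The second kernel direction v,
with a new parameter t, corrects it: f_{l₀} becomes a quadratic polynomial in t with invertible
leading coefficient, and the multiplication of t is chosen so that t is a root. -/
theorem hasPointAlgebra_of_finrank_eq_two (hP : B.IsNilpotentPencil h z w T ι) {l₀ : Fin r}
    (hl₀ : l₀ ∉ blockSupport z) (hd : d l₀ = 2) (hker : Module.finrank K (LinearMap.ker T) = 2)
    {v : V} (hv : T v = 0) (hdet : (B.blockMat l₀ (ι v)).det ≠ 0) :
    HasPointAlgebra (singIdeal (B.sectionEqs h)) ι := by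
  have hz0 : ∀ j, z ⟨l₀, j⟩ = 0 := notMem_blockSupport.1 hl₀
  obtain ⟨j₀, hj₀⟩ := BlockTensor.mem_blockSupport.1 (hP.mem_blockSupport l₀)
  -- As z vanishes in block l₀, the points of the range of T have the component of w there as kernel
  -- vector. Thus v, whose block is invertible, is outside the range.
  have hrange : ∀ u, (B.blockMat l₀ (ι (T u))).mulVec (fun j => w ⟨l₀, j⟩) = 0 := by
    intro u
    ext j
    have h1 := congrFun (hP.act_eq u) ⟨l₀, j⟩
    have h2 : B.act (ι u) z ⟨l₀, j⟩ = 0 := by simp [act_apply, hz0]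
    rw [h2, Pi.neg_apply, zero_eq_neg] at h1
    exact h1
  have hv' : v ∉ LinearMap.range T := by
    rintro ⟨u, rfl⟩
    exact hdet (det_eq_zero_of_mulVec_eq_zero (hrange u) hj₀.isUnit)
  obtain ⟨y, hy, hy0⟩ := Module.End.exists_span_pow_sup_eq_top hP.nilpotent hker hv hv'
  have hfin2 : 2 ≤ Module.finrank K V := hker ▸ Submodule.finrank_le _
  set b := Module.finrank K V - 1 with hbdef
  have hb : b ≠ 0 := by omega
  let O := TruncPoly K b
  let g : O := TruncPoly.gen K b
  let α : O →ₐ[K] K := TruncPoly.aug hb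
  let s : O := g ^ (b - 1)
  have hs : ∀ f : O, f * s = α f • s := TruncPoly.mul_gen_pow hb
  have hαg : α g = 0 := by
    have h1 : α g ^ b = 0 := by rw [← map_pow, TruncPoly.gen_pow, map_zero]
    exact pow_eq_zero_iff hb |>.1 h1
  let c : Fin (n + 1) → O := chainPoint T ι b y
  let P := B.blockMat l₀ c
  let Q := B.blockMat l₀ (ι v)
  -- The only coefficient of the chain not known to lie in the range of T is y, with weight ε^(b-1)
  -- = s. So P kills the component of w up to a multiple of s, and the determinant is a multiple of
  -- s.
  obtain ⟨k, hk⟩ : ∃ k : K, P.det = k • s := by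
    let wO : Fin (d l₀) → O := fun j => algebraMap K O (w ⟨l₀, j⟩)
    let u : Fin (d l₀) → O := fun j =>
      algebraMap K O ((B.blockMat l₀ (ι y)).mulVec (fun j => w ⟨l₀, j⟩) j)
    have hterm : ∀ i, (B.blockMat l₀ (g ^ i • fun j => algebraMap K O
        (ι ((T ^ (b - (i + 1))) y) j))).mulVec wO = g ^ i • fun j =>
        algebraMap K O ((B.blockMat l₀ (ι ((T ^ (b - (i + 1))) y))).mulVec
          (fun j => w ⟨l₀, j⟩) j) := by
      intro i
      rw [blockMat_smul, Matrix.smul_mulVec]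
      congr 1
      have := B.blockMat_map (Algebra.ofId K O) l₀ (ι ((T ^ (b - (i + 1))) y))
      ext j
      rw [show B.blockMat l₀ (fun j => algebraMap K O (ι ((T ^ (b - (i + 1))) y) j)) = _ from this]
      exact (RingHom.map_mulVec (algebraMap K O) _ _ j).symm
    have hPw : P.mulVec wO = s • u := by
      obtain ⟨b', hb'⟩ : ∃ b', b = b' + 1 := ⟨b - 1, by omega⟩
      change (B.blockMat l₀ (chainPoint T ι b y)).mulVec wO = _
      rw [chainPoint, blockMat_sum, Matrix.sum_mulVec, Finset.sum_eq_single (b - 1)]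
      · rw [hterm, show b - (b - 1 + 1) = 0 by omega]
        rfl
      · intro i hi hne
        rw [hterm]
        have hi' := Finset.mem_range.1 hi
        have : (T ^ (b - (i + 1))) y = T ((T ^ (b - (i + 1) - 1)) y) := by
          rw [← Module.End.mul_apply, ← pow_succ']
          congr 2
          omega
        rw [this, hrange]
        ext j
        simp
      · intro hb1
        exact absurd (Finset.mem_range.2 (by omega)) hb1
    have h1 : P.det • wO = s • P.adjugate.mulVec u := by
      rw [← Matrix.mulVec_smul, ← hPw, Matrix.mulVec_mulVec, Matrix.adjugate_mul,
        Matrix.smul_mulVec, Matrix.one_mulVec]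
    have h2 := congrFun h1 j₀
    rw [Pi.smul_apply, Pi.smul_apply, smul_eq_mul, smul_eq_mul, mul_comm s, hs] at h2
    refine ⟨(w ⟨l₀, j₀⟩)⁻¹ * α (P.adjugate.mulVec u j₀), ?_⟩
    rw [mul_smul, ← h2, mul_comm, ← Algebra.smul_def, smul_smul, inv_mul_cancel₀ hj₀, one_smul]
  let QO : Matrix (Fin (d l₀)) (Fin (d l₀)) O := (Algebra.ofId K O).mapMatrix Q
  let t₀ : O := (P.adjugate * QO).trace
  -- Solves det P + t·tr(adj(P) Q) + t² det Q = 0 for t², using det P = k s and t·f = α(f) t.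
  let q : K := -(α t₀) / Q.det
  let κ : K := -k / Q.det
  let E := SocleExt α s hs q κ
  let i : O →ₐ[K] E := SocleExt.incl
  let t : E := SocleExt.gen
  have hgt : i g * t = 0 := by
    rw [show i g * t = α g • t from SocleExt.incl_mul_gen g, hαg, zero_smul]
  let x : Fin (n + 1) → E := (fun j => i (c j)) + t • fun j => algebraMap K E (ι v j)
  have hcomm : ∀ e : K, i (algebraMap K O e) = algebraMap K E e := i.commutes
  have hxh : ∑ j, algebraMap K E (h j) * x j = 0 := by
    have h1 := congrArg i (hP.sum_mul_chainPoint (b := b) (y := y))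
    have h2 := congrArg (algebraMap K E) (hP.mem_hyperplane v)
    simp only [map_sum, map_mul, map_zero] at h1 h2
    simp only [x, Pi.add_apply, mul_add, Finset.sum_add_distrib, Pi.smul_apply, smul_eq_mul]
    simp_rw [mul_left_comm _ t]
    rw [← Finset.mul_sum, h2, mul_zero, add_zero]
    exact (Finset.sum_congr rfl fun j _ => by rw [← hcomm]).trans h1
  have hxact : B.act x (fun a => algebraMap K E (z a) + i g * algebraMap K E (w a)) = 0 := by
    have h1 := B.act_map i c (fun a => algebraMap K O (z a) + g * algebraMap K O (w a))
    rw [hP.act_chainPoint hy0] at h1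
    simp only [map_add, map_mul, hcomm, Pi.zero_apply, map_zero] at h1
    have h2 : (fun a => algebraMap K E (z a) + i g * algebraMap K E (w a)) =
        (fun a => algebraMap K E (z a)) + i g • fun a => algebraMap K E (w a) := rfl
    rw [act_add_left, h1, act_smul_left, h2, act_add_right, act_smul_right, act_algebraMap,
      act_algebraMap, smul_add, smul_smul, mul_comm t, hgt, zero_smul, hP.act_eq, hv]
    funext a
    simp [act_apply]
  have hxdet : (B.blockMat l₀ x).det = 0 := by
    have h1 : B.blockMat l₀ x = i.mapMatrix P + t • i.mapMatrix QO := by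
      have e1 := B.blockMat_map i l₀ c
      have e2 := B.blockMat_map (Algebra.ofId K E) l₀ (ι v)
      have e3 : i.mapMatrix QO = (Algebra.ofId K E).mapMatrix Q := by
        refine Matrix.ext fun p q => ?_
        exact hcomm _
      rw [blockMat_add, blockMat_smul, e1, e3, ← e2]
      rfl
    have h2 : ((i.mapMatrix P).adjugate * i.mapMatrix QO).trace = i t₀ := by
      have e1 := AlgHom.map_adjugate i P
      rw [← e1, ← map_mul]
      exact (AddMonoidHom.map_trace i.toRingHom.toAddMonoidHom (P.adjugate * QO)).symm
    have h3 : (i.mapMatrix QO).det = algebraMap K E Q.det := by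
      rw [← AlgHom.map_det, ← AlgHom.map_det]
      exact hcomm _
    have h4 : t * i t₀ = α t₀ • t := by
      rw [mul_comm]
      exact SocleExt.incl_mul_gen t₀
    have h5 : t ^ 2 = q • t + κ • i s := SocleExt.gen_sq
    rw [h1, Matrix.det_add_smul_of_eq_two hd, h2, h3, h4, h5, ← AlgHom.map_det, hk, map_smul,
      mul_comm (q • t + κ • i s), ← Algebra.smul_def, smul_add, smul_smul, smul_smul,
      show Q.det * q = -(α t₀) from mul_div_cancel₀ _ hdet,
      show Q.det * κ = -k from mul_div_cancel₀ _ hdet, neg_smul, neg_smul]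
    abel
  refine ⟨E, inferInstance, inferInstance, inferInstance, x, ?_, fun p hp => ?_, fun f hf u => ?_⟩
  · rw [SocleExt.finrank_eq, TruncPoly.finrank_eq]
    omega
  · refine hP.aeval_eq_zero (isNilpotent_gen.map i) hxh hxact (fun l hl => ?_) hp
    rwa [Finset.card_le_one.1 hP.card_compl_le l (by simpa using hl) l₀ (by simpa using hl₀)]
  · rw [aeval_dualForm_add, aeval_dualForm_smul_algebraMap] at hf
    have h1 : aeval (fun j => i (c j)) (dualForm f) = i (aeval c (dualForm f)) :=
      (comp_aeval_apply c i (dualForm f)).symm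
    rw [h1] at hf
    obtain ⟨hf1, hf2⟩ := SocleExt.eq_zero_of_incl_add_smul_gen hf
    obtain ⟨a, ha, e, he, rfl⟩ := Submodule.mem_sup.1 (hy ▸ Submodule.mem_top (x := u))
    obtain ⟨m, rfl⟩ := Submodule.mem_span_singleton.1 he
    rw [map_add, map_add, apply_eq_zero_of_mem_span (apply_pow_eq_zero hy0 hf1) ha, map_smul,
      map_smul, hf2, smul_zero, add_zero]

end IsNilpotentPencil

end BlockTensor

/-! ### Gluing the local algebras over all eigenvalues. -/

theorem sum_finrank_le_of_iSupIndep {K V ι : Type*} [Field K] [AddCommGroup V] [Module K V]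
    [FiniteDimensional K V] [Fintype ι] {G : ι → Submodule K V} (hG : iSupIndep G) :
    ∑ i, Module.finrank K (G i) ≤ Module.finrank K V := by
  classical
  rw [← Module.finrank_pi_fintype K, ← (DFinsupp.linearEquivFunOnFintype (R := K)
    (M := fun i => G i)).finrank_eq]
  exact LinearMap.finrank_le_finrank_of_injective hG.dfinsupp_lsum_injective

/-- The inclusion of a generalized eigenspace into the ambient space. -/
def genEigenspaceIncl {K W : Type*} [Field K] [AddCommGroup W] [Module K W] {H : Submodule K W}
    (Θ : Module.End K H) (μ : K) : Θ.maxGenEigenspace μ →ₗ[K] W :=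
  H.subtype ∘ₗ (Θ.maxGenEigenspace μ).subtype

/-- Local point algebras on the generalized eigenspaces of an endomorphism of a hyperplane combine
to a zero-dimensional scheme. -/
theorem exists_isZeroDimOfDegree_of_hasPointAlgebra {σ K : Type*} [Fintype σ] [DecidableEq σ]
    [Field K] [IsAlgClosed K] {J : Ideal (MvPolynomial σ K)} (hJ : IsHomogeneousIdeal J)
    {H : Submodule K (σ → K)} {N : ℕ} (hN : Module.finrank K H = N) (hH : Fintype.card σ ≤ N + 1)
    (Θ : Module.End K H)
    (hΘ : ∀ μ, BlockTensor.HasPointAlgebra J (genEigenspaceIncl Θ μ)) :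
    ∃ I : Ideal (MvPolynomial σ K), IsHomogeneousIdeal I ∧ J ≤ I ∧ IsZeroDimOfDegree I N := by
  classical
  subst hN
  have hind := Θ.independent_maxGenEigenspace
  have : Fintype {μ // Θ.maxGenEigenspace μ ≠ ⊥} := hind.fintypeNeBotOfFiniteDimensional
  let Λ := {μ // Θ.maxGenEigenspace μ ≠ ⊥}
  choose E instR instA instF x hle hx hf using hΘ
  let F := ∀ μ : Λ, E μ
  let X : σ → F := fun i μ => x μ i
  have hX : ∀ (p : MvPolynomial σ K) (μ : Λ), aeval X p μ = aeval (x μ) p := fun p μ =>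
    comp_aeval_apply (f := X) (Pi.evalAlgHom K (fun μ : Λ => E μ) μ) p
  let φ : Module.Dual K (σ → K) →ₗ[K] F :=
    { toFun := fun f => aeval X (dualForm f)
      map_add' := fun f g => by
        simp [aeval_dualForm, add_mul, Finset.sum_add_distrib]
      map_smul' := fun c f => by
        simp [aeval_dualForm, Finset.mul_sum, Algebra.smul_def, mul_assoc] }
  have hker : LinearMap.ker φ ≤ H.dualAnnihilator := by
    intro f hf0
    rw [Submodule.mem_dualAnnihilator]
    intro v hv
    have htop : ⨆ μ, Θ.maxGenEigenspace μ ≤ LinearMap.ker (f ∘ₗ H.subtype) := by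
      refine iSup_le fun μ u hu => ?_
      by_cases hμ : Θ.maxGenEigenspace μ = ⊥
      · rw [hμ, Submodule.mem_bot] at hu
        rw [hu]
        exact Submodule.zero_mem _
      · exact hf μ f ((hX _ ⟨μ, hμ⟩).symm.trans (congrFun hf0 ⟨μ, hμ⟩)) ⟨u, hu⟩
    rw [Module.End.iSup_maxGenEigenspace_eq_top] at htop
    exact htop (Submodule.mem_top (x := ⟨v, hv⟩))
  have hF : Module.finrank K F ≤ Module.finrank K H := by
    rw [Module.finrank_pi_fintype]
    exact (Finset.sum_le_sum fun (μ : Λ) _ => hle μ).trans (sum_finrank_le_of_iSupIndep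
      (G := fun μ : Λ => Θ.maxGenEigenspace μ) (hind.comp Subtype.val_injective))
  -- A linear form that vanishes at all local points vanishes on all generalized eigenspaces, hence
  -- on H, whose annihilator has dimension at most one. So linear forms take a space of values of
  -- dimension at least N, while the product algebra has dimension at most N.
  have hrange : Module.finrank K H ≤ Module.finrank K (LinearMap.range φ) := by
    have h1 := LinearMap.finrank_range_add_finrank_ker φ
    have h2 := Submodule.finrank_mono hker
    have h3 := Subspace.finrank_add_finrank_dualAnnihilator_eq H
    rw [Subspace.dual_finrank_eq] at h1
    rw [Module.finrank_fintype_fun_eq_card] at h1 h3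
    omega
  have hφ : Function.Surjective φ := by
    rw [← LinearMap.range_eq_top]
    exact Submodule.eq_top_of_finrank_eq
      (le_antisymm (Submodule.finrank_le _) (hF.trans hrange))
  refine exists_isZeroDimOfDegree_of_surjective hJ X (fun p hp => ?_) 1 (fun e he a => ?_)
    (hrange.trans (Submodule.finrank_le _))
  · ext μ
    rw [hX]
    exact hx μ p hp
  · obtain ⟨f, hfa⟩ := hφ a
    -- Multiplication by a linear form with value 1 transports surjectivity from degree 1 to every
    -- higher degree.
    obtain ⟨f₁, hf₁⟩ := hφ 1
    refine ⟨⟨dualForm f * dualForm f₁ ^ (e - 1), ?_⟩, ?_⟩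
    · rw [mem_homogeneousSubmodule]
      have := (isHomogeneous_dualForm f).mul ((isHomogeneous_dualForm f₁).pow (e - 1))
      rwa [one_mul, Nat.add_sub_cancel' he] at this
    · change aeval X (dualForm f * dualForm f₁ ^ (e - 1)) = a
      rw [map_mul, map_pow, show aeval X (dualForm f₁) = 1 from hf₁, one_pow, mul_one]
      exact hfa

/-! ### The case of meeting supports: eigenspaces of the pencil. -/

namespace BlockTensor.IsContracted

variable {K : Type*} [Field K] {n r : ℕ} {d : Fin r → ℕ} {B : BlockTensor K n d}
  {L : Submodule K ((Σ l, Fin (d l)) → K)} {h : Fin (n + 1) → K}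

section Eigenspace

variable {z w : (Σ l, Fin (d l)) → K} {Θ : Module.End K (hyperplane h)}

theorem act_add_smul_eq (hΘ : ∀ x : hyperplane h, B.act x z = -B.act (Θ x : hyperplane h) w)
    (μ : K) (x : hyperplane h) : B.act x (z + μ • w) =
      -B.act ((Θ - algebraMap K (Module.End K (hyperplane h)) μ) x : hyperplane h) w := by
  have h1 : B.actLin w ((Θ - algebraMap K (Module.End K (hyperplane h)) μ) x : hyperplane h) =
      B.actLin w (Θ x : hyperplane h) - μ • B.actLin w x := by
    rw [← map_smul, ← map_sub]
    rfl
  change _ = -B.actLin w ((Θ - algebraMap K (Module.End K (hyperplane h)) μ) x : hyperplane h)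
  rw [h1, act_add_right, act_smul_right, hΘ, neg_sub, sub_eq_add_neg, add_comm]
  rfl

variable (Θ) in
/-- The nilpotent part of an endomorphism on a generalized eigenspace. -/
noncomputable def nilpotentPart (μ : K) : Module.End K (Θ.maxGenEigenspace μ) :=
  (Θ - algebraMap K (Module.End K (hyperplane h)) μ).restrict
    (Module.End.mapsTo_maxGenEigenspace_of_comm (Algebra.mul_sub_algebraMap_commutes Θ μ) μ)

/-- Since A(·, w, ·) is injective on the hyperplane, the eigenvectors of Θ for μ are exactly the
points killed by z + μw. -/
theorem map_ker_nilpotentPart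
    (hΘ : ∀ x : hyperplane h, B.act x z = -B.act (Θ x : hyperplane h) w)
    (hker : B.kerSpace h w = ⊥) (μ : K) :
    (LinearMap.ker (nilpotentPart Θ μ)).map
      (genEigenspaceIncl Θ μ) = B.kerSpace h (z + μ • w) := by
  apply le_antisymm
  · rintro _ ⟨v, hv, rfl⟩
    refine ⟨(v : hyperplane h).2, ?_⟩
    have hv' : (Θ - algebraMap K (Module.End K (hyperplane h)) μ) v = 0 :=
      congrArg Subtype.val (LinearMap.mem_ker.1 hv)
    change B.act ((v : hyperplane h) : Fin (n + 1) → K) (z + μ • w) = 0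
    rw [act_add_smul_eq hΘ, hv', neg_eq_zero]
    exact map_zero (B.actLin w)
  · rintro x ⟨hxH, hx⟩
    let x' : hyperplane h := ⟨x, hxH⟩
    have h1 : (Θ - algebraMap K (Module.End K (hyperplane h)) μ) x' = 0 := by
      have h2 : B.act ((Θ - algebraMap K (Module.End K (hyperplane h)) μ) x' : hyperplane h) w
          = 0 := by
        rw [← neg_eq_zero, ← act_add_smul_eq hΘ]
        exact hx
      have h3 : (((Θ - algebraMap K (Module.End K (hyperplane h)) μ) x' : hyperplane h) :
          Fin (n + 1) → K) ∈ B.kerSpace h w := ⟨Subtype.mem _, h2⟩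
      rw [hker, Submodule.mem_bot] at h3
      exact Subtype.ext h3
    have h2 : x' ∈ Θ.maxGenEigenspace μ := by
      rw [Module.End.mem_maxGenEigenspace]
      exact ⟨1, by rw [pow_one]; exact h1⟩
    exact ⟨⟨x', h2⟩, Subtype.ext h1, rfl⟩

variable [IsAlgClosed K]

theorem isNilpotentPencil (hB : B.IsContracted L h) (hL : SupportsMeet L) (hz : z ∈ L) (hw : w ∈ L)
    (hsupp : ∀ l, l ∈ blockSupport w)
    (hΘ : ∀ x : hyperplane h, B.act x z = -B.act (Θ x : hyperplane h) w) (μ : K)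
    (hne : z + μ • w ≠ 0) :
    B.IsNilpotentPencil (V := Θ.maxGenEigenspace μ) h (z + μ • w) w (nilpotentPart Θ μ)
      (genEigenspaceIncl Θ μ) := by
  have hmem : z + μ • w ∈ L := L.add_mem hz (L.smul_mem μ hw)
  exact
    { nilpotent := Module.End.isNilpotent_restrict_maxGenEigenspace_sub_algebraMap Θ μ
      mem_hyperplane := fun v => (v : hyperplane h).2
      act_eq := fun v => act_add_smul_eq hΘ μ v
      pair_zz := hB.pair_mem _ hmem _ hmem
      pair_zw := hB.pair_mem _ hmem _ hw
      pair_wz := hB.pair_mem _ hw _ hmem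
      pair_ww := hB.pair_mem _ hw _ hw
      mem_blockSupport := hsupp
      ne_zero := hne
      card_compl_le := hB.card_compl_le hL hmem hne }

/-- If z + μw misses no block, the kernel bound makes the nilpotent part cyclic. If it misses one,
the bounds d l₀ ≤ dim ≤ 2 force a block of size 2 and a kernel of dimension 2. -/
theorem hasPointAlgebra_maxGenEigenspace (hB : B.IsContracted L h) (hL : SupportsMeet L)
    (hz : z ∈ L) (hw : w ∈ L) (hsupp : ∀ l, l ∈ blockSupport w) (hker : B.kerSpace h w = ⊥)
    (hΘ : ∀ x : hyperplane h, B.act x z = -B.act (Θ x : hyperplane h) w) (μ : K)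
    (hne : z + μ • w ≠ 0) :
    HasPointAlgebra (V := Θ.maxGenEigenspace μ) (singIdeal (B.sectionEqs h))
      (genEigenspaceIncl Θ μ) := by
  have hmem : z + μ • w ∈ L := L.add_mem hz (L.smul_mem μ hw)
  have hP := hB.isNilpotentPencil hL hz hw hsupp hΘ μ hne
  have hmap := map_ker_nilpotentPart hΘ hker μ
  have hfin : Module.finrank K (LinearMap.ker (nilpotentPart Θ μ)) =
      Module.finrank K (B.kerSpace h (z + μ • w)) := by
    rw [← hmap]
    exact (Submodule.equivMapOfInjective (genEigenspaceIncl Θ μ)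
      ((hyperplane h).subtype_injective.comp (Θ.maxGenEigenspace μ).subtype_injective)
      _).finrank_eq
  have hle := hB.finrank_le hmem hne
  by_cases hall : ∀ l, l ∈ blockSupport (z + μ • w)
  · refine hP.hasPointAlgebra_of_finrank_le_one hall (hfin.trans_le (hle.trans ?_))
    rw [show (blockSupport (z + μ • w))ᶜ = ∅ by ext l; simp [hall l]]
    simp
  · push Not at hall
    obtain ⟨l₀, hl₀⟩ := hall
    have hcompl := hB.compl_eq_singleton hL hmem hne hl₀
    have h1 := hB.sum_compl_le hL hmem hne
    rw [hcompl] at h1 hle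
    rw [Finset.sum_singleton] at h1
    rw [Finset.card_singleton] at hle
    have h2 := hB.two_le l₀
    -- Otherwise every point of this 2-dimensional kernel would be singular on `X ∩ H`.
    obtain ⟨x, hx, hdet⟩ : ∃ x ∈ B.kerSpace h (z + μ • w), (B.blockMat l₀ x).det ≠ 0 := by
      by_contra! hcon
      refine not_projFinite_of_card_add_one_lt (B.kerSpace h (z + μ • w))
        (Fin.elim0 : Fin 0 → MvPolynomial (Fin (n + 1)) K) (fun i => i.elim0) ?_
        (hB.sing_finite.subset fun x hx p hp => B.eval_eq_zero_of_mem_kerSpace hB.pair_mem hmem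
          hne hx.1 (fun l hl => ?_) hp)
      · simp only [Nat.card_eq_fintype_card, Fintype.card_fin]
        omega
      · have hll : l = l₀ := by
          rw [← Finset.mem_singleton, ← hcompl]
          simpa using hl
        rw [hll, eval_detForm]
        exact hcon x hx.1
    obtain ⟨v, hv, rfl⟩ := hmap ▸ hx
    exact hP.hasPointAlgebra_of_finrank_eq_two hl₀ (by omega) (by omega) hv hdet

end Eigenspace

variable [IsAlgClosed K]

/-- If `w` is in no kernel of a point of `H`, then `A(H, y, ·)` is contained in `A(H, w, ·)`. -/
theorem exists_act_eq (hB : B.IsContracted L h) {w : (Σ l, Fin (d l)) → K}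
    (hw : w ∈ L) (hker : B.kerSpace h w = ⊥) {y : (Σ l, Fin (d l)) → K} (hy : y ∈ L)
    {x : Fin (n + 1) → K} (hx : x ∈ hyperplane h) :
    ∃ x' ∈ hyperplane h, B.act x y = B.act x' w := by
  let b := Module.finBasisOfFinrankEq K L hB.finrank_eq
  let M : Matrix (Fin 2) (Σ l, Fin (d l)) K := Matrix.of fun i => (b i : (Σ l, Fin (d l)) → K)
  have hmem : ∀ y ∈ L, ∀ x ∈ hyperplane h, B.act x y ∈ LinearMap.ker M.mulVecLin := by
    intro y hy x hx
    ext i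
    obtain ⟨c, hc⟩ := hB.pair_mem _ (b i).2 y hy
    change ∑ a, (b i : (Σ l, Fin (d l)) → K) a * B.act x y a = 0
    rw [← sum_mul_pair, hc]
    calc ∑ j, x j * (c • h) j = c * ∑ j, h j * x j := by
          rw [Finset.mul_sum]
          exact Finset.sum_congr rfl fun j _ => by simp; ring
      _ = 0 := by rw [mem_hyperplane.1 hx, mul_zero]
  let φ := B.actLin w ∘ₗ (hyperplane h).subtype
  have hφ : LinearMap.ker φ = ⊥ := by
    rw [LinearMap.ker_eq_bot']
    intro u hu
    have : (u : Fin (n + 1) → K) ∈ B.kerSpace h w := ⟨u.2, hu⟩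
    rw [hker, Submodule.mem_bot] at this
    exact Subtype.ext this
  -- The orthogonal complement of L has dimension m + 1 - 2 ≤ n, and the image of the hyperplane
  -- under the injective map given by w already has dimension n.
  have hrange : LinearMap.range φ = LinearMap.ker M.mulVecLin := by
    refine Submodule.eq_of_le_of_finrank_le ?_ ?_
    · rintro _ ⟨u, rfl⟩
      exact hmem w hw u u.2
    · have h1 := LinearMap.finrank_range_add_finrank_ker φ
      rw [hφ, finrank_bot, finrank_hyperplane hB.ne_zero] at h1
      have h2 := LinearMap.finrank_range_add_finrank_ker M.mulVecLin
      have h3 : M.rank = 2 := by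
        have := LinearIndependent.rank_matrix (M := M)
          (b.linearIndependent.map' L.subtype L.ker_subtype)
        simpa using this
      rw [Matrix.rank] at h3
      rw [h3, Module.finrank_fintype_fun_eq_card, Fintype.card_sigma] at h2
      simp only [Fintype.card_fin] at h2
      have h4 := B.sum_le_add_two hB.cayley_finite
      omega
  obtain ⟨x', hx'⟩ : B.act x y ∈ LinearMap.range φ := hrange ▸ hmem y hy x hx
  exact ⟨x', x'.2, hx'.symm⟩

/-- The case in which no two vectors of `L` have disjoint block supports. -/
theorem exists_isZeroDimOfDegree_of_supportsMeet (hB : B.IsContracted L h) (hL : SupportsMeet L) :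
    ∃ I : Ideal (MvPolynomial (Fin (n + 1)) K), IsHomogeneousIdeal I ∧
      singIdeal (B.sectionEqs h) ≤ I ∧ IsZeroDimOfDegree I n := by
  obtain ⟨w, hw, hw0, hker⟩ := hB.exists_kerSpace_eq_bot hL
  have hsupp : ∀ l, l ∈ blockSupport w := by
    intro l
    by_contra hl
    have h1 := hB.sum_compl_le hL hw hw0
    rw [hker, finrank_bot, hB.compl_eq_singleton hL hw hw0 hl, Finset.sum_singleton] at h1
    have := hB.two_le l
    omega
  obtain ⟨z, hz, hzw⟩ : ∃ z ∈ L, z ∉ Submodule.span K {w} := by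
    by_contra! hcon
    have h1 := Submodule.finrank_mono (show L ≤ Submodule.span K {w} from hcon)
    rw [hB.finrank_eq, finrank_span_singleton hw0] at h1
    omega
  let φ := B.actLin w ∘ₗ (hyperplane h).subtype
  have hφ : LinearMap.ker φ = ⊥ := by
    rw [LinearMap.ker_eq_bot']
    intro u hu
    have : (u : Fin (n + 1) → K) ∈ B.kerSpace h w := ⟨u.2, hu⟩
    rw [hker, Submodule.mem_bot] at this
    exact Subtype.ext this
  obtain ⟨g, hg⟩ := φ.exists_leftInverse_of_injective hφ
  -- The pencil becomes an eigenvalue problem: Θ = -A(·, w)⁻¹ A(·, z).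
  let Θ : Module.End K (hyperplane h) := -(g ∘ₗ B.actLin z ∘ₗ (hyperplane h).subtype)
  have hΘ : ∀ x : hyperplane h, B.act x z = -B.act (Θ x : hyperplane h) w := by
    intro x
    obtain ⟨x', hx', hxx'⟩ := hB.exists_act_eq hw hker hz x.2
    have h1 : Θ x = -⟨x', hx'⟩ := by
      change -(g (B.act x z)) = _
      rw [hxx']
      exact congrArg Neg.neg (LinearMap.congr_fun hg ⟨x', hx'⟩)
    have h2 : B.act (-x') w = -B.act x' w := map_neg (B.actLin w) x'
    rw [h1, hxx']
    change _ = -B.act (-x') w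
    rw [h2, neg_neg]
  refine exists_isZeroDimOfDegree_of_hasPointAlgebra
    (B.isHomogeneousIdeal_singIdeal_sectionEqs h) (finrank_hyperplane hB.ne_zero)
    (Fintype.card_fin _).le Θ fun μ =>
      hB.hasPointAlgebra_maxGenEigenspace hL hz hw hsupp hker hΘ μ fun h0 => hzw
        (Submodule.mem_span_singleton.2 ⟨-μ, ?_⟩)
  rw [neg_smul]
  exact (eq_neg_of_add_eq_zero_left h0).symm

end BlockTensor.IsContracted

/-! ### Hilbert functions of intersections of two conics and of unions in two planes. -/

section Conics

variable {K : Type*} [Field K]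

theorem finrank_homogeneousSubmodule_fin_three (e : ℕ) :
    Module.finrank K (homogeneousSubmodule (Fin 3) K e) = (e + 2).choose 2 := by
  rw [homogeneousSubmodule_eq_finsupp_supported,
    (AddMonoidAlgebra.supportedEquivFinsupp {d : Fin 3 →₀ ℕ | d.degree = e}).finrank_eq]
  have hset : {d : Fin 3 →₀ ℕ | d.degree = e} =
      ((Finset.univ : Finset (Fin 3)).finsuppAntidiag e : Set (Fin 3 →₀ ℕ)) := by
    ext d
    rw [Finset.mem_coe, Finset.mem_finsuppAntidiag, Set.mem_ofPred_eq,
      Finsupp.degree_eq_sum]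
    simp
  rw [hset]
  have := Finset.card_finsuppAntidiag_nat_eq_choose (s := (Finset.univ : Finset (Fin 3))) e
  rw [Finset.card_univ, Fintype.card_fin, show 3 + e - 1 = e + 2 by omega] at this
  rw [Module.finrank_finsupp_self]
  refine (Fintype.card_coe _).trans (this.trans ?_)
  exact (Nat.choose_symm_of_eq_add rfl)

instance (e : ℕ) : FiniteDimensional K (homogeneousSubmodule (Fin 3) K e) :=
  Module.Finite.iff_fg.2 (homogeneousSubmodule_fg (Fin 3) K e)

/-- A scheme cut out by two conics in the plane has Hilbert function at least four. -/
theorem four_le_hilbertFn {g₁ g₂ : MvPolynomial (Fin 3) K} (hg₁ : g₁.IsHomogeneous 2)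
    (hg₂ : g₂.IsHomogeneous 2) (e : ℕ) : 4 ≤ hilbertFn (Ideal.span {g₁, g₂}) (e + 4) := by
  let R := fun e => homogeneousSubmodule (Fin 3) K e
  have hdim : ∀ e, Module.finrank K (R e) = (e + 2).choose 2 :=
    finrank_homogeneousSubmodule_fin_three
  let N := ((Ideal.span {g₁, g₂}).restrictScalars K).comap (R (e + 4)).subtype
  let m : R (e + 2) × R (e + 2) →ₗ[K] MvPolynomial (Fin 3) K :=
    (LinearMap.mulLeft K g₁ ∘ₗ (R (e + 2)).subtype).coprod
      (LinearMap.mulLeft K g₂ ∘ₗ (R (e + 2)).subtype)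
  have hm : ∀ a b, m (a, b) = g₁ * (a : MvPolynomial (Fin 3) K) + g₂ * b := fun a b => by simp [m]
  have hN : N.map (R (e + 4)).subtype ≤ LinearMap.range m := by
    rintro _ ⟨p, hp, rfl⟩
    obtain ⟨a, b, hab⟩ := Ideal.mem_span_pair.1 (show (p : MvPolynomial (Fin 3) K) ∈ _ from hp)
    refine ⟨(⟨homogeneousComponent (e + 2) a, homogeneousComponent_isHomogeneous _ _⟩,
      ⟨homogeneousComponent (e + 2) b, homogeneousComponent_isHomogeneous _ _⟩), ?_⟩
    rw [hm]
    change g₁ * homogeneousComponent (e + 2) a + g₂ * homogeneousComponent (e + 2) b = p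
    rw [← homogeneousComponent_mul_of_isHomogeneous hg₁,
      ← homogeneousComponent_mul_of_isHomogeneous hg₂, ← map_add, mul_comm g₁, mul_comm g₂, hab]
    exact homogeneousComponent_eq_self p.2
  have h1 := Submodule.finrank_mono hN
  rw [Submodule.finrank_map_subtype_eq] at h1
  have h2 : hilbertFn (Ideal.span {g₁, g₂}) (e + 4) + Module.finrank K N = (e + 6).choose 2 := by
    rw [← hdim (e + 4)]
    exact N.finrank_quotient_add_finrank
  have h3 := LinearMap.finrank_range_add_finrank_ker m
  rw [Module.finrank_prod, hdim] at h3
  have hchoose : ∀ i, (i + 1).choose 2 = i + i.choose 2 := fun i => by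
    rw [Nat.choose_succ_succ' i 1, Nat.choose_one_right]
  have c1 := hchoose (e + 5)
  have c2 := hchoose (e + 4)
  have c3 := hchoose (e + 3)
  have c4 := hchoose (e + 2)
  simp only [add_assoc, Nat.reduceAdd] at c1 c2 c3 c4 h3
  by_cases h0 : g₁ = 0 ∧ g₂ = 0
  · have hm0 : m = 0 := by
      refine LinearMap.ext fun p => ?_
      rw [show m p = _ from hm p.1 p.2, h0.1, h0.2]
      simp
    rw [hm0, LinearMap.range_zero, finrank_bot] at h1
    omega
  -- The Koszul relations bound the degree e + 4 part of the ideal by 2·C(e+4, 2) - C(e+2, 2), even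
  -- if the conics share a component. The second difference of binomial coefficients leaves 4.
  · let κ : R e →ₗ[K] R (e + 2) × R (e + 2) :=
      ((LinearMap.mulLeft K g₂ ∘ₗ (R e).subtype).codRestrict (R (e + 2)) fun c => by
          have := hg₂.mul c.2
          rw [add_comm] at this
          exact this).prod
        ((LinearMap.mulLeft K (-g₁) ∘ₗ (R e).subtype).codRestrict (R (e + 2)) fun c => by
          have := hg₁.neg.mul c.2
          rw [add_comm] at this
          exact this)
    have hκ : Function.Injective κ := by
      rw [injective_iff_map_eq_zero]
      intro c hc
      have e1 : g₂ * (c : MvPolynomial (Fin 3) K) = 0 :=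
        congrArg Subtype.val (congrArg Prod.fst hc)
      have e2 : -g₁ * (c : MvPolynomial (Fin 3) K) = 0 :=
        congrArg Subtype.val (congrArg Prod.snd hc)
      by_contra hc0
      have hc0' : (c : MvPolynomial (Fin 3) K) ≠ 0 := fun h => hc0 (Subtype.ext h)
      exact h0 ⟨neg_eq_zero.1 ((mul_eq_zero.1 e2).resolve_right hc0'),
        (mul_eq_zero.1 e1).resolve_right hc0'⟩
    have hle : LinearMap.range κ ≤ LinearMap.ker m := by
      rintro _ ⟨c, rfl⟩
      rw [LinearMap.mem_ker]
      refine (hm _ _).trans ?_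
      change g₁ * (g₂ * (c : MvPolynomial (Fin 3) K)) + g₂ * (-g₁ * c) = 0
      ring
    have h4 := Submodule.finrank_mono hle
    rw [LinearMap.finrank_range_of_inj hκ, hdim] at h4
    omega

end Conics

section TwoPlanes

/-- Rank-nullity for f, for f × g and for g restricted to ker f, together with ker (f × g) = ker f ∩
ker g. -/
theorem finrank_range_prod_ge {K V A C : Type*} [Field K] [AddCommGroup V] [Module K V]
    [FiniteDimensional K V] [AddCommGroup A] [Module K A] [AddCommGroup C] [Module K C]
    (f : V →ₗ[K] A) (g : V →ₗ[K] C) :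
    Module.finrank K (LinearMap.range f) +
      Module.finrank K ((LinearMap.ker f).map g) ≤
      Module.finrank K (LinearMap.range (f.prod g)) := by
  have h1 := LinearMap.finrank_range_add_finrank_ker f
  have h2 := LinearMap.finrank_range_add_finrank_ker (f.prod g)
  have h3 := LinearMap.finrank_range_add_finrank_ker (g.domRestrict (LinearMap.ker f))
  rw [LinearMap.range_domRestrict] at h3
  have h4 : Module.finrank K (LinearMap.ker (f.prod g)) =
      Module.finrank K (LinearMap.ker (g.domRestrict (LinearMap.ker f))) := by
    rw [← Submodule.finrank_map_subtype_eq, LinearMap.ker_prod, LinearMap.ker_domRestrict,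
      Submodule.map_comap_subtype]
  omega

theorem isHomogeneous_linSubst {K σ τ : Type*} [Field K] [Fintype τ] (u : τ → σ → K)
    {p : MvPolynomial σ K} {e : ℕ} (hp : p.IsHomogeneous e) : (linSubst u p).IsHomogeneous e := by
  rw [← one_mul e]
  exact hp.aeval _ fun i => IsHomogeneous.sum _ _ _ fun j _ => isHomogeneous_C_mul_X _ _

variable {K σ : Type*} [Field K] [Fintype σ] [DecidableEq σ]

theorem linSubst_dualForm {τ : Type*} [Fintype τ] (u : τ → σ → K) (f : Module.Dual K (σ → K)) :
    linSubst u (dualForm f) = ∑ j, C (f (u j)) * X j := by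
  simp only [linSubst, aeval_dualForm, Finset.mul_sum]
  rw [Finset.sum_comm]
  refine Finset.sum_congr rfl fun j _ => ?_
  rw [dual_apply_eq_sum f (u j), map_sum, Finset.sum_mul]
  refine Finset.sum_congr rfl fun i _ => ?_
  rw [map_mul, mul_assoc]
  rfl

/-- The Hilbert function of a scheme containing subschemes of two planes that meet in at most a
point. The planes are parametrized by `u` and `u'`. -/
theorem hilbertFn_add_hilbertFn_le {J : Ideal (MvPolynomial σ K)}
    {I I' : Ideal (MvPolynomial (Fin 3) K)} {u u' : Fin 3 → σ → K}
    (hI : ∀ p ∈ J, linSubst u p ∈ I) (hI' : ∀ p ∈ J, linSubst u' p ∈ I')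
    {ζ ξ : Fin 3 → Module.Dual K (σ → K)} (hζ : ∀ i j, ζ i (u j) = if i = j then 1 else 0)
    (hξ : ∀ i j, ξ i (u' j) = if i = j then 1 else 0) (hξu : ∀ i, i ≠ 0 → ∀ j, ξ i (u j) = 0)
    (e : ℕ) : hilbertFn I e + hilbertFn I' e ≤ hilbertFn J e + 1 := by
  let S := homogeneousSubmodule σ K e
  let R := homogeneousSubmodule (Fin 3) K e
  have : FiniteDimensional K S := Module.Finite.iff_fg.2 (homogeneousSubmodule_fg σ K e)
  have hsection : ∀ (u : Fin 3 → σ → K) (ζ : Fin 3 → Module.Dual K (σ → K)),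
      (∀ i j, ζ i (u j) = if i = j then 1 else 0) → ∀ p : MvPolynomial (Fin 3) K,
      linSubst u (aeval (fun i => dualForm (ζ i)) p) = p := by
    intro u ζ h p
    rw [comp_aeval_apply]
    have : (fun i => linSubst u (dualForm (ζ i))) = X := by
      funext i
      rw [linSubst_dualForm]
      simp [h]
    rw [this, aeval_X_left_apply]
  have hsec_hom : ∀ (ζ : Fin 3 → Module.Dual K (σ → K)) (p : MvPolynomial (Fin 3) K),
      p.IsHomogeneous e → (aeval (fun i => dualForm (ζ i)) p).IsHomogeneous e := by
    intro ζ p hp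
    rw [← one_mul e]
    exact hp.aeval _ fun i => isHomogeneous_dualForm _
  let π : ∀ I : Ideal (MvPolynomial (Fin 3) K), R →ₗ[K] MvPolynomial (Fin 3) K ⧸ I := fun I =>
    (Ideal.Quotient.mkₐ K I).toLinearMap ∘ₗ R.subtype
  have hπ : ∀ I, hilbertFn I e = Module.finrank K (LinearMap.range (π I)) := fun I =>
    hilbertFn_eq_finrank_range I e (π I) fun p => Ideal.Quotient.eq_zero_iff_mem
  let f : S →ₗ[K] MvPolynomial (Fin 3) K ⧸ I :=
    (Ideal.Quotient.mkₐ K I).toLinearMap ∘ₗ (linSubst u).toLinearMap ∘ₗ S.subtype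
  let f' : S →ₗ[K] MvPolynomial (Fin 3) K ⧸ I' :=
    (Ideal.Quotient.mkₐ K I').toLinearMap ∘ₗ (linSubst u').toLinearMap ∘ₗ S.subtype
  have hf : LinearMap.range (π I) ≤ LinearMap.range f := by
    rintro _ ⟨p, rfl⟩
    refine ⟨⟨_, hsec_hom ζ p p.2⟩, ?_⟩
    exact congrArg (Ideal.Quotient.mk I) (hsection u ζ hζ p)
  -- A form on the second plane that vanishes at [1 : 0 : 0] extends through ξ to a form that
  -- vanishes on the first plane, because only ξ 0 is nonzero there. Subtracting a multiple of X₀^e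
  -- achieves this vanishing, at the cost of one dimension.
  have hf' : LinearMap.range (π I') ≤
      (LinearMap.ker f).map f' ⊔
        Submodule.span K {Ideal.Quotient.mk I' (X 0 ^ e : MvPolynomial (Fin 3) K)} := by
    rintro _ ⟨p, rfl⟩
    let pt : Fin 3 → K := fun i => if i = 0 then 1 else 0
    let c : K := eval pt (p : MvPolynomial (Fin 3) K)
    let p' : MvPolynomial (Fin 3) K := p - c • (X 0 ^ e : MvPolynomial (Fin 3) K)
    have hp' : p'.IsHomogeneous e :=
      R.sub_mem p.2 (R.smul_mem c ((isHomogeneous_X_pow (R := K) (0 : Fin 3) e)))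
    have hdec : π I' p = Ideal.Quotient.mk I' p' +
        c • Ideal.Quotient.mk I' (X 0 ^ e : MvPolynomial (Fin 3) K) := by
      change Ideal.Quotient.mkₐ K I' (p : MvPolynomial (Fin 3) K) = Ideal.Quotient.mkₐ K I' p' +
        c • Ideal.Quotient.mkₐ K I' (X 0 ^ e : MvPolynomial (Fin 3) K)
      rw [← map_smul, ← map_add, sub_add_cancel]
    rw [hdec]
    refine Submodule.add_mem_sup ?_ (Submodule.smul_mem _ _ (Submodule.mem_span_singleton_self _))
    refine ⟨⟨_, hsec_hom ξ p' hp'⟩, ?_, ?_⟩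
    · rw [SetLike.mem_coe, LinearMap.mem_ker]
      change Ideal.Quotient.mk I (linSubst u (aeval (fun i => dualForm (ξ i)) p')) = 0
      have hz : linSubst u (aeval (fun i => dualForm (ξ i)) p') = 0 := by
        rw [comp_aeval_apply]
        have h1 : (fun i => linSubst u (dualForm (ξ i))) =
            fun i => linSubst u (dualForm (ξ 0)) * algebraMap K _ (pt i) := by
          funext i
          by_cases hi : i = 0
          · simp [hi, pt]
          · rw [linSubst_dualForm]
            simp [hi, pt, hξu i hi]
        rw [h1, aeval_mul_of_isHomogeneous hp', show (fun i => algebraMap K (MvPolynomial (Fin 3) K)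
          (pt i)) = algebraMap K (MvPolynomial (Fin 3) K) ∘ pt from rfl, aeval_algebraMap_apply,
          aeval_eq_eval]
        have h2 : eval pt p' = 0 := by simp [p', pt, c, smul_eval]
        rw [h2, map_zero, mul_zero]
      rw [hz, map_zero]
    · exact congrArg (Ideal.Quotient.mk I') (hsection u' ξ hξ p')
  have h1 : Module.finrank K (LinearMap.range (f.prod f')) ≤ hilbertFn J e := by
    refine finrank_range_le_hilbertFn J e (f.prod f') fun p hp => Prod.ext ?_ ?_
    · exact Ideal.Quotient.eq_zero_iff_mem.2 (hI p hp)
    · exact Ideal.Quotient.eq_zero_iff_mem.2 (hI' p hp)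
  have h2 := finrank_range_prod_ge f f'
  have h3 := Submodule.finrank_mono hf
  have h4 := (Submodule.finrank_mono hf').trans (Submodule.finrank_add_le_finrank_add_finrank _ _)
  have h5 := finrank_span_le_card (R := K)
    {Ideal.Quotient.mk I' (X 0 ^ e : MvPolynomial (Fin 3) K)}
  rw [Set.toFinset_singleton, Finset.card_singleton] at h5
  rw [hπ, hπ]
  omega

end TwoPlanes

/-! ### Coordinates adapted to two subspaces. -/

section DualFamily

variable {K V : Type*} [Field K] [AddCommGroup V] [Module K V]

theorem exists_dual_family {k : ℕ} {v : Fin k → V} (hv : LinearIndependent K v) :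
    ∃ ζ : Fin k → Module.Dual K V, ∀ i j, ζ i (v j) = if i = j then 1 else 0 := by
  obtain ⟨g, hg⟩ := (Fintype.linearCombination K v).exists_leftInverse_of_injective
    (LinearMap.ker_eq_bot'.2 fun c hc => funext (Fintype.linearIndependent_iff.1 hv c hc))
  refine ⟨fun i => LinearMap.proj i ∘ₗ g, fun i j => ?_⟩
  have h1 := LinearMap.congr_fun hg (Pi.single j 1)
  rw [LinearMap.comp_apply, Fintype.linearCombination_apply_single, one_smul] at h1
  rw [LinearMap.comp_apply, h1, LinearMap.id_apply, LinearMap.proj_apply, Pi.single_apply]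

variable [FiniteDimensional K V]

/-- If `U` and `U'` meet in dimension at most one, then `U'` contains three vectors with dual
linear forms of which two vanish on `U`. -/
theorem exists_dual_family_of_finrank_inf_le_one {U U' : Submodule K V}
    (hinf : Module.finrank K (U ⊓ U' : Submodule K V) ≤ 1) (hU' : 3 ≤ Module.finrank K U') :
    ∃ u : Fin 3 → V, (∀ j, u j ∈ U') ∧ ∃ ξ : Fin 3 → Module.Dual K V,
      (∀ i j, ξ i (u j) = if i = j then 1 else 0) ∧ ∀ i, i ≠ 0 → ∀ v ∈ U, ξ i v = 0 := by
  -- A generator of the intersection, or any nonzero vector of U' if the intersection is zero.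
  obtain ⟨u₀, hu₀, hu₀0, hle⟩ : ∃ u₀ ∈ U', u₀ ≠ 0 ∧ U ⊓ U' ≤ Submodule.span K {u₀} := by
    by_cases hbot : U ⊓ U' = ⊥
    · have : U' ≠ ⊥ := fun h => by rw [h, finrank_bot] at hU'; omega
      obtain ⟨u₀, h1, h2⟩ := U'.ne_bot_iff.1 this
      exact ⟨u₀, h1, h2, hbot ▸ bot_le⟩
    · obtain ⟨u₀, h1, h2⟩ := (U ⊓ U').ne_bot_iff.1 hbot
      refine ⟨u₀, h1.2, h2, ?_⟩
      have h3 : Submodule.span K {u₀} ≤ U ⊓ U' := (Submodule.span_singleton_le_iff_mem _ _).2 h1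
      exact (Submodule.eq_of_le_of_finrank_le h3 (by rwa [finrank_span_singleton h2])).ge
  let N := U ⊔ Submodule.span K {u₀}
  let q := N.mkQ ∘ₗ U'.subtype
  have hker : Module.finrank K (LinearMap.ker q) ≤ 1 := by
    have h1 : (LinearMap.ker q).map U'.subtype ≤ Submodule.span K {u₀} := by
      rintro _ ⟨v, hv, rfl⟩
      have hv' : (v : V) ∈ N := (Submodule.Quotient.mk_eq_zero N).1 hv
      obtain ⟨a, ha, c, hc, hac⟩ := Submodule.mem_sup.1 hv'
      have hcU : c ∈ U' := (Submodule.span_singleton_le_iff_mem _ _).2 hu₀ hc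
      have haU : a ∈ U' := by
        rw [show a = v - c by rw [← hac, add_sub_cancel_right]]
        exact U'.sub_mem v.2 hcU
      change (v : V) ∈ _
      rw [← hac]
      exact Submodule.add_mem _ (hle ⟨ha, haU⟩) hc
    have h2 := Submodule.finrank_mono h1
    rwa [Submodule.finrank_map_subtype_eq, finrank_span_singleton hu₀0] at h2
  have hrange : 2 ≤ Module.finrank K (LinearMap.range q) := by
    have := LinearMap.finrank_range_add_finrank_ker q
    omega
  obtain ⟨f, hf⟩ := exists_linearIndependent_of_le_finrank hrange
  choose t ht using fun i => (f i).2
  have hf' := hf.map' (LinearMap.range q).subtype (LinearMap.range q).ker_subtype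
  obtain ⟨η, hη⟩ := exists_dual_family hf'
  have hηt : ∀ i j, η i (N.mkQ (t j)) = if i = j then 1 else 0 := fun i j => by
    rw [← hη i j]
    exact congrArg (η i) (ht j)
  have hηN : ∀ i, ∀ v ∈ N, η i (N.mkQ v) = 0 := fun i v hv => by
    rw [Submodule.mkQ_apply, (Submodule.Quotient.mk_eq_zero N).2 hv, map_zero]
  have hu₀N : u₀ ∈ N := le_sup_right (a := U) (Submodule.mem_span_singleton_self u₀)
  obtain ⟨θ, hθ⟩ := exists_dual_family (K := K) (v := fun _ : Fin 1 => u₀)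
    (LinearIndependent.of_subsingleton 0 hu₀0)
  have hθ : θ 0 u₀ = 1 := by simpa using hθ 0 0
  let ξ₁ : Module.Dual K V := η 0 ∘ₗ N.mkQ
  let ξ₂ : Module.Dual K V := η 1 ∘ₗ N.mkQ
  have e10 : ξ₁ u₀ = 0 := hηN 0 u₀ hu₀N
  have e20 : ξ₂ u₀ = 0 := hηN 1 u₀ hu₀N
  have e11 : ξ₁ (t 0) = 1 := (hηt 0 0).trans (if_pos rfl)
  have e12 : ξ₁ (t 1) = 0 := (hηt 0 1).trans (if_neg (by decide))
  have e21 : ξ₂ (t 0) = 0 := (hηt 1 0).trans (if_neg (by decide))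
  have e22 : ξ₂ (t 1) = 1 := (hηt 1 1).trans (if_pos rfl)
  refine ⟨![u₀, t 0, t 1], fun j => ?_,
    ![θ 0 - θ 0 (t 0) • ξ₁ - θ 0 (t 1) • ξ₂, ξ₁, ξ₂], fun i j => ?_, fun i hi v hv => ?_⟩
  · fin_cases j
    · exact hu₀
    · exact (t 0).2
    · exact (t 1).2
  · fin_cases i <;> fin_cases j <;> simp [hθ, e10, e20, e11, e12, e21, e22]
  · fin_cases i
    · exact absurd rfl hi
    · exact hηN 0 v (le_sup_left (a := U) hv)
    · exact hηN 1 v (le_sup_left (a := U) hv)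

end DualFamily

/-! ### The case of disjoint supports. -/

namespace BlockTensor

variable {K : Type*} [Field K] {n r : ℕ} {d : Fin r → ℕ} {B : BlockTensor K n d}
  {L : Submodule K ((Σ l, Fin (d l)) → K)} {h : Fin (n + 1) → K}

/-- The equations of the singular scheme on the linear space `A(·, y, ·) = 0`. -/
theorem aeval_linSubst_eq_zero
    (hpair : ∀ y ∈ L, ∀ z ∈ L, ∃ c : K, B.pair y z = c • h) {y : (Σ l, Fin (d l)) → K}
    (hy : y ∈ L) (hy0 : y ≠ 0) {τ : Type*} [Fintype τ] {u : τ → Fin (n + 1) → K}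
    (hu : ∀ j, u j ∈ B.kerSpace h y) {E : Type*} [CommRing E] [Algebra K E] {t : τ → E}
    (ht : ∀ l ∉ blockSupport y, aeval t (linSubst u (B.detForm l)) = 0)
    {p : MvPolynomial (Fin (n + 1)) K} (hp : p ∈ singIdeal (B.sectionEqs h)) :
    aeval t (linSubst u p) = 0 := by
  simp only [aeval_linSubst] at ht ⊢
  set x : Fin (n + 1) → E := fun i => ∑ j, algebraMap K E (u j i) * t j with hx
  have hx' : x = ∑ j, t j • fun i => algebraMap K E (u j i) := by
    ext i
    simp [hx, mul_comm]
  obtain ⟨c, hc⟩ := hpair y hy y hy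
  refine B.aeval_eq_zero_of_mem_singIdeal x (fun a => algebraMap K E (y a)) h (blockSupport y)
    (blockSupport_nonempty hy0) ?_ ?_ ⟨algebraMap K E c, fun i => ?_⟩ (fun l hl => ?_)
    (fun l hl => ?_) (Or.inl fun l hl j => ?_) hp
  · rw [hx', act_sum_left]
    refine Finset.sum_eq_zero fun j _ => ?_
    rw [act_smul_left, act_algebraMap, ((B.mem_kerSpace).1 (hu j)).2]
    funext a
    simp
  · simp only [hx, Finset.mul_sum]
    rw [Finset.sum_comm]
    refine Finset.sum_eq_zero fun j _ => ?_
    have := congrArg (algebraMap K E) ((B.mem_kerSpace).1 (hu j)).1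
    rw [map_sum, map_zero] at this
    simp_rw [← mul_assoc, ← map_mul, ← Finset.sum_mul]
    rw [this, zero_mul]
  · have := B.sum_blockPair_add_mul y 0 (0 : E) i
    simp only [zero_mul, add_zero, hc, ne_eq, OfNat.ofNat_ne_zero, not_false_eq_true, zero_pow,
      Pi.smul_apply, smul_eq_mul, map_mul] at this
    exact this
  · obtain ⟨j, hj⟩ := mem_blockSupport.1 hl
    exact ⟨j, hj.isUnit.map (algebraMap K E)⟩
  · rw [← aeval_detForm]
    exact ht l hl
  · rw [notMem_blockSupport.1 hl j, map_zero]

theorem linSubst_mem_of_mem_singIdeal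
    (hpair : ∀ y ∈ L, ∀ z ∈ L, ∃ c : K, B.pair y z = c • h) {y : (Σ l, Fin (d l)) → K}
    (hy : y ∈ L) (hy0 : y ≠ 0) {τ : Type*} [Fintype τ] {u : τ → Fin (n + 1) → K}
    (hu : ∀ j, u j ∈ B.kerSpace h y) {I : Ideal (MvPolynomial τ K)}
    (hI : ∀ l ∉ blockSupport y, linSubst u (B.detForm l) ∈ I)
    {p : MvPolynomial (Fin (n + 1)) K} (hp : p ∈ singIdeal (B.sectionEqs h)) :
    linSubst u p ∈ I := by
  have hmk : ∀ q : MvPolynomial τ K,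
      aeval (fun j => Ideal.Quotient.mkₐ K I (X j)) q = Ideal.Quotient.mkₐ K I q := fun q => by
    rw [← comp_aeval_apply, aeval_X_left_apply]
  refine Ideal.Quotient.eq_zero_iff_mem.1 ((hmk _).symm.trans
    (aeval_linSubst_eq_zero hpair hy hy0 hu (fun l hl => ?_) hp))
  rw [hmk]
  exact Ideal.Quotient.eq_zero_iff_mem.2 (hI l hl)

namespace IsContracted

/-- A vector supported in a single block would lie in a block space, which is proper because another
block exists. -/
theorem two_le_card_blockSupport (hB : B.IsContracted L h) {y : (Σ l, Fin (d l)) → K} (hy : y ∈ L)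
    (hy0 : y ≠ 0) {l' : Fin r} (hl' : l' ∉ blockSupport y) : 2 ≤ (blockSupport y).card := by
  by_contra! hlt
  have hpos := (blockSupport_nonempty hy0).card_pos
  obtain ⟨l, hl⟩ := Finset.card_eq_one.1 (show (blockSupport y).card = 1 by omega)
  have hne : l' ≠ l := fun h => hl' (by rw [hl, h]; exact Finset.mem_singleton_self l)
  have htop : blockSpace K d l ≠ ⊤ := fun h => by
    have := hB.two_le l'
    let a : Σ l, Fin (d l) := ⟨l', ⟨0, by omega⟩⟩
    have h1 : Pi.single a (1 : K) ∈ blockSpace K d l := h ▸ Submodule.mem_top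
    have h2 := h1 a hne
    simp at h2
  have hmem : y ∈ L ⊓ blockSpace K d l := ⟨hy, fun a ha => by
    have : a.1 ∉ blockSupport y := by rw [hl, Finset.mem_singleton]; exact ha
    exact notMem_blockSupport.1 this a.2⟩
  rw [hB.inf_blockSpace l htop, Submodule.mem_bot] at hmem
  exact hy0 hmem

theorem add_one_le (hB : B.IsContracted L h) {y : (Σ l, Fin (d l)) → K} (hy : y ∈ L)
    (hy0 : y ≠ 0) : n + 1 ≤ Module.finrank K (B.kerSpace h y) + ∑ l ∈ blockSupport y, d l := by
  refine B.add_le_finrank_kerSpace hB.ne_zero hB.pair_mem hy (fun _ : Fin 1 => y) (fun _ => hy)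
    (LinearIndependent.of_subsingleton 0 fun h0 => ?_)
  obtain ⟨l, hl⟩ := blockSupport_nonempty hy0
  obtain ⟨j, hj⟩ := mem_blockSupport.1 hl
  exact hj (congrFun h0 ⟨⟨l, j⟩, hl⟩)

variable [IsAlgClosed K]

/-- With c missed blocks the bounds give 2c ≤ c + 2. Without the assumption that supports meet, only
y itself is sure to restrict nontrivially to its support, which weakens the count by one. -/
theorem card_compl_le_two (hB : B.IsContracted L h) {y : (Σ l, Fin (d l)) → K} (hy : y ∈ L)
    (hy0 : y ≠ 0) : (blockSupport y)ᶜ.card ≤ 2 := by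
  have h1 := hB.add_one_le hy hy0
  have h2 := hB.finrank_le hy hy0
  have h3 := hB.sum_add_sum_compl_le (blockSupport y)
  have h4 := hB.two_mul_card_le (blockSupport y)ᶜ
  omega

/-- The support of y' has at least two blocks, and it lies in the complement of that of y, which has
at most two. -/
theorem compl_eq_of_disjoint (hB : B.IsContracted L h) {y y' : (Σ l, Fin (d l)) → K} (hy : y ∈ L)
    (hy0 : y ≠ 0) (hy' : y' ∈ L) (hy0' : y' ≠ 0)
    (hdisj : ∀ l ∈ blockSupport y, l ∉ blockSupport y') :
    (blockSupport y)ᶜ = blockSupport y' ∧ (blockSupport y)ᶜ.card = 2 := by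
  obtain ⟨l, hl⟩ := blockSupport_nonempty hy0
  have h1 := hB.two_le_card_blockSupport hy' hy0' (hdisj l hl)
  have h2 := hB.card_compl_le_two hy hy0
  have hsub : blockSupport y' ⊆ (blockSupport y)ᶜ := fun l hl =>
    Finset.mem_compl.2 fun hl' => hdisj l hl' hl
  have h3 := Finset.eq_of_subset_of_card_le hsub (h2.trans h1)
  exact ⟨h3.symm, le_antisymm h2 (h3 ▸ h1)⟩

/-- At a point of both kernels y' provides a kernel vector in each block missed by y, so all
equations hold and the point is singular on `X ∩ H`; only finitely many such points exist. -/
theorem finrank_inf_le_one (hB : B.IsContracted L h) {y y' : (Σ l, Fin (d l)) → K} (hy : y ∈ L)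
    (hy0 : y ≠ 0) (hcompl : (blockSupport y)ᶜ = blockSupport y') :
    Module.finrank K (B.kerSpace h y ⊓ B.kerSpace h y' : Submodule K (Fin (n + 1) → K)) ≤ 1 := by
  by_contra! hlt
  refine not_projFinite_of_card_add_one_lt (B.kerSpace h y ⊓ B.kerSpace h y')
    (Fin.elim0 : Fin 0 → MvPolynomial (Fin (n + 1)) K) (fun i => i.elim0) ?_
    (hB.sing_finite.subset fun x hx p hp => B.eval_eq_zero_of_mem_kerSpace hB.pair_mem hy
      hy0 hx.1.1 (fun l hl => ?_) hp)
  · simpa [Nat.card_eq_fintype_card] using hlt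
  · have hl' : l ∈ blockSupport y' := hcompl ▸ Finset.mem_compl.2 hl
    obtain ⟨j, hj⟩ := mem_blockSupport.1 hl'
    rw [eval_detForm]
    refine det_eq_zero_of_mulVec_eq_zero (z := fun j => y' ⟨l, j⟩) ?_ hj.isUnit
    ext j
    exact congrFun hx.1.2.2 ⟨l, j⟩

/-- The restriction of the equations of the singular scheme to a plane `A(·, y, ·) = 0`. -/
theorem exists_four_le_hilbertFn (hB : B.IsContracted L h) {y : (Σ l, Fin (d l)) → K} (hy : y ∈ L)
    (hy0 : y ≠ 0) (hcard : (blockSupport y)ᶜ.card = 2) {u : Fin 3 → Fin (n + 1) → K}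
    (hu : ∀ j, u j ∈ B.kerSpace h y) :
    ∃ I : Ideal (MvPolynomial (Fin 3) K),
      (∀ p ∈ singIdeal (B.sectionEqs h), linSubst u p ∈ I) ∧ ∀ e, 4 ≤ hilbertFn I (e + 4) := by
  obtain ⟨l₁, l₂, hne, hcompl⟩ := Finset.card_eq_two.1 hcard
  have hsum : ∑ l ∈ (blockSupport y)ᶜ, d l ≤ 4 := by
    have h1 := hB.add_one_le hy hy0
    have h2 := hB.finrank_le hy hy0
    have h3 := hB.sum_add_sum_compl_le (blockSupport y)
    omega
  rw [hcompl, Finset.sum_pair hne] at hsum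
  have h1 := hB.two_le l₁
  have h2 := hB.two_le l₂
  have hd₁ : d l₁ = 2 := by omega
  have hd₂ : d l₂ = 2 := by omega
  refine ⟨Ideal.span {linSubst u (B.detForm l₁), linSubst u (B.detForm l₂)}, fun p hp =>
    linSubst_mem_of_mem_singIdeal hB.pair_mem hy hy0 hu (fun l hl => ?_) hp,
    four_le_hilbertFn (isHomogeneous_linSubst u (hd₁ ▸ B.isHomogeneous_detForm l₁))
      (isHomogeneous_linSubst u (hd₂ ▸ B.isHomogeneous_detForm l₂))⟩
  have hl' : l ∈ ({l₁, l₂} : Finset (Fin r)) := hcompl ▸ Finset.mem_compl.2 hl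
  rw [Finset.mem_insert, Finset.mem_singleton] at hl'
  rcases hl' with rfl | rfl
  · exact Ideal.subset_span (by simp)
  · exact Ideal.subset_span (by simp)

/-- The case in which two vectors of `L` have disjoint block supports. -/
theorem exists_isZeroDimOfDegree_of_disjoint (hB : B.IsContracted L h)
    {y y' : (Σ l, Fin (d l)) → K} (hy : y ∈ L) (hy0 : y ≠ 0) (hy' : y' ∈ L) (hy0' : y' ≠ 0)
    (hdisj : ∀ l ∈ blockSupport y, l ∉ blockSupport y') :
    ∃ I : Ideal (MvPolynomial (Fin (n + 1)) K), IsHomogeneousIdeal I ∧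
      singIdeal (B.sectionEqs h) ≤ I ∧ IsZeroDimOfDegree I n := by
  obtain ⟨hc, hcard⟩ := hB.compl_eq_of_disjoint hy hy0 hy' hy0' hdisj
  obtain ⟨hc', hcard'⟩ := hB.compl_eq_of_disjoint hy' hy0' hy hy0 fun l hl hl' => hdisj l hl' hl
  have h1 := hB.add_one_le hy hy0
  have h1' := hB.add_one_le hy' hy0'
  have h2 := hB.finrank_le hy hy0
  have h2' := hB.finrank_le hy' hy0'
  have h3 := hB.sum_add_sum_compl_le (blockSupport y)
  have h4 := hB.two_mul_card_le (blockSupport y)ᶜ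
  have h4' := hB.two_mul_card_le (blockSupport y')ᶜ
  rw [hc] at h3 h4
  rw [hc'] at h4'
  rw [hcard] at h2
  rw [hcard'] at h2'
  rw [← hc, hcard, hc] at h4
  rw [← hc', hcard', hc'] at h4'
  obtain ⟨f, hf⟩ := exists_linearIndependent_of_le_finrank
    (show 3 ≤ Module.finrank K (B.kerSpace h y) by omega)
  obtain ⟨ζ, hζ⟩ := exists_dual_family
    (hf.map' (B.kerSpace h y).subtype (B.kerSpace h y).ker_subtype)
  obtain ⟨u', hu', ξ, hξ, hξu⟩ := exists_dual_family_of_finrank_inf_le_one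
    (hB.finrank_inf_le_one hy hy0 hc) (show 3 ≤ Module.finrank K (B.kerSpace h y') by omega)
  obtain ⟨I, hI, hI4⟩ := hB.exists_four_le_hilbertFn hy hy0 hcard (fun j => (f j).2)
  obtain ⟨I', hI', hI4'⟩ := hB.exists_four_le_hilbertFn hy' hy0' hcard' hu'
  -- The inequalities force n = 6 and both kernels of dimension 3. Two schemes of Hilbert function
  -- at least 4, in planes that share at most a point, give at least 4 + 4 - 1 = 7.
  refine exists_isZeroDimOfDegree_of_projFinite (B.isHomogeneousIdeal_singIdeal_sectionEqs h)
    hB.sing_finite (e₀ := 4) fun e he => ?_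
  obtain ⟨e, rfl⟩ := Nat.exists_eq_add_of_le' he
  have h5 := hilbertFn_add_hilbertFn_le hI hI' hζ hξ (fun i hi j => hξu i hi _ (f j).2) (e + 4)
  have h6 := hI4 e
  have h6' := hI4' e
  omega

end IsContracted

end BlockTensor

/-! ### Polarization, base change and the conclusion. -/

namespace BlockTensor

variable {K : Type*} [Field K] {n r : ℕ} {d : Fin r → ℕ}

theorem pair_add_left (B : BlockTensor K n d) (y y' z : (Σ l, Fin (d l)) → K) :
    B.pair (y + y') z = B.pair y z + B.pair y' z := by
  ext i
  exact add_dotProduct _ _ _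

theorem pair_add_right (B : BlockTensor K n d) (y z z' : (Σ l, Fin (d l)) → K) :
    B.pair y (z + z') = B.pair y z + B.pair y z' := by
  ext i
  simp [pair, Matrix.mulVec_add]

theorem pair_comm (B : BlockTensor K n d) (y z : (Σ l, Fin (d l)) → K) :
    B.pair y z = B.pair z y := by
  ext i
  simp only [pair_eq_sum_blockPair, blockPair]
  refine Finset.sum_congr rfl fun l _ => ?_
  rw [Finset.sum_comm]
  refine Finset.sum_congr rfl fun p _ => Finset.sum_congr rfl fun q _ => ?_
  rw [(B.symm l i).apply, mul_comm (y _)]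

/-- Polarization. -/
theorem exists_pair_eq_smul_of_psi (B : BlockTensor K n d) (h2 : (2 : K) ≠ 0)
    {L : Submodule K ((Σ l, Fin (d l)) → K)} {h : Fin (n + 1) → K}
    (hL : ∀ y ∈ L, ∃ c : K, B.psi y = c • h) :
    ∀ y ∈ L, ∀ z ∈ L, ∃ c : K, B.pair y z = c • h := by
  intro y hy z hz
  obtain ⟨a, ha⟩ := hL y hy
  obtain ⟨b, hb⟩ := hL z hz
  obtain ⟨c, hc⟩ := hL (y + z) (L.add_mem hy hz)
  refine ⟨(2 : K)⁻¹ * (c - a - b), ?_⟩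
  rw [psi] at ha hb hc
  rw [pair_add_left, pair_add_right, pair_add_right, ha, hb, B.pair_comm z y] at hc
  have h1 : (2 : K) • B.pair y z = (c - a - b) • h := by
    rw [two_smul, sub_smul, sub_smul, ← hc]
    abel
  rw [mul_smul, ← h1, smul_smul, inv_mul_cancel₀ h2, one_smul]

theorem aeval_quadric {k : Type*} [Field k] [Algebra k K] (A : BlockTensor k n d) (i : Fin (n + 1))
    (y : (Σ l, Fin (d l)) → K) : aeval y (A.quadric i) = (A.baseChange K).psi y i := by
  rw [← eval_quadric]
  have : map (algebraMap k K) (A.quadric i) = (A.baseChange K).quadric i := by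
    simp only [quadric, dotProduct, Matrix.mulVec, map_sum, map_mul, map_X, Matrix.map_apply, map_C]
    refine Finset.sum_congr rfl fun a _ => ?_
    congr 1
    refine Finset.sum_congr rfl fun b _ => ?_
    congr 2
    by_cases hab : a.1 = b.1
    · obtain ⟨l, p⟩ := a
      obtain ⟨l', q⟩ := b
      obtain rfl : l = l' := hab
      simp [bigSlice, baseChange, Matrix.blockDiagonal'_apply_eq]
    · simp [bigSlice, baseChange, Matrix.blockDiagonal'_apply, hab]
  rw [← this, eval_map, aeval_def]

theorem finrank_eq_two_of_isSecant {B : BlockTensor K n d}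
    {L : Submodule K ((Σ l, Fin (d l)) → K)} (hL : B.IsSecant L) : Module.finrank K L = 2 := by
  obtain ⟨p, q, hli, rfl, -⟩ := hL
  have := finrank_span_eq_card hli
  rwa [Matrix.range_cons_cons_empty, Fintype.card_fin] at this

end BlockTensor

theorem mainTheorem2 {k K : Type*} [Field k] [Field K] [Algebra k K] [IsAlgClosure k K]
    (h2 : (2 : k) ≠ 0) (h3 : (3 : k) ≠ 0)
    {n r : ℕ} {d : Fin r → ℕ} (A : BlockTensor k n d)
    -- standing assumptions on block-diagonal tensors
    (hd : ∀ l, 2 ≤ d l) (hirr : ∀ l, Irreducible (A.detForm l))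
    -- the Cayley variety is 0-dimensional and `X` is a complete intersection
    (hC : HasProjDim A.cayleyIdeal 0) (hX : A.IsCompleteIntersection)
    -- a (geometric) secant line that does not meet the block spaces; the condition is void
    -- when there is only one block, whose block space is everything
    (L : Submodule K ((Σ l, Fin (d l)) → K)) (hL : (A.baseChange K).IsSecant L)
    (hblock : ∀ l, BlockTensor.blockSpace K d l ≠ ⊤ →
      L ⊓ BlockTensor.blockSpace K d l = ⊥)
    -- the hyperplane `H = Z(h)` with `[H] = ψ(ℓ)`
    (h : Fin (n + 1) → K) (hH : (A.baseChange K).PsiImageEq L h)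
    -- no essential and no coincident singularities of `X` on `X ∩ H`
    (hsing : ∀ x : Fin (n + 1) → K, x ≠ 0 → (A.baseChange K).OnX x →
      MvPolynomial.eval x (linForm h) = 0 →
      ¬ (A.baseChange K).IsEssential x ∧ ¬ (A.baseChange K).IsCoincident x) :
    ∃ I : Ideal (MvPolynomial (Fin (n + 1)) K),
      IsHomogeneousIdeal I ∧
      singIdeal ((A.baseChange K).sectionEqs h) ≤ I ∧
      IsZeroDimOfDegree I n := by
  have : IsAlgClosed K := IsAlgClosure.isAlgClosed k
  have : Algebra.IsAlgebraic k K := IsAlgClosure.isAlgebraic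
  set B := A.baseChange K with hBdef
  -- With infinitely many singular points, n of them already form a subscheme of degree n; all
  -- finiteness arguments are confined to the other case.
  by_cases hfin : ProjFinite (K := K) {x | ∀ p ∈ singIdeal (B.sectionEqs h), eval x p = 0}
  swap
  · exact exists_isZeroDimOfDegree_of_not_projFinite
      (B.isHomogeneousIdeal_singIdeal_sectionEqs h) hfin n
  have h2K : (2 : K) ≠ 0 := fun h0 => h2 ((algebraMap k K).injective (by
    rw [map_ofNat, h0, map_zero]))
  have hcayley : ProjFinite (K := K) {y | B.psi y = 0} := by
    refine (projFinite_zeroLocus_of_ringKrullDim_le_one A.quadric (fun _ => 2)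
      A.isHomogeneous_quadric ?_).subset fun y hy i => ?_
    · exact (show _ = _ from hC).le.trans (by simp)
    · rw [BlockTensor.aeval_quadric]
      exact congrFun hy i
  have hB : B.IsContracted L h :=
    { two_le := hd
      finrank_eq := BlockTensor.finrank_eq_two_of_isSecant hL
      ne_zero := hH.1
      pair_mem := B.exists_pair_eq_smul_of_psi h2K hH.2.1
      cayley_finite := hcayley
      sing_finite := hfin
      inf_blockSpace := hblock
      not_essential := fun x hx0 hxX hx => (hsing x hx0 hxX (by simpa [linForm] using hx)).1 }
  by_cases hmeet : BlockTensor.SupportsMeet L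
  · exact hB.exists_isZeroDimOfDegree_of_supportsMeet hmeet
  · simp only [BlockTensor.SupportsMeet] at hmeet
    push Not at hmeet
    obtain ⟨y, hy, hy0, y', hy', hy0', hdisj⟩ := hmeet
    exact hB.exists_isZeroDimOfDegree_of_disjoint hy hy0 hy' hy0' hdisj
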